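/- Let $d\ge 2$, $\Omega=(0,1)^d$, $0<p,q\le\infty$, $s>d/p$, let $\mathcal B=B^s_q(L_p(\Omega))$, and let $r$ be an integer with $r>\max(s,1)$. Here $\mathcal B$ is the set of real functions $f\in L_p(\Omega)$ with $$|f|_{\mathcal B}:=\Big[\int_0^1\big(t^{-s}\omega_{r(s)}(f,t)_p\big)^q\,\frac{dt}{t}\Big]^{1/q}<\infty$$ (the supremum of $t^{-s}\omega_{r(s)}(f,t)_p$ over $0<t\le1$ if $q=\infty$), where $r(s)$ is the smallest integer strictly larger than $\max(s,1)$, $\omega_n(f,t)_p:=\sup_{|h|\le t}\|\Delta^n_h f\|_{L_p(\Omega_{nh})}$, $\Delta_h^n f:=(-1)^n\sum_{i=0}^n(-1)^i\binom ni f(\cdot+ih)$, and $\Omega_h:=\{x\in\Omega:[x,x+h]\subset\Omega\}$; its (quasi-)norm is $\|f\|_{\mathcal B}:=\|f\|_{L_p(\Omega)}+|f|_{\mathcal B}$. For $k\ge0$ let $G_{k,r}\subset[0,1]^d$ be the uniform tensor product grid with spacing $2^{-k}(r-1)^{-1}$ (including the end points), let $\widetilde m:=|G_{k,r}|$, and for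 a continuous function $f$ on $[0,1]^d$ put $$\|f\|^*_{L_\tau}:=\Big[\frac1{\widetilde m}\sum_{x\in G_{k,r}}|f(x)|^\tau\Big]^{1/\tau}\quad(1\le\tau<\infty),\qquad \|f\|^*_{L_\infty}:=\max_{x\in G_{k,r}}|f(x)|.$$ Then every $f\in\mathcal B$ agrees a.e. on $\Omega$ with a continuous function on $[0,1]^d$ (with which $f$ is identified in $\|f\|^*_{L_\tau}$), and for all $1\le\tau\le\infty$ and $k\ge0$, $$\|f\|_{L_\tau(\Omega)}\le C_1\|f\|^*_{L_\tau}+C_2\|f\|_{\mathcal B}\,\widetilde m^{-\alpha_\tau},\qquad \|f\|^*_{L_\tau}\le C_1\|f\|_{L_\tau(\Omega)}+C_2\|f\|_{\mathcal B}\,\widetilde m^{-\alpha_\tau},$$ where $\alpha_\tau:=\frac sd-\big(\frac1p-\frac1\tau\big)_+$. The constant $C_1$ depends only on $r$ and $d$. The constant $C_2$ depends only on $r$, $d$ and a positive lower bound $\delta$ for $s-d/p$: for each $\delta>0$ one $C_2$ serves all $s,p,q$ as above with $s-d/p\ge\delta$, and all $f$, $\tau$ and $k$. -/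

import Mathlib

open MeasureTheory Set
open scoped ENNReal NNReal

noncomputable section

namespace BesovGrid

/-- The open unit cube `Ω = (0,1)^d`, inside `ℝ^d` with the Euclidean norm. -/
def openCube (d : ℕ) : Set (EuclideanSpace ℝ (Fin d)) :=
  {x | ∀ i, x i ∈ Ioo (0 : ℝ) 1}

/-- The closed unit cube `[0,1]^d`. -/
def closedCube (d : ℕ) : Set (EuclideanSpace ℝ (Fin d)) :=
  {x | ∀ i, x i ∈ Icc (0 : ℝ) 1}

/-- Lebesgue measure on `Ω = (0,1)^d`. -/
def cubeMeasure (d : ℕ) : Measure (EuclideanSpace ℝ (Fin d)) :=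
  volume.restrict (openCube d)

/-- `Ω_h`: the points `x ∈ Ω` for which the whole segment `[x, x + h]` lies in `Ω`. -/
def shrunkCube (d : ℕ) (h : EuclideanSpace ℝ (Fin d)) : Set (EuclideanSpace ℝ (Fin d)) :=
  {x | x ∈ openCube d ∧ segment ℝ x (x + h) ⊆ openCube d}

/-- The `r`-th difference of `f` with step `h`:
`Δ_h^r(f, x) = (-1)^r ∑_{k=0}^r (-1)^k (r choose k) f(x + k h)`. -/
def difference {d : ℕ} (r : ℕ) (h : EuclideanSpace ℝ (Fin d))
    (f : EuclideanSpace ℝ (Fin d) → ℝ) (x : EuclideanSpace ℝ (Fin d)) : ℝ :=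
  (-1) ^ r * ∑ k ∈ Finset.range (r + 1), (-1) ^ k * (r.choose k : ℝ) * f (x + (k : ℝ) • h)

/-- The modulus of smoothness
`ω_r(f, t)_p = sup_{|h| ≤ t} ‖Δ_h^r(f, ·)‖_{L_p(Ω_{rh})}`, as an extended nonnegative number. -/
def modulus {d : ℕ} (r : ℕ) (p : ℝ≥0∞) (f : EuclideanSpace ℝ (Fin d) → ℝ) (t : ℝ) : ℝ≥0∞ :=
  ⨆ (h : EuclideanSpace ℝ (Fin d)) (_ : ‖h‖ ≤ t),
    eLpNorm (difference r h f) p (volume.restrict (shrunkCube d ((r : ℝ) • h)))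

/-- `r(s)`, the smallest integer strictly larger than `max s 1`. -/
def besovOrder (s : ℝ) : ℕ := ⌊max s 1⌋₊ + 1

/-- The Besov (quasi-)seminorm `|f|_{B_q^s(L_p(Ω))} = (∫_0^1 [t^{-s} ω_{r(s)}(f,t)_p]^q dt/t)^{1/q}`,
with the supremum over `0 < t ≤ 1` in place of the integral when `q = ∞`. -/
def besovSeminorm {d : ℕ} (s : ℝ) (p q : ℝ≥0∞) (f : EuclideanSpace ℝ (Fin d) → ℝ) : ℝ≥0∞ :=
  if q = ∞ then
    ⨆ (t : ℝ) (_ : t ∈ Ioc (0 : ℝ) 1), ENNReal.ofReal (t ^ (-s)) * modulus (besovOrder s) p f t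
  else
    (∫⁻ t in Ioc (0 : ℝ) 1,
      (ENNReal.ofReal (t ^ (-s)) * modulus (besovOrder s) p f t) ^ q.toReal
        * ENNReal.ofReal t⁻¹) ^ (1 / q.toReal)

/-- The Besov (quasi-)norm `‖f‖_{B_q^s(L_p(Ω))} = ‖f‖_{L_p(Ω)} + |f|_{B_q^s(L_p(Ω))}`. -/
def besovNorm {d : ℕ} (s : ℝ) (p q : ℝ≥0∞) (f : EuclideanSpace ℝ (Fin d) → ℝ) : ℝ≥0∞ :=
  eLpNorm f p (cubeMeasure d) + besovSeminorm s p q f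

/-- Membership in `B_q^s(L_p(Ω))`. Only the values of `f` on `Ω`, up to null sets, matter. -/
def MemBesov {d : ℕ} (s : ℝ) (p q : ℝ≥0∞) (f : EuclideanSpace ℝ (Fin d) → ℝ) : Prop :=
  MemLp f p (cubeMeasure d) ∧ besovSeminorm s p q f < ∞

open Classical in
/-- The uniform tensor product grid `G_{k,r}` of `[0,1]^d` with spacing `2^{-k} (r-1)^{-1}`
(used for `r ≥ 2`). -/
def grid (d r k : ℕ) : Finset (EuclideanSpace ℝ (Fin d)) :=
  Finset.univ.image fun j : Fin d → Fin ((r - 1) * 2 ^ k + 1) =>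
    WithLp.toLp 2 fun i => ((j i : ℕ) : ℝ) / (((r : ℝ) - 1) * 2 ^ k)

/-- The discrete norm of `f` on the grid `G_{k,r}`: the normalized `ℓ_τ` norm
`(m⁻¹ ∑_{x ∈ G_{k,r}} |f(x)|^τ)^{1/τ}`, `m = |G_{k,r}|`, and the maximum of `|f|` on the grid when
`τ = ∞`. -/
def discreteNorm {d : ℕ} (r k : ℕ) (τ : ℝ≥0∞) (f : EuclideanSpace ℝ (Fin d) → ℝ) : ℝ≥0∞ :=
  if τ = ∞ then
    (grid d r k).sup fun x => ‖f x‖ₑ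
  else
    (((grid d r k).card : ℝ≥0∞)⁻¹ * ∑ x ∈ grid d r k, ‖f x‖ₑ ^ τ.toReal) ^ (1 / τ.toReal)

/-- The exponent `α_τ = s/d - (1/p - 1/τ)_+`, with `1/∞ = 0`. -/
def rate (d : ℕ) (s : ℝ) (p τ : ℝ≥0∞) : ℝ :=
  s / d - max ((p⁻¹).toReal - (τ⁻¹).toReal) 0

end BesovGrid

end

namespace BesovGrid

/-! ### The unit cube -/

/-! The cube is cut into dyadic cells of side 2^{-k}. On a cell, a continuous function whose n-th
differences are small at every point (n being the order in the seminorm) is controlled by its values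
at the r^d nodes, and each of its values is controlled by values at n points on a segment towards
any other point of the cell. Each statement costs one error per cell. The Besov condition bounds
differences only in an L_p mean, possibly with p < 1, so the main work is to pass from smallness in
measure to smallness at every point.

For this passage, `extrap` combines f(x+h), ..., f(x+nh) and reproduces f(x) up to the n-th
difference. Let the step point from x to an arbitrary y in the cube, with length of order 2^{-l}.
Under `SmallDiff` the differences exceed B β^l only on a set of (point, step) pairs of measure η
4^{-ld}. The gap between two extrapolated values at x is a combination of n-th differences
(`extrap_sub_extrap`), so for most y, z they agree up to a multiple of B β^l. The values at level l
therefore cluster, the clusters converge geometrically in l, and their limit defines g(x) at every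
point of the closed cube. This g is continuous and equals f a.e. Its differences are small
everywhere, because extrapolating with steps in arithmetic progression turns differences of
extrapolated values into differences of f (`sum_extrap_eq`). The outcome is
`exists_continuous_of_smallDiff`.

Control by the nodes (`exists_abs_le_cubeNode`) comes from interpolation in one variable on dyadic
intervals shrinking to a point: successive interpolants differ by O(β^j), and coordinates are
treated one at a time. The factor in front of the nodal value is the d-th power of a bound for a
single interpolation operator. It does not involve β, which is why C₁ depends on r and d alone. In
the other direction, `abs_le_sum_segment` is integrated over the free end point of the segment.

After rescaling to the cells, Chebyshev's inequality yields `SmallDiff` with B^P equal to a weighted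
sum over levels of the P-energies of the differences, where P = p, or an auxiliary finite exponent
if p = ∞. With β = 2^{-δ/4} the margin s - d/p ≥ δ makes this sum geometric. For finite p, adding
over cells recovers the global modulus, so the errors have normalized ℓ_p size at most a constant
times 2^{-ks} |f| (`exists_local_errors`); for p = ∞ this bound holds in each cell. Passing from ℓ_p
to ℓ_τ over N = 2^{kd} cells costs N^{(1/p-1/τ)_+}, and this gives the exponent α_τ. -/

theorem openCube_subset_closedCube (d : ℕ) : openCube d ⊆ closedCube d :=
  fun _ hx i => ⟨(hx i).1.le, (hx i).2.le⟩

theorem convex_openCube (d : ℕ) : Convex ℝ (openCube d) := by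
  intro x hx y hy a b ha hb hab i
  exact convex_Ioo (0 : ℝ) 1 (hx i) (hy i) ha hb hab

theorem convex_closedCube (d : ℕ) : Convex ℝ (closedCube d) := by
  intro x hx y hy a b ha hb hab i
  exact convex_Icc (0 : ℝ) 1 (hx i) (hy i) ha hb hab

theorem isOpen_openCube (d : ℕ) : IsOpen (openCube d) := by
  have : openCube d = ⋂ i, {x : EuclideanSpace ℝ (Fin d) | x i ∈ Ioo (0 : ℝ) 1} := by
    ext x; simp [openCube]
  rw [this]
  exact isOpen_iInter_of_finite fun i => isOpen_Ioo.preimage (by fun_prop)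

theorem isClosed_closedCube (d : ℕ) : IsClosed (closedCube d) := by
  have : closedCube d = ⋂ i, {x : EuclideanSpace ℝ (Fin d) | x i ∈ Icc (0 : ℝ) 1} := by
    ext x; simp [closedCube]
  rw [this]
  exact isClosed_iInter fun i => isClosed_Icc.preimage (by fun_prop)

theorem measurableSet_openCube (d : ℕ) : MeasurableSet (openCube d) :=
  (isOpen_openCube d).measurableSet

theorem volume_openCube (d : ℕ) : volume (openCube d) = 1 := by
  have h := (EuclideanSpace.volume_preserving_symm_measurableEquiv_toLp (Fin d)).measure_preimage
    (s := Set.pi univ fun _ => Ioo (0 : ℝ) 1)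
    (MeasurableSet.univ_pi fun _ => measurableSet_Ioo).nullMeasurableSet
  have e : (⇑(MeasurableEquiv.toLp 2 (Fin d → ℝ)).symm ⁻¹' Set.pi univ fun _ => Ioo (0 : ℝ) 1)
      = openCube d := by
    ext x; simp [openCube]
  rw [e] at h
  rw [h, Real.volume_pi_Ioo]; simp

instance isProbabilityMeasure_cubeMeasure (d : ℕ) : IsProbabilityMeasure (cubeMeasure d) :=
  ⟨by rw [cubeMeasure, Measure.restrict_apply_univ, volume_openCube]⟩

theorem cubeMeasure_compl_openCube (d : ℕ) : cubeMeasure d (openCube d)ᶜ = 0 := by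
  rw [cubeMeasure, Measure.restrict_apply (measurableSet_openCube d).compl]; simp

theorem volume_openCube_prod (d : ℕ) : volume (openCube d ×ˢ openCube d) = 1 := by
  rw [Measure.volume_eq_prod, Measure.prod_prod, volume_openCube, one_mul]

/-- Moving from a point of the closed cube towards a point of the open cube leads into
the open cube. -/
theorem add_smul_sub_mem_openCube {d : ℕ} {x y : EuclideanSpace ℝ (Fin d)} (hx : x ∈ closedCube d)
    (hy : y ∈ openCube d) {t : ℝ} (h0 : 0 < t) (h1 : t ≤ 1) : x + t • (y - x) ∈ openCube d := by
  intro i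
  have hx1 := (hx i).1
  have hx2 := (hx i).2
  have hy1 := (hy i).1
  have hy2 := (hy i).2
  simp only [PiLp.add_apply, PiLp.smul_apply, PiLp.sub_apply, smul_eq_mul, mem_Ioo]
  constructor <;> nlinarith [mul_pos h0 hy1, mul_pos h0 (sub_pos.2 hy2)]

theorem norm_sub_le_of_mem_closedCube {d : ℕ} {x y : EuclideanSpace ℝ (Fin d)}
    (hx : x ∈ closedCube d) (hy : y ∈ closedCube d) : ‖y - x‖ ≤ d := by
  have h1 : ∑ i, ‖(y - x) i‖ ^ 2 ≤ (d : ℝ) := by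
    calc ∑ i, ‖(y - x) i‖ ^ 2 ≤ ∑ _i : Fin d, (1 : ℝ) := by
          refine Finset.sum_le_sum fun i _ => ?_
          have hx1 := (hx i).1
          have hx2 := (hx i).2
          have hy1 := (hy i).1
          have hy2 := (hy i).2
          rw [Real.norm_eq_abs, sq_abs, PiLp.sub_apply]
          nlinarith
      _ = d := by simp
  rw [EuclideanSpace.norm_eq]
  rcases Nat.eq_zero_or_pos d with h | h
  · subst h; simp
  · refine Real.sqrt_le_iff.2 ⟨by positivity, h1.trans ?_⟩
    have : (1 : ℝ) ≤ d := by exact_mod_cast h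
    nlinarith

theorem center_mem_openCube (d : ℕ) :
    (WithLp.toLp 2 fun _ => (1 / 2 : ℝ)) ∈ openCube d := by
  intro i; simp; norm_num

theorem closedCube_subset_closure (d : ℕ) : closedCube d ⊆ closure (openCube d) := by
  intro x hx
  set c : EuclideanSpace ℝ (Fin d) := WithLp.toLp 2 fun _ => (1 / 2 : ℝ)
  have ht : Filter.Tendsto (fun t : ℝ => x + t • (c - x)) (nhdsWithin 0 (Ioi 0)) (nhds x) := by
    have : Continuous fun t : ℝ => x + t • (c - x) := by fun_prop
    have h := (this.tendsto 0).mono_left (nhdsWithin_le_nhds (s := Ioi 0))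
    simpa using h
  refine mem_closure_of_tendsto ht ?_
  have h1 : ∀ᶠ t : ℝ in nhdsWithin 0 (Ioi 0), t < 1 :=
    nhdsWithin_le_nhds (Iio_mem_nhds (by norm_num))
  filter_upwards [h1, self_mem_nhdsWithin] with t h1 h0
  exact add_smul_sub_mem_openCube hx (center_mem_openCube d) h0 h1.le

theorem shrunkCube_eq (d : ℕ) (h : EuclideanSpace ℝ (Fin d)) :
    shrunkCube d h = {x | x ∈ openCube d ∧ x + h ∈ openCube d} := by
  ext x
  refine and_congr_right fun hx => ⟨fun hs => hs (right_mem_segment ℝ _ _), fun hh => ?_⟩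
  exact (convex_openCube d).segment_subset hx hh

/-- Two functions continuous on the closed cube which agree a.e. agree everywhere on it. -/
theorem eqOn_closedCube_of_ae_eq {d : ℕ} {f g : EuclideanSpace ℝ (Fin d) → ℝ}
    (hf : ContinuousOn f (closedCube d)) (hg : ContinuousOn g (closedCube d))
    (h : f =ᵐ[cubeMeasure d] g) : EqOn f g (closedCube d) := by
  have h1 : EqOn f g (openCube d) := by
    refine Measure.eqOn_of_ae_eq h (hf.mono (openCube_subset_closedCube d))
      (hg.mono (openCube_subset_closedCube d)) ?_
    rw [(isOpen_openCube d).interior_eq]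
    exact subset_closure
  exact h1.of_subset_closure hf hg (openCube_subset_closedCube d) (closedCube_subset_closure d)

/-! ### Change of variables and selection of good points -/

theorem volume_preimage_smul_add {d : ℕ} {a : ℝ} (ha : 0 < a) (c : EuclideanSpace ℝ (Fin d))
    (T : Set (EuclideanSpace ℝ (Fin d))) :
    volume {x | a • x + c ∈ T} = ENNReal.ofReal ((a⁻¹) ^ d) * volume T := by
  have e : {x | a • x + c ∈ T} = (fun x => a • x) ⁻¹' ((fun x => x + c) ⁻¹' T) := rfl
  rw [e, Measure.addHaar_preimage_smul _ ha.ne', measure_preimage_add_right,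
      finrank_euclideanSpace_fin, inv_pow, abs_of_pos (by positivity)]

/-- The volume of the preimage of a set under a triangular affine map of `ℝ^d × ℝ^d`. -/
theorem volume_preimage_triangular {d : ℕ} {a b : ℝ} (ha : 0 < a) (hb : 0 < b)
    (c : EuclideanSpace ℝ (Fin d)) {β : EuclideanSpace ℝ (Fin d) → EuclideanSpace ℝ (Fin d)}
    (hβ : Measurable β) {S : Set (EuclideanSpace ℝ (Fin d) × EuclideanSpace ℝ (Fin d))}
    (hS : MeasurableSet S) :
    volume {z : EuclideanSpace ℝ (Fin d) × EuclideanSpace ℝ (Fin d) |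
        (a • z.1 + c, b • z.2 + β z.1) ∈ S}
      = ENNReal.ofReal ((a⁻¹) ^ d * (b⁻¹) ^ d) * volume S := by
  have hm : Measurable fun z : EuclideanSpace ℝ (Fin d) × EuclideanSpace ℝ (Fin d) =>
      (a • z.1 + c, b • z.2 + β z.1) := by fun_prop
  have hm' : MeasurableSet {z : EuclideanSpace ℝ (Fin d) × EuclideanSpace ℝ (Fin d) |
      (a • z.1 + c, b • z.2 + β z.1) ∈ S} := hm hS
  have hmap : Measure.map (fun x : EuclideanSpace ℝ (Fin d) => a • x + c) volume
      = ENNReal.ofReal ((a⁻¹) ^ d) • volume := by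
    ext T hT
    exact (Measure.map_apply (by fun_prop) hT).trans (volume_preimage_smul_add ha c T)
  have hSm := measurable_measure_prodMk_left (ν := (volume : Measure (EuclideanSpace ℝ (Fin d)))) hS
  -- On each fibre the second component is a dilation followed by a translation, and the translation
  -- does not affect volume.
  rw [Measure.volume_eq_prod, Measure.prod_apply hm', Measure.prod_apply hS]
  have e1 : ∀ x : EuclideanSpace ℝ (Fin d), volume (Prod.mk x ⁻¹'
      {z : EuclideanSpace ℝ (Fin d) × EuclideanSpace ℝ (Fin d) |
        (a • z.1 + c, b • z.2 + β z.1) ∈ S})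
      = ENNReal.ofReal ((b⁻¹) ^ d) * volume (Prod.mk (a • x + c) ⁻¹' S) := by
    intro x
    exact volume_preimage_smul_add hb (β x) (Prod.mk (a • x + c) ⁻¹' S)
  have e2 : ∫⁻ x : EuclideanSpace ℝ (Fin d), volume (Prod.mk (a • x + c) ⁻¹' S)
      = ENNReal.ofReal ((a⁻¹) ^ d) * ∫⁻ x, volume (Prod.mk x ⁻¹' S) := by
    rw [← lintegral_map (f := fun x => volume (Prod.mk x ⁻¹' S)) hSm
      (by fun_prop : Measurable fun x : EuclideanSpace ℝ (Fin d) => a • x + c), hmap,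
      lintegral_smul_measure]; rfl
  calc _ = ∫⁻ x, ENNReal.ofReal ((b⁻¹) ^ d) * volume (Prod.mk (a • x + c) ⁻¹' S) :=
        lintegral_congr e1
    _ = ENNReal.ofReal ((b⁻¹) ^ d) * ∫⁻ x, volume (Prod.mk (a • x + c) ⁻¹' S) := by
        rw [lintegral_const_mul]
        exact hSm.comp (by fun_prop)
    _ = _ := by
        rw [e2, ← mul_assoc, ← ENNReal.ofReal_mul (by positivity), mul_comm (b⁻¹ ^ d)]

theorem exists_mem_notMem_of_measure_lt {α : Type*} [MeasurableSpace α] {μ : Measure α}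
    {s t : Set α} (h : μ t < μ s) : ∃ x ∈ s, x ∉ t := by
  by_contra hc
  push Not at hc
  exact absurd (measure_mono (μ := μ) hc) (not_le.2 h)

/-! ### Extrapolation -/

/-- The weights `(-1)^k (n choose k)`. -/
def wt (n k : ℕ) : ℝ := (-1) ^ k * (n.choose k : ℝ)

/-- The value at `x` extrapolated from the values at `x + h, …, x + n h`. -/
def extrap {d : ℕ} (n : ℕ) (h : EuclideanSpace ℝ (Fin d))
    (f : EuclideanSpace ℝ (Fin d) → ℝ) (x : EuclideanSpace ℝ (Fin d)) : ℝ :=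
  -∑ k ∈ Finset.Icc 1 n, wt n k * f (x + (k : ℝ) • h)

theorem sum_range_succ_eq_add_Icc (n : ℕ) (a : ℕ → ℝ) :
    ∑ k ∈ Finset.range (n + 1), a k = a 0 + ∑ k ∈ Finset.Icc 1 n, a k := by
  rw [Finset.sum_range_succ', add_comm, Finset.sum_bij (fun i _ => i + 1)]
  · intro i hi; simp at hi ⊢; omega
  · intro i _ j _ h; simpa using h
  · intro b hb; simp at hb; exact ⟨b - 1, by simp; omega, by omega⟩
  · intros; rfl

theorem difference_eq {d : ℕ} (n : ℕ) (h : EuclideanSpace ℝ (Fin d))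
    (f : EuclideanSpace ℝ (Fin d) → ℝ) (x : EuclideanSpace ℝ (Fin d)) :
    difference n h f x = (-1) ^ n * ∑ k ∈ Finset.range (n + 1), wt n k * f (x + (k : ℝ) • h) := rfl

theorem difference_eq_sub_extrap {d : ℕ} (n : ℕ) (h : EuclideanSpace ℝ (Fin d))
    (f : EuclideanSpace ℝ (Fin d) → ℝ) (x : EuclideanSpace ℝ (Fin d)) :
    (-1) ^ n * difference n h f x = f x - extrap n h f x := by
  rw [difference_eq, ← mul_assoc, ← mul_pow, sum_range_succ_eq_add_Icc, extrap]
  simp [wt]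

theorem abs_sub_extrap {d : ℕ} (n : ℕ) (h : EuclideanSpace ℝ (Fin d))
    (f : EuclideanSpace ℝ (Fin d) → ℝ) (x : EuclideanSpace ℝ (Fin d)) :
    |f x - extrap n h f x| = |difference n h f x| := by
  rw [← difference_eq_sub_extrap, abs_mul]; simp

theorem abs_wt (n k : ℕ) : |wt n k| = n.choose k := by
  simp [wt, abs_mul]

theorem abs_sum_range_wt_le (n : ℕ) (a : ℕ → ℝ) (M : ℝ) (h : ∀ k ≤ n, |a k| ≤ M) :
    |∑ k ∈ Finset.range (n + 1), wt n k * a k| ≤ 2 ^ n * M := by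
  calc |∑ k ∈ Finset.range (n + 1), wt n k * a k|
      ≤ ∑ k ∈ Finset.range (n + 1), |wt n k * a k| := Finset.abs_sum_le_sum_abs _ _
    _ ≤ ∑ k ∈ Finset.range (n + 1), (n.choose k : ℝ) * M := by
        refine Finset.sum_le_sum fun k hk => ?_
        rw [abs_mul, abs_wt]
        exact mul_le_mul_of_nonneg_left (h k (by simp at hk; omega)) (by positivity)
    _ = 2 ^ n * M := by
        rw [← Finset.sum_mul]
        congr 1
        exact_mod_cast Nat.sum_range_choose n

theorem abs_sum_Icc_wt_le (n : ℕ) (a : ℕ → ℝ) (M : ℝ) (hM : 0 ≤ M)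
    (h : ∀ k, 1 ≤ k → k ≤ n → |a k| ≤ M) :
    |∑ k ∈ Finset.Icc 1 n, wt n k * a k| ≤ 2 ^ n * M := by
  have := abs_sum_range_wt_le n (fun k => if k = 0 then 0 else a k) M (by
    intro k hk
    by_cases h0 : k = 0
    · simpa [h0]
    · simpa [h0] using h k (by omega) hk)
  rw [sum_range_succ_eq_add_Icc] at this
  simp only [if_true, mul_zero, zero_add] at this
  refine le_trans (le_of_eq ?_) this
  congr 1
  refine Finset.sum_congr rfl fun k hk => ?_
  have : k ≠ 0 := by simp at hk; omega
  simp [this]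

/-- The double sum over the values f(x + j h₁ + i h₂) is symmetric in the two steps and cancels.
What is left are the errors of extrapolating f at the sample points themselves. -/
theorem extrap_sub_extrap {d : ℕ} (n : ℕ) (h₁ h₂ : EuclideanSpace ℝ (Fin d))
    (f : EuclideanSpace ℝ (Fin d) → ℝ) (x : EuclideanSpace ℝ (Fin d)) :
    extrap n h₁ f x - extrap n h₂ f x =
      -(∑ j ∈ Finset.Icc 1 n, wt n j * ((-1) ^ n * difference n h₂ f (x + (j : ℝ) • h₁)))
      + ∑ i ∈ Finset.Icc 1 n, wt n i * ((-1) ^ n * difference n h₁ f (x + (i : ℝ) • h₂)) := by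
  simp only [difference_eq_sub_extrap]
  simp only [mul_sub, Finset.sum_sub_distrib]
  have e : ∑ j ∈ Finset.Icc 1 n, wt n j * extrap n h₂ f (x + (j : ℝ) • h₁)
      = ∑ i ∈ Finset.Icc 1 n, wt n i * extrap n h₁ f (x + (i : ℝ) • h₂) := by
    simp only [extrap, mul_neg, Finset.mul_sum, Finset.sum_neg_distrib]
    rw [Finset.sum_comm]
    congr 1
    refine Finset.sum_congr rfl fun i _ => Finset.sum_congr rfl fun j _ => ?_
    rw [show x + (j : ℝ) • h₁ + (i : ℝ) • h₂ = x + (i : ℝ) • h₂ + (j : ℝ) • h₁ by abel]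
    ring
  rw [e]
  simp only [extrap]
  ring

/-- Differences of extrapolated values with steps in arithmetic progression are
combinations of differences of the function. -/
theorem sum_extrap_eq {d : ℕ} (n : ℕ) (h u v : EuclideanSpace ℝ (Fin d))
    (f : EuclideanSpace ℝ (Fin d) → ℝ) (x : EuclideanSpace ℝ (Fin d)) :
    (-1) ^ n * ∑ i ∈ Finset.range (n + 1),
        wt n i * extrap n (u + (i : ℝ) • v) f (x + (i : ℝ) • h)
      = -∑ j ∈ Finset.Icc 1 n, wt n j *
        difference n (h + (j : ℝ) • v) f (x + (j : ℝ) • u) := by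
  simp only [extrap, difference_eq, mul_neg, Finset.mul_sum, Finset.sum_neg_distrib]
  rw [Finset.sum_comm]
  congr 1
  refine Finset.sum_congr rfl fun j _ => Finset.sum_congr rfl fun i _ => ?_
  -- Since the steps u + i v are affine in i, for fixed j the sample points run through an
  -- arithmetic progression with step h + j v.
  rw [show x + (i : ℝ) • h + (j : ℝ) • (u + (i : ℝ) • v)
    = x + (j : ℝ) • u + (i : ℝ) • (h + (j : ℝ) • v) by module]
  ring

theorem measurable_difference {d : ℕ} (n : ℕ) {f : EuclideanSpace ℝ (Fin d) → ℝ}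
    (hf : Measurable f) : Measurable fun z : EuclideanSpace ℝ (Fin d) × EuclideanSpace ℝ (Fin d) =>
      difference n z.2 f z.1 := by
  unfold difference
  fun_prop

theorem measurable_extrap {d : ℕ} (n : ℕ) {f : EuclideanSpace ℝ (Fin d) → ℝ}
    (hf : Measurable f) : Measurable fun z : EuclideanSpace ℝ (Fin d) × EuclideanSpace ℝ (Fin d) =>
      extrap n z.2 f z.1 := by
  unfold extrap
  fun_prop

/-! ### Smallness of differences in measure -/

/-- The largest length of the steps used at level `l`. -/
noncomputable def scale (l : ℕ) : ℝ := (1 / 2) ^ l / 8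

/-- The contraction ratio used at level `l`. -/
noncomputable def ratio (d n l : ℕ) : ℝ := scale l / (4 * n * d)

theorem scale_pos (l : ℕ) : 0 < scale l := by unfold scale; positivity

theorem scale_le (l : ℕ) : scale l ≤ 1 / 8 := by
  unfold scale
  have : ((1 : ℝ) / 2) ^ l ≤ 1 := pow_le_one₀ (by norm_num) (by norm_num)
  linarith

theorem ratio_pos {d n : ℕ} (hd : 1 ≤ d) (hn : 1 ≤ n) (l : ℕ) : 0 < ratio d n l := by
  have := scale_pos l
  unfold ratio; positivity

theorem ratio_mul {d n : ℕ} (hd : 1 ≤ d) (hn : 1 ≤ n) (l : ℕ) :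
    ratio d n l * (n * d) = scale l / 4 := by
  unfold ratio; field_simp

theorem mul_ratio_le {d n : ℕ} (hd : 1 ≤ d) (hn : 1 ≤ n) (l : ℕ) {j : ℕ} (hj : j ≤ n) :
    j * ratio d n l ≤ 1 / 32 := by
  have h1 := ratio_mul hd hn l
  have h2 := scale_le l
  have h3 := (ratio_pos hd hn l).le
  have hd' : (1 : ℝ) ≤ d := by exact_mod_cast hd
  have hj' : (j : ℝ) ≤ n := by exact_mod_cast hj
  have hn' : (1 : ℝ) ≤ n := by exact_mod_cast hn
  have : (j : ℝ) ≤ n * d := by nlinarith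
  nlinarith [mul_le_mul_of_nonneg_left this h3]

theorem ratio_mul_dim_le {d n : ℕ} (hd : 1 ≤ d) (hn : 1 ≤ n) (l : ℕ) :
    ratio d n l * d ≤ scale l / 4 := by
  have h1 := ratio_mul hd hn l
  have h3 := (ratio_pos hd hn l).le
  have hn' : (1 : ℝ) ≤ n := by exact_mod_cast hn
  have hd' : (0 : ℝ) ≤ d := by positivity
  nlinarith [mul_le_mul_of_nonneg_right hn' (mul_nonneg h3 hd')]

theorem ratio_inv {d n : ℕ} (l : ℕ) :
    (ratio d n l)⁻¹ = 32 * n * d * 2 ^ l := by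
  unfold ratio scale
  rw [inv_div, div_div_eq_mul_div, one_div, inv_pow, div_inv_eq_mul]
  ring

/-- The pairs (point, step) at which the `n`-th difference of `f` exceeds `b`. -/
def badSet {d : ℕ} (n : ℕ) (f : EuclideanSpace ℝ (Fin d) → ℝ) (ρ b : ℝ) :
    Set (EuclideanSpace ℝ (Fin d) × EuclideanSpace ℝ (Fin d)) :=
  {z | z.1 ∈ openCube d ∧ z.1 + (n : ℝ) • z.2 ∈ openCube d ∧ ‖z.2‖ ≤ ρ ∧
    b < |difference n z.2 f z.1|}

/-- At each level `l`, the differences of `f` with steps of length at most `scale l` exceed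
`B β^l` only on a small set. -/
def SmallDiff {d : ℕ} (n : ℕ) (f : EuclideanSpace ℝ (Fin d) → ℝ) (η β B : ℝ) : Prop :=
  ∀ l : ℕ, volume (badSet n f (scale l) (B * β ^ l)) ≤ ENNReal.ofReal (η * ((1 / 4) ^ l) ^ d)

theorem measurableSet_badSet {d : ℕ} (n : ℕ) {f : EuclideanSpace ℝ (Fin d) → ℝ}
    (hf : Measurable f) (ρ b : ℝ) : MeasurableSet (badSet n f ρ b) := by
  have h1 : MeasurableSet {z : EuclideanSpace ℝ (Fin d) × EuclideanSpace ℝ (Fin d) |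
      z.1 ∈ openCube d} := measurable_fst (measurableSet_openCube d)
  have h2 : MeasurableSet {z : EuclideanSpace ℝ (Fin d) × EuclideanSpace ℝ (Fin d) |
      z.1 + (n : ℝ) • z.2 ∈ openCube d} :=
    (by fun_prop : Measurable fun z : EuclideanSpace ℝ (Fin d) × EuclideanSpace ℝ (Fin d) =>
      z.1 + (n : ℝ) • z.2) (measurableSet_openCube d)
  have h3 : MeasurableSet {z : EuclideanSpace ℝ (Fin d) × EuclideanSpace ℝ (Fin d) |
      ‖z.2‖ ≤ ρ} := measurableSet_le (by fun_prop) (by fun_prop)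
  have h4 : MeasurableSet {z : EuclideanSpace ℝ (Fin d) × EuclideanSpace ℝ (Fin d) |
      b < |difference n z.2 f z.1|} :=
    measurableSet_lt (by fun_prop) (by
      simpa [Real.norm_eq_abs] using (measurable_difference n hf).norm)
  exact h1.inter (h2.inter (h3.inter h4))

theorem add_smul_sub_add_smul_sub_mem_openCube {d : ℕ} {x y z : EuclideanSpace ℝ (Fin d)}
    (hx : x ∈ closedCube d) (hy : y ∈ openCube d) (hz : z ∈ openCube d) {a b : ℝ} (ha : 0 < a)
    (hb : 0 < b) (hab : a + b ≤ 1) : x + a • (y - x) + b • (z - x) ∈ openCube d := by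
  intro i
  have hx1 := (hx i).1
  have hx2 := (hx i).2
  have hy1 := (hy i).1
  have hy2 := (hy i).2
  have hz1 := (hz i).1
  have hz2 := (hz i).2
  simp only [PiLp.add_apply, PiLp.smul_apply, PiLp.sub_apply, smul_eq_mul, mem_Ioo]
  constructor <;>
  nlinarith [mul_pos ha hy1, mul_pos ha (sub_pos.2 hy2), mul_pos hb hz1, mul_pos hb (sub_pos.2 hz2),
    mul_nonneg (sub_nonneg.2 hab) hx1, mul_nonneg (sub_nonneg.2 hab) (sub_nonneg.2 hx2)]

/-! ### Clusters of extrapolated values and their limit -/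

section

variable {d n : ℕ} {f : EuclideanSpace ℝ (Fin d) → ℝ} {η β B : ℝ}

/-- The pair (y, z) is mapped affinely to (base point, step) with dilation factors j θ_a and θ_b, so
volumes grow by at most (32 n d)^{2d} 2^{(a+b)d}. For a ≤ b + 1 the factor 4^{-bd} in `SmallDiff`
compensates this up to 2^d, and the bound does not depend on the level. -/
theorem volume_bad_pairs_le (hd : 1 ≤ d) (hn : 1 ≤ n) (hf : Measurable f) (hη : 0 ≤ η)
    (hs : SmallDiff n f η β B) {x : EuclideanSpace ℝ (Fin d)} (hx : x ∈ closedCube d)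
    {a b j : ℕ} (hab : a ≤ b + 1) (h1j : 1 ≤ j) (hj : j ≤ n) :
    volume {z : EuclideanSpace ℝ (Fin d) × EuclideanSpace ℝ (Fin d) |
      z.1 ∈ openCube d ∧ z.2 ∈ openCube d ∧
      B * β ^ b < |difference n (ratio d n b • (z.2 - x)) f
        (x + (j : ℝ) • ratio d n a • (z.1 - x))|}
    ≤ ENNReal.ofReal (η * (2 * (32 * n * d) ^ 2) ^ d) := by
  have hra := ratio_pos hd hn a
  have hrb := ratio_pos hd hn b
  have hj0 : (0 : ℝ) < j := by exact_mod_cast h1j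
  have hja : 0 < j * ratio d n a := by positivity
  have hsub : {z : EuclideanSpace ℝ (Fin d) × EuclideanSpace ℝ (Fin d) |
      z.1 ∈ openCube d ∧ z.2 ∈ openCube d ∧
      B * β ^ b < |difference n (ratio d n b • (z.2 - x)) f
        (x + (j : ℝ) • ratio d n a • (z.1 - x))|} ⊆
      {z | ((j * ratio d n a) • z.1 + (x - (j * ratio d n a) • x),
        ratio d n b • z.2 + (fun _ => -(ratio d n b • x)) z.1) ∈ badSet n f (scale b) (B * β ^ b)} := by
    rintro ⟨y, z⟩ ⟨hy, hz, hb⟩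
    simp only at hy hz hb
    have e1 : (j * ratio d n a) • y + (x - (j * ratio d n a) • x)
        = x + (j : ℝ) • ratio d n a • (y - x) := by module
    have e2 : ratio d n b • z + -(ratio d n b • x) = ratio d n b • (z - x) := by module
    simp only [mem_ofPred_eq, badSet]
    rw [e1, e2]
    have hle := mul_ratio_le hd hn a hj
    have hle' := mul_ratio_le hd hn b (le_refl n)
    refine ⟨?_, ?_, ?_, hb⟩
    · rw [smul_smul]
      exact add_smul_sub_mem_openCube hx hy hja (by linarith)
    · rw [smul_smul, smul_smul]
      exact add_smul_sub_add_smul_sub_mem_openCube hx hy hz hja (by positivity) (by linarith)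
    · rw [norm_smul, Real.norm_of_nonneg hrb.le]
      calc ratio d n b * ‖z - x‖ ≤ ratio d n b * d :=
            mul_le_mul_of_nonneg_left
              (norm_sub_le_of_mem_closedCube hx (openCube_subset_closedCube d hz)) hrb.le
        _ ≤ scale b := (ratio_mul_dim_le hd hn b).trans (by linarith [scale_pos b])
  refine (measure_mono hsub).trans ?_
  rw [volume_preimage_triangular hja hrb _ measurable_const (measurableSet_badSet n hf _ _)]
  refine (mul_le_mul_right (hs b) _).trans ?_
  rw [← ENNReal.ofReal_mul (by positivity)]
  refine ENNReal.ofReal_le_ofReal ?_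
  have e : ((j * ratio d n a)⁻¹) ^ d * ((ratio d n b)⁻¹) ^ d * (η * ((1 / 4) ^ b) ^ d)
      = η * ((j * ratio d n a)⁻¹ * (ratio d n b)⁻¹ * (1 / 4) ^ b) ^ d := by
    rw [mul_pow, mul_pow]; ring
  rw [e]
  refine mul_le_mul_of_nonneg_left (pow_le_pow_left₀ (by positivity) ?_ d) hη
  rw [mul_inv, ratio_inv, ratio_inv]
  have hj1 : (j : ℝ)⁻¹ ≤ 1 := inv_le_one_of_one_le₀ (by exact_mod_cast h1j)
  have h2 : (2 : ℝ) ^ a ≤ 2 ^ (b + 1) := pow_le_pow_right₀ (by norm_num) hab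
  have h4 : (2 : ℝ) ^ b * 2 ^ b * (1 / 4) ^ b = 1 := by
    rw [← mul_pow, ← mul_pow]; norm_num
  calc (j : ℝ)⁻¹ * (32 * n * d * 2 ^ a) * (32 * n * d * 2 ^ b) * (1 / 4) ^ b
      ≤ 1 * (32 * n * d * 2 ^ (b + 1)) * (32 * n * d * 2 ^ b) * (1 / 4) ^ b := by gcongr
    _ = 2 * (32 * n * d) ^ 2 * (2 ^ b * 2 ^ b * (1 / 4) ^ b) := by ring
    _ = _ := by rw [h4, mul_one]

/-- The extrapolated values from two independent configurations mostly agree. -/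
theorem volume_extrap_sub_extrap_le (hd : 1 ≤ d) (hn : 1 ≤ n) (hf : Measurable f) (hη : 0 ≤ η)
    (hB : 0 ≤ B) (hβ : 0 < β) (hβ1 : β < 1)
    (hs : SmallDiff n f η β B) {x : EuclideanSpace ℝ (Fin d)} (hx : x ∈ closedCube d)
    {l m : ℕ} (hlm : l ≤ m) (hml : m ≤ l + 1) :
    volume {z : EuclideanSpace ℝ (Fin d) × EuclideanSpace ℝ (Fin d) |
      z.1 ∈ openCube d ∧ z.2 ∈ openCube d ∧
      2 ^ (n + 1) * (B * β ^ l) < |extrap n (ratio d n l • (z.1 - x)) f x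
        - extrap n (ratio d n m • (z.2 - x)) f x|}
    ≤ ENNReal.ofReal (2 * n * (η * (2 * (32 * n * d) ^ 2) ^ d)) := by
  set T : ℕ → ℕ → ℕ → Set (EuclideanSpace ℝ (Fin d) × EuclideanSpace ℝ (Fin d)) :=
    fun a b j => {z | z.1 ∈ openCube d ∧ z.2 ∈ openCube d ∧
      B * β ^ b < |difference n (ratio d n b • (z.2 - x)) f
        (x + (j : ℝ) • ratio d n a • (z.1 - x))|} with hT
  set M := ENNReal.ofReal (η * (2 * (32 * n * d) ^ 2) ^ d) with hM
  have hsub : {z : EuclideanSpace ℝ (Fin d) × EuclideanSpace ℝ (Fin d) |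
      z.1 ∈ openCube d ∧ z.2 ∈ openCube d ∧
      2 ^ (n + 1) * (B * β ^ l) < |extrap n (ratio d n l • (z.1 - x)) f x
        - extrap n (ratio d n m • (z.2 - x)) f x|} ⊆
      (⋃ j ∈ Finset.Icc 1 n, T l m j) ∪ ⋃ i ∈ Finset.Icc 1 n, Prod.swap ⁻¹' T m l i := by
    rintro ⟨y, z⟩ ⟨hy, hz, hlt⟩
    simp only at hy hz hlt
    by_contra hc
    simp only [mem_union, mem_iUnion, not_or, not_exists, mem_preimage, Prod.swap_prod_mk,
      Finset.mem_Icc] at hc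
    obtain ⟨hc1, hc2⟩ := hc
    have hBl : 0 ≤ B * β ^ l := by positivity
    have hml' : B * β ^ m ≤ B * β ^ l :=
      mul_le_mul_of_nonneg_left (pow_le_pow_of_le_one hβ.le hβ1.le hlm) hB
    rw [extrap_sub_extrap] at hlt
    have b1 : ∀ k, 1 ≤ k → k ≤ n → |(-1) ^ n * difference n (ratio d n m • (z - x)) f
        (x + (k : ℝ) • ratio d n l • (y - x))| ≤ B * β ^ l := by
      intro k h1 h2
      have := hc1 k ⟨h1, h2⟩
      simp only [hT, mem_ofPred_eq, not_and, not_lt] at this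
      rw [abs_mul, abs_pow, abs_neg, abs_one, one_pow, one_mul]
      exact (this hy hz).trans hml'
    have b2 : ∀ k, 1 ≤ k → k ≤ n → |(-1) ^ n * difference n (ratio d n l • (y - x)) f
        (x + (k : ℝ) • ratio d n m • (z - x))| ≤ B * β ^ l := by
      intro k h1 h2
      have := hc2 k ⟨h1, h2⟩
      simp only [hT, mem_ofPred_eq, not_and, not_lt] at this
      rw [abs_mul, abs_pow, abs_neg, abs_one, one_pow, one_mul]
      exact this hz hy
    have c1 := abs_sum_Icc_wt_le n _ _ hBl b1
    have c2 := abs_sum_Icc_wt_le n _ _ hBl b2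
    refine absurd hlt (not_lt.2 ((abs_add_le _ _).trans ?_))
    rw [abs_neg, pow_succ]
    linarith
  have m1 : ∀ j ∈ Finset.Icc 1 n, volume (T l m j) ≤ M := fun j hj => by
    rw [Finset.mem_Icc] at hj
    exact volume_bad_pairs_le hd hn hf hη hs hx (by omega) hj.1 hj.2
  have m2 : ∀ j ∈ Finset.Icc 1 n, volume (Prod.swap ⁻¹' T m l j) ≤ M := fun j hj => by
    rw [Finset.mem_Icc] at hj
    have e : volume (Prod.swap ⁻¹' T m l j) = volume (T m l j) :=
      (Measure.measurePreserving_swap (μ := (volume : Measure (EuclideanSpace ℝ (Fin d))))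
        (ν := (volume : Measure (EuclideanSpace ℝ (Fin d))))).measure_preimage_equiv
          (f := MeasurableEquiv.prodComm) _
    rw [e]
    exact volume_bad_pairs_le hd hn hf hη hs hx (by omega) hj.1 hj.2
  calc _ ≤ _ := measure_mono hsub
    _ ≤ _ := measure_union_le _ _
    _ ≤ ∑ j ∈ Finset.Icc 1 n, volume (T l m j)
        + ∑ j ∈ Finset.Icc 1 n, volume (Prod.swap ⁻¹' T m l j) :=
        add_le_add (measure_biUnion_finset_le _ _) (measure_biUnion_finset_le _ _)
    _ ≤ ∑ _j ∈ Finset.Icc 1 n, M + ∑ _j ∈ Finset.Icc 1 n, M :=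
        add_le_add (Finset.sum_le_sum m1) (Finset.sum_le_sum m2)
    _ = _ := by
        simp only [Finset.sum_const, Nat.card_Icc, Nat.add_sub_cancel, nsmul_eq_mul]
        rw [ENNReal.ofReal_mul (p := 2 * (n : ℝ)) (by positivity),
          ENNReal.ofReal_mul (by norm_num), ENNReal.ofReal_natCast, ENNReal.ofReal_ofNat]
        ring

theorem measurable_extrap_left (hf : Measurable f) (θ : ℝ) (x : EuclideanSpace ℝ (Fin d)) :
    Measurable fun y => extrap n (θ • (y - x)) f x :=
  (measurable_extrap n hf).comp
    (by fun_prop : Measurable fun y : EuclideanSpace ℝ (Fin d) => (x, θ • (y - x)))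

/-- A value at `x` with which most extrapolated values at level `l` agree. -/
theorem exists_extrap_value (hd : 1 ≤ d) (hn : 1 ≤ n) (hf : Measurable f) (hη : 0 ≤ η)
    (hB : 0 ≤ B) (hβ : 0 < β) (hβ1 : β < 1)
    (hs : SmallDiff n f η β B) {x : EuclideanSpace ℝ (Fin d)} (hx : x ∈ closedCube d) (l : ℕ) :
    ∃ m : ℝ, volume {y | y ∈ openCube d ∧
      2 ^ (n + 1) * (B * β ^ l) < |m - extrap n (ratio d n l • (y - x)) f x|}
      ≤ ENNReal.ofReal (2 * n * (η * (2 * (32 * n * d) ^ 2) ^ d)) := by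
  set S := {z : EuclideanSpace ℝ (Fin d) × EuclideanSpace ℝ (Fin d) |
      z.1 ∈ openCube d ∧ z.2 ∈ openCube d ∧
      2 ^ (n + 1) * (B * β ^ l) < |extrap n (ratio d n l • (z.1 - x)) f x
        - extrap n (ratio d n l • (z.2 - x)) f x|} with hS
  have hvol := volume_extrap_sub_extrap_le hd hn hf hη hB hβ hβ1 hs hx (le_refl l) (Nat.le_succ l)
  have hA := measurable_extrap_left (n := n) hf (ratio d n l) x
  have hSm : MeasurableSet S := by
    have h := ((hA.comp measurable_fst).sub (hA.comp (measurable_snd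
      (α := EuclideanSpace ℝ (Fin d)) (β := EuclideanSpace ℝ (Fin d))))).norm
    exact (measurable_fst (measurableSet_openCube d)).inter
      ((measurable_snd (measurableSet_openCube d)).inter
        (measurableSet_lt (measurable_const (a := 2 ^ (n + 1) * (B * β ^ l))) h))
  have hF := measurable_measure_prodMk_left (ν := (volume : Measure (EuclideanSpace ℝ (Fin d)))) hSm
  -- Some y in the cube has a slice of `S` no larger than the average slice; the value extrapolated
  -- along this y serves as m.
  obtain ⟨y, hy, hle⟩ := exists_notMem_null_le_lintegral (μ := cubeMeasure d) hF.aemeasurable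
    (cubeMeasure_compl_openCube d)
  rw [notMem_compl_iff] at hy
  refine ⟨extrap n (ratio d n l • (y - x)) f x, ?_⟩
  have e : {y' | y' ∈ openCube d ∧ 2 ^ (n + 1) * (B * β ^ l)
      < |extrap n (ratio d n l • (y - x)) f x - extrap n (ratio d n l • (y' - x)) f x|}
      = Prod.mk y ⁻¹' S := by
    ext y'; simp [hS, hy]
  rw [e]
  refine hle.trans (le_trans ?_ hvol)
  rw [Measure.volume_eq_prod, Measure.prod_apply hSm]
  exact lintegral_mono' Measure.restrict_le_self le_rfl

theorem volume_fst_mem_le (T : Set (EuclideanSpace ℝ (Fin d))) :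
    volume {z : EuclideanSpace ℝ (Fin d) × EuclideanSpace ℝ (Fin d) |
      z.1 ∈ T ∧ z.2 ∈ openCube d} ≤ volume T := by
  have : {z : EuclideanSpace ℝ (Fin d) × EuclideanSpace ℝ (Fin d) |
      z.1 ∈ T ∧ z.2 ∈ openCube d} = T ×ˢ openCube d := rfl
  rw [this, Measure.volume_eq_prod, Measure.prod_prod, volume_openCube, mul_one]

theorem volume_snd_mem_le (T : Set (EuclideanSpace ℝ (Fin d))) :
    volume {z : EuclideanSpace ℝ (Fin d) × EuclideanSpace ℝ (Fin d) |
      z.1 ∈ openCube d ∧ z.2 ∈ T} ≤ volume T := by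
  have : {z : EuclideanSpace ℝ (Fin d) × EuclideanSpace ℝ (Fin d) |
      z.1 ∈ openCube d ∧ z.2 ∈ T} = openCube d ×ˢ T := rfl
  rw [this, Measure.volume_eq_prod, Measure.prod_prod, volume_openCube, one_mul]

/-- The limit of the extrapolated values. -/
theorem exists_limit_value (hd : 1 ≤ d) (hn : 1 ≤ n) (hf : Measurable f) (hη : 0 ≤ η)
    (hB : 0 ≤ B) (hβ : 0 < β) (hβ1 : β < 1)
    (hη1 : 2 * n * (η * (2 * (32 * n * d) ^ 2) ^ d) < 1 / 4)
    (hs : SmallDiff n f η β B) {x : EuclideanSpace ℝ (Fin d)} (hx : x ∈ closedCube d) :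
    ∃ m : ℝ, ∀ l, volume {y | y ∈ openCube d ∧
      2 ^ (n + 1) * (1 + 3 / (1 - β)) * (B * β ^ l)
        < |m - extrap n (ratio d n l • (y - x)) f x|}
      ≤ ENNReal.ofReal (2 * n * (η * (2 * (32 * n * d) ^ 2) ^ d)) := by
  set η₁ := 2 * n * (η * (2 * (32 * n * d) ^ 2) ^ d) with hη₁
  have hη₁0 : 0 ≤ η₁ := by positivity
  choose m hm using fun l => exists_extrap_value hd hn hf hη hB hβ hβ1 hs hx l
  -- The exceptional sets for level l, for level l + 1 and for the comparison of the two levels have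
  -- total measure below 3/4, so one pair (y, z) avoids all three and links m l with m (l + 1).
  have hstep : ∀ l, dist (m l) (m (l + 1)) ≤ 3 * 2 ^ (n + 1) * B * β ^ l := by
    intro l
    have h3 := volume_extrap_sub_extrap_le hd hn hf hη hB hβ hβ1 hs hx (Nat.le_succ l) le_rfl
    set T₁ := {y | y ∈ openCube d ∧
      2 ^ (n + 1) * (B * β ^ l) < |m l - extrap n (ratio d n l • (y - x)) f x|} with hT₁
    set T₂ := {y | y ∈ openCube d ∧
      2 ^ (n + 1) * (B * β ^ (l + 1))
        < |m (l + 1) - extrap n (ratio d n (l + 1) • (y - x)) f x|} with hT₂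
    set T₃ := {z : EuclideanSpace ℝ (Fin d) × EuclideanSpace ℝ (Fin d) |
      z.1 ∈ openCube d ∧ z.2 ∈ openCube d ∧
      2 ^ (n + 1) * (B * β ^ l) < |extrap n (ratio d n l • (z.1 - x)) f x
        - extrap n (ratio d n (l + 1) • (z.2 - x)) f x|} with hT₃
    have hlt : volume ({z : EuclideanSpace ℝ (Fin d) × EuclideanSpace ℝ (Fin d) |
        z.1 ∈ T₁ ∧ z.2 ∈ openCube d} ∪ ({z | z.1 ∈ openCube d ∧ z.2 ∈ T₂} ∪ T₃))
        < volume (openCube d ×ˢ openCube d) := by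
      rw [volume_openCube_prod]
      calc _ ≤ ENNReal.ofReal η₁ + (ENNReal.ofReal η₁ + ENNReal.ofReal η₁) := by
            refine (measure_union_le _ _).trans (add_le_add ((volume_fst_mem_le _).trans (hm l)) ?_)
            exact (measure_union_le _ _).trans
              (add_le_add ((volume_snd_mem_le _).trans (hm (l + 1))) h3)
        _ < 1 := by
            rw [← ENNReal.ofReal_add hη₁0 hη₁0, ← ENNReal.ofReal_add hη₁0 (by positivity),
              ENNReal.ofReal_lt_one]
            linarith
    obtain ⟨⟨y, z⟩, ⟨hy, hz⟩, hn'⟩ := exists_mem_notMem_of_measure_lt hlt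
    simp only at hy hz
    simp only [mem_union, not_or, mem_ofPred_eq, hT₁, hT₂, hT₃, hy, hz, true_and, and_true,
      not_lt] at hn'
    obtain ⟨a1, a2, a3⟩ := hn'
    have hle : 2 ^ (n + 1) * (B * β ^ (l + 1)) ≤ 2 ^ (n + 1) * (B * β ^ l) := by
      have := pow_le_pow_of_le_one hβ.le hβ1.le (Nat.le_succ l)
      gcongr
    rw [Real.dist_eq]
    have : |m l - m (l + 1)| ≤ 2 ^ (n + 1) * (B * β ^ l) + 2 ^ (n + 1) * (B * β ^ l)
        + 2 ^ (n + 1) * (B * β ^ l) := by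
      rw [abs_le] at a1 a2 a3 ⊢
      constructor <;> linarith [a1.1, a1.2, a2.1, a2.2, a3.1, a3.2]
    linarith
  obtain ⟨g, hg⟩ := cauchySeq_tendsto_of_complete
    (cauchySeq_of_le_geometric β (3 * 2 ^ (n + 1) * B) hβ1 hstep)
  refine ⟨g, fun l => le_trans (measure_mono ?_) (hm l)⟩
  rintro y ⟨hy, hlt⟩
  refine ⟨hy, ?_⟩
  have h1 := dist_le_of_le_geometric_of_tendsto β _ hβ1 hstep hg l
  rw [Real.dist_eq] at h1
  -- The summand 3 / (1 - β) accounts for the geometric tail between m l and the limit, the summand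
  -- 1 for the cluster at level l.
  have e : 2 ^ (n + 1) * (1 + 3 / (1 - β)) * (B * β ^ l)
      = 2 ^ (n + 1) * (B * β ^ l) + 3 * 2 ^ (n + 1) * B * β ^ l / (1 - β) := by ring
  rw [e] at hlt
  have h2 : |g - extrap n (ratio d n l • (y - x)) f x|
      ≤ |m l - g| + |m l - extrap n (ratio d n l • (y - x)) f x| := by
    rw [abs_sub_comm (m l) g]; exact abs_sub_le _ _ _
  linarith

end

/-! ### Algebra of differences -/

/-- Translation of functions by `h`. -/
def shiftEnd {d : ℕ} (h : EuclideanSpace ℝ (Fin d)) :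
    Module.End ℝ (EuclideanSpace ℝ (Fin d) → ℝ) :=
  LinearMap.funLeft ℝ ℝ fun x => x + h

theorem shiftEnd_pow_apply {d : ℕ} (h : EuclideanSpace ℝ (Fin d)) (k : ℕ)
    (f : EuclideanSpace ℝ (Fin d) → ℝ) (x : EuclideanSpace ℝ (Fin d)) :
    (shiftEnd h ^ k) f x = f (x + (k : ℝ) • h) := by
  induction k generalizing f with
  | zero => simp
  | succ k ih =>
    rw [pow_succ, Module.End.mul_apply, ih]
    simp only [shiftEnd, LinearMap.funLeft_apply]
    congr 1
    push_cast
    module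

/-- Writing differences as powers of T - 1, with T the translation by h, turns laws for composition
and step doubling into identities between commuting operators. -/
theorem difference_eq_pow {d : ℕ} (n : ℕ) (h : EuclideanSpace ℝ (Fin d))
    (f : EuclideanSpace ℝ (Fin d) → ℝ) :
    difference n h f = ((shiftEnd h - 1) ^ n) f := by
  have hp : ((Polynomial.X : Polynomial ℝ) - 1) ^ n
      = ∑ m ∈ Finset.range (n + 1), Polynomial.C ((-1) ^ n * wt n m) * Polynomial.X ^ m := by
    rw [sub_eq_add_neg, add_pow]
    refine Finset.sum_congr rfl fun m hm => ?_
    have hm' : m ≤ n := by simp at hm; omega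
    have hs : (-1 : Polynomial ℝ) ^ (n - m) = (-1) ^ n * (-1) ^ m := by
      obtain ⟨t, rfl⟩ := Nat.exists_eq_add_of_le hm'
      rw [Nat.add_sub_cancel_left, pow_add, mul_right_comm, ← mul_pow]; simp
    rw [hs, wt]
    simp only [map_mul, map_pow, map_neg, map_one, map_natCast]
    ring
  have h2 := congrArg (Polynomial.aeval (shiftEnd h)) hp
  simp only [map_pow, map_sub, Polynomial.aeval_X, map_one, map_sum, map_mul,
    Polynomial.aeval_C] at h2
  funext x
  rw [h2, LinearMap.sum_apply, Finset.sum_apply, difference_eq, Finset.mul_sum]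
  refine Finset.sum_congr rfl fun m _ => ?_
  rw [← map_pow, ← map_mul, Module.End.mul_apply, Module.algebraMap_end_apply, Pi.smul_apply,
    shiftEnd_pow_apply, smul_eq_mul, mul_assoc]

theorem difference_add {d : ℕ} (m n : ℕ) (h : EuclideanSpace ℝ (Fin d))
    (f : EuclideanSpace ℝ (Fin d) → ℝ) :
    difference (m + n) h f = difference m h (difference n h f) := by
  rw [difference_eq_pow, difference_eq_pow m, difference_eq_pow n, pow_add, Module.End.mul_apply]

/-- This is T² - 1 = (T + 1)(T - 1) raised to the n-th power, with the first factor expanded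
binomially. -/
theorem difference_two_smul {d : ℕ} (n : ℕ) (h : EuclideanSpace ℝ (Fin d))
    (f : EuclideanSpace ℝ (Fin d) → ℝ) (x : EuclideanSpace ℝ (Fin d)) :
    difference n ((2 : ℝ) • h) f x
      = ∑ k ∈ Finset.range (n + 1), (n.choose k : ℝ) * difference n h f (x + (k : ℝ) • h) := by
  have e2 : shiftEnd ((2 : ℝ) • h) = shiftEnd h ^ 2 := by
    ext f x
    rw [shiftEnd_pow_apply]; simp [shiftEnd]
  have hc : Commute (shiftEnd h + 1) (shiftEnd h - 1) :=
    ((Commute.refl (shiftEnd h)).sub_right (Commute.one_right _)).add_left (Commute.one_left _)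
  have e3 : shiftEnd h ^ 2 - 1 = (shiftEnd h + 1) * (shiftEnd h - 1) := by
    rw [sq, add_mul, mul_sub, mul_one, one_mul]; abel
  rw [difference_eq_pow, e2, e3, hc.mul_pow, Module.End.mul_apply, ← difference_eq_pow,
    (Commute.one_right _).add_pow, LinearMap.sum_apply, Finset.sum_apply]
  refine Finset.sum_congr rfl fun k _ => ?_
  rw [one_pow, mul_one, ← Nat.cast_comm, ← nsmul_eq_mul, LinearMap.smul_apply, Pi.smul_apply,
    shiftEnd_pow_apply, nsmul_eq_mul]

theorem add_smul_mem_closedCube {d n : ℕ} {x h : EuclideanSpace ℝ (Fin d)} (hx : x ∈ closedCube d)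
    (hxh : x + (n : ℝ) • h ∈ closedCube d) {t : ℝ} (h0 : 0 ≤ t) (hn : t ≤ n) :
    x + t • h ∈ closedCube d := by
  rcases h0.eq_or_lt with h0 | h0
  · simpa [← h0]
  have hn0 : (0 : ℝ) < n := h0.trans_le hn
  have := convex_closedCube d hx hxh (a := 1 - t / n) (b := t / n)
    (by rw [sub_nonneg, div_le_one hn0]; exact hn) (by positivity) (by ring)
  convert this using 1
  rw [smul_add, smul_smul, ← add_assoc, ← add_smul, div_mul_cancel₀ _ hn0.ne']
  simp

/-- A difference with doubled step is a combination of differences on the same segment, with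
nonnegative coefficients of sum 2^n. Iteration carries bounds from short steps to longer ones. -/
theorem abs_difference_le_of_half {d n : ℕ} {g : EuclideanSpace ℝ (Fin d) → ℝ} {ρ M : ℝ}
    (hg : ∀ x h, x ∈ closedCube d → x + (n : ℝ) • h ∈ closedCube d → ‖h‖ ≤ ρ →
      |difference n h g x| ≤ M) (x h : EuclideanSpace ℝ (Fin d)) (hx : x ∈ closedCube d)
    (hxh : x + (n : ℝ) • h ∈ closedCube d) (hh : ‖h‖ ≤ 2 * ρ) :
    |difference n h g x| ≤ 2 ^ n * M := by
  have e : h = (2 : ℝ) • ((1 / 2 : ℝ) • h) := by rw [smul_smul]; norm_num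
  rw [e, difference_two_smul]
  calc _ ≤ ∑ k ∈ Finset.range (n + 1), |(n.choose k : ℝ) * difference n ((1 / 2 : ℝ) • h) g
          (x + (k : ℝ) • (1 / 2 : ℝ) • h)| := Finset.abs_sum_le_sum_abs _ _
    _ ≤ ∑ k ∈ Finset.range (n + 1), (n.choose k : ℝ) * M := by
        refine Finset.sum_le_sum fun k hk => ?_
        have hk' : (k : ℝ) ≤ n := by
          have : k ≤ n := by simp at hk; omega
          exact_mod_cast this
        have hk0 : (0 : ℝ) ≤ k := by positivity
        rw [abs_mul, abs_of_nonneg (by positivity : (0 : ℝ) ≤ n.choose k)]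
        refine mul_le_mul_of_nonneg_left (hg _ _ ?_ ?_ ?_) (by positivity)
        · rw [smul_smul]
          exact add_smul_mem_closedCube hx hxh (by positivity) (by linarith)
        · rw [smul_smul, smul_smul, add_assoc, ← add_smul]
          exact add_smul_mem_closedCube hx hxh (by positivity) (by linarith)
        · rw [norm_smul, Real.norm_of_nonneg (by norm_num)]; linarith
    _ = 2 ^ n * M := by
        rw [← Finset.sum_mul]
        congr 1
        exact_mod_cast Nat.sum_range_choose n

theorem abs_difference_le_of_pow_two {d n : ℕ} {g : EuclideanSpace ℝ (Fin d) → ℝ} {ρ M : ℝ}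
    (hg : ∀ x h, x ∈ closedCube d → x + (n : ℝ) • h ∈ closedCube d → ‖h‖ ≤ ρ →
      |difference n h g x| ≤ M) (m : ℕ) (x h : EuclideanSpace ℝ (Fin d)) (hx : x ∈ closedCube d)
    (hxh : x + (n : ℝ) • h ∈ closedCube d) (hh : ‖h‖ ≤ 2 ^ m * ρ) :
    |difference n h g x| ≤ 2 ^ (m * n) * M := by
  induction m generalizing x h with
  | zero => simpa using hg x h hx hxh (by simpa using hh)
  | succ m ih =>
    have := abs_difference_le_of_half ih x h hx hxh (by rw [pow_succ] at hh; linarith)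
    rw [Nat.succ_mul, pow_add]
    linarith

/-- Differences of higher order are bounded by those of lower order. -/
theorem abs_difference_add_le {d n m : ℕ} {g : EuclideanSpace ℝ (Fin d) → ℝ} {M : ℝ}
    {x h : EuclideanSpace ℝ (Fin d)}
    (hg : ∀ k ≤ m, |difference n h g (x + (k : ℝ) • h)| ≤ M) :
    |difference (m + n) h g x| ≤ 2 ^ m * M := by
  rw [difference_add, difference_eq, abs_mul, abs_pow, abs_neg, abs_one, one_pow, one_mul]
  exact abs_sum_range_wt_le m _ M hg

/-! ### Approximation in measure -/

/-- A measurable function on the cube is close in measure to a uniformly continuous function. -/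
theorem exists_uniformContinuous_volume_le {d : ℕ} {f : EuclideanSpace ℝ (Fin d) → ℝ}
    (hf : Measurable f) {b : ℝ} (hb : 0 < b) {κ : ℝ≥0∞} (hκ : κ ≠ 0) :
    ∃ φ : EuclideanSpace ℝ (Fin d) → ℝ, UniformContinuous φ ∧
      cubeMeasure d {y | b < |f y - φ y|} ≤ κ := by
  have hκ2 : κ / 2 ≠ 0 := by simpa using hκ
  have hfa : Measurable fun y => |f y| := by simpa [Real.norm_eq_abs] using hf.norm
  -- Truncation at a height N makes the function integrable, so that density of continuous functions
  -- in L_1 and Markov's inequality apply. Truncation and approximation each use up κ / 2.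
  obtain ⟨N, hN⟩ : ∃ N : ℕ, cubeMeasure d {y | (N : ℝ) < |f y|} < κ / 2 := by
    have ht := tendsto_measure_iInter_atTop (μ := cubeMeasure d)
      (s := fun N : ℕ => {y | (N : ℝ) < |f y|})
      (fun N => (measurableSet_lt measurable_const hfa).nullMeasurableSet)
      (fun M N hMN y (hy : (N : ℝ) < |f y|) =>
        show (M : ℝ) < |f y| from lt_of_le_of_lt (by exact_mod_cast hMN) hy) ⟨0, measure_ne_top _ _⟩
    have he : (⋂ N : ℕ, {y | (N : ℝ) < |f y|}) = ∅ := by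
      refine eq_empty_iff_forall_notMem.2 fun y hy => ?_
      obtain ⟨N, hN⟩ := exists_nat_gt |f y|
      exact absurd (mem_iInter.1 hy N) (not_lt.2 hN.le)
    rw [he, measure_empty] at ht
    exact (ht.eventually (gt_mem_nhds (pos_iff_ne_zero.2 hκ2))).exists
  set F : EuclideanSpace ℝ (Fin d) → ℝ := fun y => max (-(N : ℝ)) (min N (f y)) with hF
  have hFm : Measurable F := by fun_prop
  have hFL : MemLp F 1 (cubeMeasure d) := by
    refine MemLp.of_bound hFm.aestronglyMeasurable (N : ℝ) (Filter.Eventually.of_forall fun y => ?_)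
    rw [Real.norm_eq_abs, abs_le]
    have : (0 : ℝ) ≤ N := by positivity
    exact ⟨le_max_left _ _, max_le (by linarith) (min_le_left _ _)⟩
  have hε : ENNReal.ofReal b * (κ / 2) ≠ 0 := by
    simp [hb, hκ]
  obtain ⟨φ, hφs, hφ, hφc, -⟩ := hFL.exists_hasCompactSupport_eLpNorm_sub_le ENNReal.one_ne_top hε
  refine ⟨φ, hφs.uniformContinuous_of_continuous hφc, ?_⟩
  have hsub : {y | b < |f y - φ y|} ⊆ {y | (N : ℝ) < |f y|} ∪
      {y | ENNReal.ofReal b ≤ ‖(F - φ) y‖ₑ} := by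
    intro y hy
    by_cases h : (N : ℝ) < |f y|
    · exact Or.inl h
    · right
      rw [not_lt, abs_le] at h
      have : F y = f y := by
        simp only [hF]; rw [min_eq_right h.2, max_eq_right h.1]
      change ENNReal.ofReal b ≤ ‖F y - φ y‖ₑ
      rw [this, Real.enorm_eq_ofReal_abs]
      exact ENNReal.ofReal_le_ofReal (le_of_lt hy)
  have hmk : cubeMeasure d {y | ENNReal.ofReal b ≤ ‖(F - φ) y‖ₑ} ≤ κ / 2 := by
    have h1 := mul_meas_ge_le_lintegral₀ (μ := cubeMeasure d) (f := fun y => ‖(F - φ) y‖ₑ)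
      ((hFm.sub hφc.measurable).enorm.aemeasurable) (ENNReal.ofReal b)
    rw [← eLpNorm_one_eq_lintegral_enorm] at h1
    exact (ENNReal.mul_le_mul_iff_right (by simpa using hb) ENNReal.ofReal_ne_top).1 (h1.trans hφ)
  calc _ ≤ _ := measure_mono hsub
    _ ≤ _ := measure_union_le _ _
    _ ≤ κ / 2 + κ / 2 := add_le_add hN.le hmk
    _ = κ := ENNReal.add_halves κ

/-! ### The continuous representative and its differences -/

section

variable {d n : ℕ} {f g : EuclideanSpace ℝ (Fin d) → ℝ} {η β B η₁ K : ℝ}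

/-- At every point of the closed cube and every level, most extrapolated values of `f` are close
to the value of `g`. -/
def ExtrapClose (n : ℕ) (f g : EuclideanSpace ℝ (Fin d) → ℝ) (η₁ β K : ℝ) : Prop :=
  ∀ x ∈ closedCube d, ∀ l : ℕ, volume {y | y ∈ openCube d ∧
      K * β ^ l < |g x - extrap n (ratio d n l • (y - x)) f x|} ≤ ENNReal.ofReal η₁

/-- A Borel–Cantelli argument in the base point. The exceptional pairs (x, y) at level l have
measure O(2^{ld} 4^{-ld}), which is summable, so for a.e. x the slices tend to zero. For all large l
some y then makes the extrapolated value close to both f(x) and g(x). -/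
theorem ae_eq_of_extrapClose (hd : 1 ≤ d) (hn : 1 ≤ n) (hf : Measurable f) (hη : 0 ≤ η)
    (hβ : 0 < β) (hβ1 : β < 1) (hs : SmallDiff n f η β B)
    (hη₁ : η₁ < 1 / 4) (hg : ExtrapClose n f g η₁ β K) : g =ᵐ[cubeMeasure d] f := by
  set S : ℕ → Set (EuclideanSpace ℝ (Fin d) × EuclideanSpace ℝ (Fin d)) := fun l =>
    {z | (z.1, z.2) ∈ openCube d ×ˢ openCube d ∧
      B * β ^ l < |difference n (ratio d n l • (z.2 - z.1)) f z.1|} with hS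
  have hSm : ∀ l, MeasurableSet (S l) := fun l => by
    refine ((measurableSet_openCube d).prod (measurableSet_openCube d)).inter ?_
    have h := ((measurable_difference n hf).comp
      (by fun_prop : Measurable fun z : EuclideanSpace ℝ (Fin d) × EuclideanSpace ℝ (Fin d) =>
        (z.1, ratio d n l • (z.2 - z.1)))).norm
    exact measurableSet_lt (measurable_const (a := B * β ^ l)) h
  have hSv : ∀ l, volume (S l) ≤ ENNReal.ofReal (η * (32 * n * d) ^ d) * (2⁻¹) ^ l := by
    intro l
    have hr := ratio_pos hd hn l
    have hsub : S l ⊆ {z | ((1 : ℝ) • z.1 + 0, ratio d n l • z.2 + (fun y => -(ratio d n l • y)) z.1)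
        ∈ badSet n f (scale l) (B * β ^ l)} := by
      rintro ⟨y, z⟩ ⟨⟨hy, hz⟩, hb⟩
      simp only at hy hz hb
      have e2 : ratio d n l • z + -(ratio d n l • y) = ratio d n l • (z - y) := by module
      simp only [mem_ofPred_eq, badSet, one_smul, add_zero]
      rw [e2]
      have hle := mul_ratio_le hd hn l (le_refl n)
      refine ⟨hy, ?_, ?_, hb⟩
      · rw [smul_smul]
        exact add_smul_sub_mem_openCube (openCube_subset_closedCube d hy) hz
          (by positivity) (by linarith)
      · rw [norm_smul, Real.norm_of_nonneg hr.le]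
        calc ratio d n l * ‖z - y‖ ≤ ratio d n l * d :=
              mul_le_mul_of_nonneg_left
                (norm_sub_le_of_mem_closedCube (openCube_subset_closedCube d hy)
                  (openCube_subset_closedCube d hz)) hr.le
          _ ≤ scale l := (ratio_mul_dim_le hd hn l).trans (by linarith [scale_pos l])
    refine (measure_mono hsub).trans ?_
    rw [volume_preimage_triangular one_pos hr 0 (β := fun y => -(ratio d n l • y)) (by fun_prop) (measurableSet_badSet n hf _ _)]
    refine (mul_le_mul_right (hs l) _).trans ?_
    rw [← ENNReal.ofReal_mul (by positivity)]
    have e3 : ENNReal.ofReal (η * (32 * n * d) ^ d) * (2⁻¹) ^ l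
        = ENNReal.ofReal (η * (32 * n * d) ^ d * (1 / 2) ^ l) := by
      rw [ENNReal.ofReal_mul (p := η * (32 * n * d) ^ d) (by positivity),
        ENNReal.ofReal_pow (by norm_num)]
      congr 2
      rw [one_div, ENNReal.ofReal_inv_of_pos (by norm_num), ENNReal.ofReal_ofNat]
    rw [e3]
    refine ENNReal.ofReal_le_ofReal ?_
    rw [ratio_inv]
    have e4 : (1⁻¹ : ℝ) ^ d * (32 * n * d * 2 ^ l) ^ d * (η * ((1 / 4) ^ l) ^ d)
        = η * (32 * n * d) ^ d * ((1 / 2) ^ l) ^ d := by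
      rw [inv_one, one_pow, one_mul, mul_pow (32 * (n : ℝ) * d)]
      have : ((2 : ℝ) ^ l) ^ d * ((1 / 4) ^ l) ^ d = ((1 / 2) ^ l) ^ d := by
        rw [← mul_pow, ← mul_pow]; norm_num
      rw [← this]; ring
    rw [e4]
    refine mul_le_mul_of_nonneg_left ?_ (by positivity)
    exact pow_le_of_le_one (by positivity) (pow_le_one₀ (by norm_num) (by norm_num)) (by omega)
  have hFm : ∀ l, Measurable fun x => volume (Prod.mk x ⁻¹' S l) := fun l =>
    measurable_measure_prodMk_left (hSm l)
  have hsum : ∫⁻ x, ∑' l, volume (Prod.mk x ⁻¹' S l) ∂(cubeMeasure d) ≠ ∞ := by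
    rw [lintegral_tsum fun l => (hFm l).aemeasurable]
    refine ne_top_of_le_ne_top (b := ∑' l : ℕ, ENNReal.ofReal (η * (32 * n * d) ^ d) * (2⁻¹) ^ l)
      ?_ (ENNReal.tsum_le_tsum fun l => le_trans ?_ (hSv l))
    · rw [ENNReal.tsum_mul_left, ENNReal.tsum_geometric]
      refine ENNReal.mul_ne_top ENNReal.ofReal_ne_top ?_
      rw [ENNReal.one_sub_inv_two, inv_inv]; simp
    · rw [Measure.volume_eq_prod, Measure.prod_apply (hSm l)]
      exact lintegral_mono' Measure.restrict_le_self le_rfl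
  have hae := ae_lt_top' (Measurable.tsum hFm).aemeasurable hsum
  have hmem : ∀ᵐ x ∂(cubeMeasure d), x ∈ openCube d := ae_restrict_mem (measurableSet_openCube d)
  filter_upwards [hae, hmem] with x hx hxo
  have ht := ENNReal.tendsto_atTop_zero_of_tsum_ne_top hx.ne
  have hev : ∀ᶠ l : ℕ in Filter.atTop, |g x - f x| ≤ (K + B) * β ^ l := by
    filter_upwards [ht.eventually (gt_mem_nhds (show (0 : ℝ≥0∞) < 1 / 2 by simp))] with l hl
    have hlt : volume ({y | y ∈ openCube d ∧
        K * β ^ l < |g x - extrap n (ratio d n l • (y - x)) f x|} ∪ Prod.mk x ⁻¹' S l)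
        < volume (openCube d) := by
      rw [volume_openCube]
      calc _ ≤ ENNReal.ofReal η₁ + volume (Prod.mk x ⁻¹' S l) :=
            (measure_union_le _ _).trans
              (add_le_add (hg x (openCube_subset_closedCube d hxo) l) le_rfl)
        _ < 1 / 2 + 1 / 2 := by
            refine ENNReal.add_lt_add ?_ hl
            have h12 : (1 / 2 : ℝ≥0∞) = ENNReal.ofReal (1 / 2) := by
              rw [ENNReal.ofReal_div_of_pos (by norm_num)]; simp
            rw [h12, ENNReal.ofReal_lt_ofReal_iff (by norm_num)]
            linarith
        _ = 1 := ENNReal.add_halves 1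
    obtain ⟨y, hy, hny⟩ := exists_mem_notMem_of_measure_lt hlt
    simp only [hS, mem_union, not_or, mem_ofPred_eq, mem_preimage, mem_prod, hy, hxo, true_and,
      not_lt] at hny
    have h2 := hny.2
    rw [← abs_sub_extrap] at h2
    have h3 := abs_sub_le (g x) (extrap n (ratio d n l • (y - x)) f x) (f x)
    rw [abs_sub_comm (extrap n (ratio d n l • (y - x)) f x) (f x)] at h3
    linarith [hny.1]
  have hlim : Filter.Tendsto (fun l : ℕ => (K + B) * β ^ l) Filter.atTop (nhds 0) := by
    simpa using (tendsto_pow_atTop_nhds_zero_of_lt_one hβ.le hβ1).const_mul (K + B)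
  have h0 := ge_of_tendsto hlim hev
  exact sub_eq_zero.1 (abs_nonpos_iff.1 h0)

/-- At a fixed level the values g(x) and g(x') are compared through extrapolation towards a common
y. The sample points differ by (1 - kθ)(x - x'), and off a small set f may be replaced there by a
uniformly continuous φ. Contraction towards x or x' enlarges that small set by at most θ^{-d}, with
θ fixed before φ is chosen. -/
theorem continuousOn_of_extrapClose (hd : 1 ≤ d) (hn : 1 ≤ n) (hf : Measurable f)
    (hβ : 0 < β) (hβ1 : β < 1)
    (hη₁ : η₁ < 1 / 4) (hg : ExtrapClose n f g η₁ β K) : ContinuousOn g (closedCube d) := by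
  rw [Metric.continuousOn_iff]
  intro x hx ε hε
  obtain ⟨l, hl⟩ : ∃ l : ℕ, K * β ^ l < ε / 4 := by
    have hlim : Filter.Tendsto (fun l : ℕ => K * β ^ l) Filter.atTop (nhds 0) := by
      simpa using (tendsto_pow_atTop_nhds_zero_of_lt_one hβ.le hβ1).const_mul K
    exact (hlim.eventually (gt_mem_nhds (by positivity))).exists
  set θ := ratio d n l with hθ
  have hθ0 : 0 < θ := ratio_pos hd hn l
  -- Three errors of size b (f to φ twice, φ to φ once), with weights of total at most 2^n, must
  -- stay below ε / 4.
  set b : ℝ := ε / (16 * 2 ^ n) with hb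
  have hb0 : 0 < b := by positivity
  obtain ⟨κ, hκ0, hκ⟩ := ENNReal.exists_pos_mul_lt
    (a := (n : ℝ≥0∞) * ENNReal.ofReal ((θ⁻¹) ^ d) + n * ENNReal.ofReal ((θ⁻¹) ^ d)) (b := 1 / 4)
    (by finiteness) (by simp)
  obtain ⟨φ, hφu, hφ⟩ := exists_uniformContinuous_volume_le hf hb0 hκ0.ne'
  obtain ⟨r, hr0, hr⟩ := Metric.uniformContinuous_iff.1 hφu b hb0
  refine ⟨r, hr0, fun x' hx' hdist => ?_⟩
  set T := {y | y ∈ openCube d ∧ b < |f y - φ y|} with hT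
  have hTv : volume T ≤ κ := by
    refine le_trans ?_ hφ
    rw [cubeMeasure, Measure.restrict_apply
      (measurableSet_lt measurable_const
        (by simpa [Real.norm_eq_abs] using (hf.sub hφu.continuous.measurable).norm)), inter_comm]
    exact le_rfl
  have hpre : ∀ w ∈ closedCube d, ∀ i ∈ Finset.Icc 1 n,
      volume {y | y ∈ openCube d ∧ b < |f (w + (i : ℝ) • θ • (y - w)) - φ (w + (i : ℝ) • θ • (y - w))|}
      ≤ ENNReal.ofReal ((θ⁻¹) ^ d) * κ := by
    intro w hw i hi
    rw [Finset.mem_Icc] at hi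
    have hi0 : (1 : ℝ) ≤ i := by exact_mod_cast hi.1
    have hle := mul_ratio_le hd hn l hi.2
    have hsub : {y | y ∈ openCube d ∧
        b < |f (w + (i : ℝ) • θ • (y - w)) - φ (w + (i : ℝ) • θ • (y - w))|} ⊆
        {y | (i * θ) • y + (w - (i * θ) • w) ∈ T} := by
      rintro y ⟨hy, hlt⟩
      have e : (i * θ) • y + (w - (i * θ) • w) = w + (i : ℝ) • θ • (y - w) := by module
      refine ⟨?_, ?_⟩
      · rw [e, smul_smul]
        exact add_smul_sub_mem_openCube hw hy (by positivity) (by linarith)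
      · rw [e]; exact hlt
    refine (measure_mono hsub).trans ?_
    rw [volume_preimage_smul_add (by positivity)]
    refine mul_le_mul' (ENNReal.ofReal_le_ofReal ?_) hTv
    refine pow_le_pow_left₀ (by positivity) ?_ d
    exact inv_anti₀ hθ0 (by nlinarith)
  set U : EuclideanSpace ℝ (Fin d) → Set (EuclideanSpace ℝ (Fin d)) := fun w =>
    ⋃ i ∈ Finset.Icc 1 n, {y | y ∈ openCube d ∧
      b < |f (w + (i : ℝ) • θ • (y - w)) - φ (w + (i : ℝ) • θ • (y - w))|} with hU
  have hUv : ∀ w ∈ closedCube d, volume (U w) ≤ κ * (n * ENNReal.ofReal ((θ⁻¹) ^ d)) := by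
    intro w hw
    calc volume (U w) ≤ ∑ i ∈ Finset.Icc 1 n, ENNReal.ofReal ((θ⁻¹) ^ d) * κ :=
          (measure_biUnion_finset_le _ _).trans (Finset.sum_le_sum (hpre w hw))
      _ = _ := by simp; ring
  have hlt : volume (({y | y ∈ openCube d ∧ K * β ^ l < |g x - extrap n (θ • (y - x)) f x|} ∪
      {y | y ∈ openCube d ∧ K * β ^ l < |g x' - extrap n (θ • (y - x')) f x'|}) ∪ (U x ∪ U x'))
      < volume (openCube d) := by
    rw [volume_openCube]
    have hq : ENNReal.ofReal η₁ ≤ 1 / 4 := by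
      calc ENNReal.ofReal η₁ ≤ ENNReal.ofReal (1 / 4) := ENNReal.ofReal_le_ofReal hη₁.le
        _ = 1 / 4 := by rw [ENNReal.ofReal_div_of_pos (by norm_num)]; simp
    calc _ ≤ (ENNReal.ofReal η₁ + ENNReal.ofReal η₁) + (volume (U x) + volume (U x')) := by
          refine (measure_union_le _ _).trans (add_le_add ?_ (measure_union_le _ _))
          exact (measure_union_le _ _).trans (add_le_add (hg x hx l) (hg x' hx' l))
      _ ≤ (1 / 4 + 1 / 4) + κ * (n * ENNReal.ofReal ((θ⁻¹) ^ d) + n * ENNReal.ofReal ((θ⁻¹) ^ d)) := by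
          rw [mul_add]
          exact add_le_add (add_le_add hq hq) (add_le_add (hUv x hx) (hUv x' hx'))
      _ < (1 / 4 + 1 / 4) + 1 / 4 :=
          (ENNReal.add_lt_add_iff_left (by finiteness)).2 hκ
      _ ≤ 1 := by
          rw [← ENNReal.toReal_le_toReal (by finiteness) (by finiteness),
            ENNReal.toReal_add (by finiteness) (by finiteness),
            ENNReal.toReal_add (by finiteness) (by finiteness)]
          norm_num
  obtain ⟨y, hy, hny⟩ := exists_mem_notMem_of_measure_lt hlt
  simp only [hU, mem_union, not_or, mem_ofPred_eq, mem_iUnion, not_exists, hy, true_and,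
    not_lt, Finset.mem_Icc] at hny
  obtain ⟨⟨h1, h2⟩, h3, h4⟩ := hny
  have hext : |extrap n (θ • (y - x')) f x' - extrap n (θ • (y - x)) f x| ≤ 2 ^ n * (3 * b) := by
    have e : extrap n (θ • (y - x')) f x' - extrap n (θ • (y - x)) f x
        = ∑ k ∈ Finset.Icc 1 n, wt n k * (f (x + (k : ℝ) • θ • (y - x))
          - f (x' + (k : ℝ) • θ • (y - x'))) := by
      simp only [extrap, mul_sub, Finset.sum_sub_distrib]; ring
    rw [e]
    refine abs_sum_Icc_wt_le n _ _ (by positivity) fun k hk1 hk2 => ?_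
    have hle := mul_ratio_le hd hn l hk2
    have hk0 : (0 : ℝ) ≤ k * θ := by positivity
    have hd' : dist (x + (k : ℝ) • θ • (y - x)) (x' + (k : ℝ) • θ • (y - x')) < r := by
      rw [dist_eq_norm]
      have : x + (k : ℝ) • θ • (y - x) - (x' + (k : ℝ) • θ • (y - x'))
          = (1 - k * θ) • (x - x') := by module
      rw [this, norm_smul, Real.norm_of_nonneg (by linarith), ← dist_eq_norm, dist_comm]
      nlinarith [dist_nonneg (x := x') (y := x)]
    have h5 := (hr hd').le
    rw [Real.dist_eq] at h5
    have h6 := h3 k ⟨hk1, hk2⟩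
    have h7 := h4 k ⟨hk1, hk2⟩
    rw [abs_le] at h5 h6 h7 ⊢
    constructor <;> linarith [h5.1, h5.2, h6.1, h6.2, h7.1, h7.2]
  have hb3 : 2 ^ n * (3 * b) ≤ ε / 4 := by
    rw [hb]; field_simp; norm_num
  rw [Real.dist_eq]
  have : |g x' - g x| ≤ K * β ^ l + 2 ^ n * (3 * b) + K * β ^ l := by
    rw [abs_le] at h1 h2 hext ⊢
    constructor <;> linarith [h1.1, h1.2, h2.1, h2.2, hext.1, hext.2]
  linarith

/-- Convex combinations of two independent points avoid small sets. -/
theorem volume_convex_comb_mem_le {a b : ℝ} (hab : a + b = 1)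
    (T : Set (EuclideanSpace ℝ (Fin d))) :
    volume {z : EuclideanSpace ℝ (Fin d) × EuclideanSpace ℝ (Fin d) |
      z.1 ∈ openCube d ∧ z.2 ∈ openCube d ∧ a • z.1 + b • z.2 ∈ T}
      ≤ ENNReal.ofReal (2 ^ d) * volume T := by
  -- The point with the larger weight is integrated with the other one frozen; inverting its
  -- dilation costs at most 2^d.
  have key : ∀ {a b : ℝ}, 1 / 2 ≤ b → volume {z : EuclideanSpace ℝ (Fin d) × EuclideanSpace ℝ (Fin d) |
      z.1 ∈ openCube d ∧ z.2 ∈ openCube d ∧ a • z.1 + b • z.2 ∈ T}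
      ≤ ENNReal.ofReal (2 ^ d) * volume T := by
    intro a b hb
    have hb0 : 0 < b := by linarith
    have hsub : {z : EuclideanSpace ℝ (Fin d) × EuclideanSpace ℝ (Fin d) |
        z.1 ∈ openCube d ∧ z.2 ∈ openCube d ∧ a • z.1 + b • z.2 ∈ T} ⊆
        {z | ((1 : ℝ) • z.1 + 0, b • z.2 + (fun y => a • y) z.1)
          ∈ openCube d ×ˢ toMeasurable volume T} := by
      rintro ⟨y, z⟩ ⟨hy, -, hz⟩
      simp only [mem_ofPred_eq, one_smul, add_zero, mem_prod]
      refine ⟨hy, subset_toMeasurable _ _ ?_⟩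
      rw [add_comm]; exact hz
    refine (measure_mono hsub).trans ?_
    rw [volume_preimage_triangular one_pos hb0 _ (by fun_prop)
      ((measurableSet_openCube d).prod (measurableSet_toMeasurable _ _)), Measure.volume_eq_prod,
      Measure.prod_prod, volume_openCube, measure_toMeasurable, one_mul]
    refine mul_le_mul' (ENNReal.ofReal_le_ofReal ?_) le_rfl
    rw [inv_one, one_pow, one_mul]
    refine pow_le_pow_left₀ (by positivity) ?_ d
    rw [inv_le_comm₀ hb0 (by norm_num)]; linarith
  by_cases h : 1 / 2 ≤ b
  · exact key h
  · have h' : 1 / 2 ≤ a := by linarith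
    refine le_trans (le_of_eq ?_) (key (a := b) h')
    have e := (Measure.measurePreserving_swap (μ := (volume : Measure (EuclideanSpace ℝ (Fin d))))
        (ν := (volume : Measure (EuclideanSpace ℝ (Fin d))))).measure_preimage_equiv
          (f := MeasurableEquiv.prodComm) {z | z.1 ∈ openCube d ∧ z.2 ∈ openCube d ∧
            b • z.1 + a • z.2 ∈ T}
    refine Eq.trans (congrArg _ ?_) e
    ext ⟨y, z⟩
    change (y ∈ openCube d ∧ z ∈ openCube d ∧ a • y + b • z ∈ T) ↔
      (z ∈ openCube d ∧ y ∈ openCube d ∧ b • z + a • y ∈ T)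
    rw [add_comm]; tauto

/-- For random y, z the point x + i h is extrapolated towards (1 - i/n) y + (i/n) z. The steps are
then in arithmetic progression in i, so `sum_extrap_eq` turns the difference of the extrapolated
values into differences of f at x + jθ(y - x). The hypothesis on `η₁` says that some pair (y, z)
avoids all n + 1 exceptional sets of g and all n of f. -/
theorem abs_difference_le_of_extrapClose (hd : 1 ≤ d) (hn : 1 ≤ n) (hf : Measurable f)
    (hη : 0 ≤ η) (hβ : 0 < β) (hs : SmallDiff n f η β B) (hB : 0 ≤ B)
    (hη₁0 : 0 ≤ η₁)
    (hη₁ : n * (η * (n * (32 * n * d) ^ 2) ^ d) + (n + 1) * (2 ^ d * η₁) < 1)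
    (hg : ExtrapClose n f g η₁ β K) (l : ℕ) (x h : EuclideanSpace ℝ (Fin d))
    (hx : x ∈ closedCube d) (hxh : x + (n : ℝ) • h ∈ closedCube d) (hh : ‖h‖ ≤ scale l / 2) :
    |difference n h g x| ≤ 2 ^ n * ((K + B) * β ^ l) := by
  set θ := ratio d n l with hθ
  have hθ0 : 0 < θ := ratio_pos hd hn l
  have hn0 : (0 : ℝ) < n := by exact_mod_cast hn
  set P : ℕ → EuclideanSpace ℝ (Fin d) := fun i => x + (i : ℝ) • h with hP
  have hPmem : ∀ i ≤ n, P i ∈ closedCube d := fun i hi =>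
    add_smul_mem_closedCube hx hxh (by positivity) (by exact_mod_cast hi)
  set T : ℕ → Set (EuclideanSpace ℝ (Fin d)) := fun i => {y | y ∈ openCube d ∧
      K * β ^ l < |g (P i) - extrap n (θ • (y - P i)) f (P i)|} with hT
  set U : ℕ → Set (EuclideanSpace ℝ (Fin d) × EuclideanSpace ℝ (Fin d)) := fun i =>
    {z | z.1 ∈ openCube d ∧ z.2 ∈ openCube d ∧
      ((1 - i / n : ℝ)) • z.1 + (i / n : ℝ) • z.2 ∈ T i} with hU
  set V : ℕ → Set (EuclideanSpace ℝ (Fin d) × EuclideanSpace ℝ (Fin d)) := fun j =>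
    {z | z.1 ∈ openCube d ∧ z.2 ∈ openCube d ∧
      B * β ^ l < |difference n (h + (j : ℝ) • ((θ / n) • (z.2 - z.1 - (n : ℝ) • h))) f
        (x + (j : ℝ) • (θ • (z.1 - x)))|} with hV
  have hUv : ∀ i ∈ Finset.range (n + 1), volume (U i) ≤ ENNReal.ofReal (2 ^ d * η₁) := by
    intro i hi
    have hi' : (i : ℝ) ≤ n := by
      have : i ≤ n := by simp at hi; omega
      exact_mod_cast this
    refine (volume_convex_comb_mem_le (by ring) _).trans ?_
    rw [ENNReal.ofReal_mul (by positivity)]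
    exact mul_le_mul' le_rfl (hg _ (hPmem i (by exact_mod_cast hi')) l)
  have hVv : ∀ j ∈ Finset.Icc 1 n, volume (V j)
      ≤ ENNReal.ofReal (η * (n * (32 * n * d) ^ 2) ^ d) := by
    intro j hj
    rw [Finset.mem_Icc] at hj
    have hj1 : (1 : ℝ) ≤ j := by exact_mod_cast hj.1
    have hj0 : (0 : ℝ) < j := by linarith
    have hjn : (j : ℝ) ≤ n := by exact_mod_cast hj.2
    have hle := mul_ratio_le hd hn l hj.2
    rw [← hθ] at hle
    have hja : 0 < j * θ := by positivity
    have hjb : 0 < j * θ / n := by positivity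
    have hsub : V j ⊆ {z | ((j * θ) • z.1 + (x - (j * θ) • x), (j * θ / n) • z.2 +
        (fun y => (1 - j * θ) • h - (j * θ / n) • y) z.1) ∈ badSet n f (scale l) (B * β ^ l)} := by
      rintro ⟨y, z⟩ ⟨hy, hz, hb⟩
      simp only at hy hz hb
      have e1 : (j * θ) • y + (x - (j * θ) • x) = x + (j : ℝ) • (θ • (y - x)) := by module
      have e2 : (j * θ / n) • z + ((1 - j * θ) • h - (j * θ / n) • y)
          = h + (j : ℝ) • ((θ / n) • (z - y - (n : ℝ) • h)) := by
        (match_scalars <;> field_simp); ring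
      -- The two ends of the new segment are x contracted towards y and x + n h contracted towards z
      -- with the same ratio, so both lie in the open cube.
      have e3 : x + (j : ℝ) • (θ • (y - x)) + (n : ℝ) • (h + (j : ℝ) • ((θ / n) • (z - y - (n : ℝ) • h)))
          = (x + (n : ℝ) • h) + (j * θ) • (z - (x + (n : ℝ) • h)) := by
        (match_scalars <;> field_simp); ring
      simp only [mem_ofPred_eq, badSet]
      rw [e1]
      refine ⟨?_, ?_, ?_, ?_⟩
      · rw [smul_smul]
        exact add_smul_sub_mem_openCube hx hy hja (by linarith)
      · rw [e2, e3]
        exact add_smul_sub_mem_openCube hxh hz hja (by linarith)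
      · have e4 : (j * θ / n) • z + ((1 - j * θ) • h - (j * θ / n) • y)
          = (1 - j * θ) • h + (j * θ / n) • (z - y) := by module
        rw [e4]
        refine (norm_add_le _ _).trans ?_
        rw [norm_smul, norm_smul, Real.norm_of_nonneg (by linarith), Real.norm_of_nonneg hjb.le]
        have h1 : (1 - j * θ) * ‖h‖ ≤ scale l / 2 := by nlinarith [norm_nonneg h]
        have h2 : j * θ / n ≤ θ := by
          rw [div_le_iff₀ hn0]; nlinarith
        have h3 := norm_sub_le_of_mem_closedCube (openCube_subset_closedCube d hy)
          (openCube_subset_closedCube d hz)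
        have h4 : j * θ / n * ‖z - y‖ ≤ θ * d :=
          mul_le_mul h2 h3 (norm_nonneg _) hθ0.le
        have h5 := ratio_mul_dim_le hd hn l
        have := scale_pos l
        linarith
      · rw [e2]; exact hb
    refine (measure_mono hsub).trans ?_
    rw [volume_preimage_triangular hja hjb _
      (β := fun y => (1 - j * θ) • h - (j * θ / n) • y) (by fun_prop) (measurableSet_badSet n hf _ _)]
    refine (mul_le_mul_right (hs l) _).trans ?_
    rw [← ENNReal.ofReal_mul (by positivity)]
    refine ENNReal.ofReal_le_ofReal ?_
    have e : ((j * θ)⁻¹) ^ d * ((j * θ / n)⁻¹) ^ d * (η * ((1 / 4) ^ l) ^ d)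
        = η * ((j * θ)⁻¹ * (j * θ / n)⁻¹ * (1 / 4) ^ l) ^ d := by
      rw [mul_pow, mul_pow]; ring
    rw [e]
    refine mul_le_mul_of_nonneg_left (pow_le_pow_left₀ (by positivity) ?_ d) hη
    have hji : (j : ℝ)⁻¹ ≤ 1 := inv_le_one_of_one_le₀ hj1
    have h4 : (2 : ℝ) ^ l * 2 ^ l * (1 / 4) ^ l = 1 := by
      rw [← mul_pow, ← mul_pow]; norm_num
    have e5 : (j * θ)⁻¹ * (j * θ / n)⁻¹ * (1 / 4) ^ l
        = (j : ℝ)⁻¹ * (j : ℝ)⁻¹ * (n * (θ⁻¹ * θ⁻¹) * (1 / 4) ^ l) := by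
      field_simp
    rw [e5, hθ, ratio_inv]
    calc (j : ℝ)⁻¹ * (j : ℝ)⁻¹ * (n * ((32 * n * d * 2 ^ l) * (32 * n * d * 2 ^ l)) * (1 / 4) ^ l)
        ≤ 1 * 1 * (n * ((32 * n * d * 2 ^ l) * (32 * n * d * 2 ^ l)) * (1 / 4) ^ l) := by gcongr
      _ = n * (32 * n * d) ^ 2 * (2 ^ l * 2 ^ l * (1 / 4) ^ l) := by ring
      _ = _ := by rw [h4, mul_one]
  have hlt : volume ((⋃ j ∈ Finset.Icc 1 n, V j) ∪ ⋃ i ∈ Finset.range (n + 1), U i)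
      < volume (openCube d ×ˢ openCube d) := by
    rw [volume_openCube_prod]
    calc _ ≤ ∑ _j ∈ Finset.Icc 1 n, ENNReal.ofReal (η * (n * (32 * n * d) ^ 2) ^ d)
          + ∑ _i ∈ Finset.range (n + 1), ENNReal.ofReal (2 ^ d * η₁) := by
          refine (measure_union_le _ _).trans (add_le_add ?_ ?_)
          · exact (measure_biUnion_finset_le _ _).trans (Finset.sum_le_sum hVv)
          · exact (measure_biUnion_finset_le _ _).trans (Finset.sum_le_sum hUv)
      _ = ENNReal.ofReal (n * (η * (n * (32 * n * d) ^ 2) ^ d) + (n + 1) * (2 ^ d * η₁)) := by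
          rw [ENNReal.ofReal_add (by positivity) (by positivity),
            ENNReal.ofReal_mul (p := (n : ℝ)) (by positivity), ENNReal.ofReal_natCast,
            ENNReal.ofReal_mul (p := (n : ℝ) + 1) (by positivity)]
          simp only [Finset.sum_const, Nat.card_Icc, Nat.add_sub_cancel, nsmul_eq_mul,
            Finset.card_range]
          congr 2
          rw [← ENNReal.ofReal_natCast]; push_cast; rfl
      _ < 1 := by rw [ENNReal.ofReal_lt_one]; exact hη₁
  obtain ⟨⟨y, z⟩, ⟨hy, hz⟩, hnm⟩ := exists_mem_notMem_of_measure_lt hlt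
  simp only at hy hz
  simp only [mem_union, not_or, mem_iUnion, not_exists] at hnm
  obtain ⟨hv, hu⟩ := hnm
  have hBl : 0 ≤ B * β ^ l := by positivity
  have hv' : ∀ j, 1 ≤ j → j ≤ n →
      |difference n (h + (j : ℝ) • ((θ / n) • (z - y - (n : ℝ) • h))) f
        (x + (j : ℝ) • (θ • (y - x)))| ≤ B * β ^ l := by
    intro j h1 h2
    have := hv j (Finset.mem_Icc.2 ⟨h1, h2⟩)
    simp only [hV, mem_ofPred_eq, not_and, not_lt] at this
    exact this hy hz
  have hu' : ∀ i ≤ n, |g (P i) - extrap n (θ • (y - x) + (i : ℝ) • ((θ / n) • (z - y - (n : ℝ) • h))) f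
      (P i)| ≤ K * β ^ l := by
    intro i hi
    have := hu i (Finset.mem_range.2 (by omega))
    have hi' : (i : ℝ) ≤ n := by exact_mod_cast hi
    have hY : (1 - i / n : ℝ) • y + (i / n : ℝ) • z ∈ openCube d :=
      convex_openCube d hy hz (by rw [sub_nonneg, div_le_one hn0]; exact hi') (by positivity)
        (by ring)
    simp only [hU, hT, mem_ofPred_eq, not_and, not_lt] at this
    have := this hy hz hY
    have e : θ • (y - x) + (i : ℝ) • ((θ / n) • (z - y - (n : ℝ) • h))
        = θ • ((1 - i / n : ℝ) • y + (i / n : ℝ) • z - P i) := by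
      simp only [hP]
      (match_scalars <;> field_simp); ring
    rw [e]; exact this
  have s1 := abs_sum_range_wt_le n _ _ hu'
  have s2 := abs_sum_Icc_wt_le n _ _ hBl hv'
  have hid := sum_extrap_eq n h (θ • (y - x)) ((θ / n) • (z - y - (n : ℝ) • h)) f x
  rw [difference_eq]
  have e : (-1 : ℝ) ^ n * ∑ k ∈ Finset.range (n + 1), wt n k * g (x + (k : ℝ) • h)
      = (-1) ^ n * (∑ k ∈ Finset.range (n + 1), wt n k * (g (P k) - extrap n
        (θ • (y - x) + (k : ℝ) • ((θ / n) • (z - y - (n : ℝ) • h))) f (P k)))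
        + -∑ j ∈ Finset.Icc 1 n, wt n j *
        difference n (h + (j : ℝ) • ((θ / n) • (z - y - (n : ℝ) • h))) f (x + (j : ℝ) • (θ • (y - x))) := by
    rw [← hid]
    simp only [mul_sub, Finset.sum_sub_distrib]
    ring
  rw [e]
  refine (abs_add_le _ _).trans ?_
  rw [abs_mul, abs_pow, abs_neg, abs_one, one_pow, one_mul, abs_neg]
  linarith

/-- If the differences of `f` are small in measure at all levels, then `f` agrees a.e. with a
continuous function all of whose differences are small. -/
theorem exists_continuous_of_smallDiff (hd : 1 ≤ d) (hn : 1 ≤ n) :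
    ∃ η : ℝ, 0 < η ∧ ∀ β : ℝ, 0 < β → β < 1 → ∃ C : ℝ, 0 ≤ C ∧
      ∀ f : EuclideanSpace ℝ (Fin d) → ℝ, Measurable f → ∀ B : ℝ, 0 ≤ B → SmallDiff n f η β B →
      ∃ g : EuclideanSpace ℝ (Fin d) → ℝ, ContinuousOn g (closedCube d) ∧
        g =ᵐ[cubeMeasure d] f ∧
        ∀ (l : ℕ) (x h : EuclideanSpace ℝ (Fin d)), x ∈ closedCube d →
          x + (n : ℝ) • h ∈ closedCube d → ‖h‖ ≤ (1 / 2) ^ l →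
          |difference n h g x| ≤ C * B * β ^ l := by
  have hn0 : (1 : ℝ) ≤ n := by exact_mod_cast hn
  have hd0 : (1 : ℝ) ≤ d := by exact_mod_cast hd
  -- M dominates the Jacobian factors of both arguments, and η makes the exceptional measures total
  -- less than one. Neither depends on β.
  set M : ℝ := (2 * n * (32 * n * d) ^ 2) ^ d with hM
  have hM0 : 0 < M := by positivity
  set η : ℝ := 1 / (8 * (n + 1) ^ 2 * 2 ^ d * M) with hη
  have hη0 : 0 < η := by positivity
  have hηM : η * M = 1 / (8 * (n + 1) ^ 2 * 2 ^ d) := by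
    rw [hη]; field_simp
  have hM1 : (2 * (32 * n * d) ^ 2 : ℝ) ^ d ≤ M := by
    refine pow_le_pow_left₀ (by positivity) ?_ d
    nlinarith [sq_nonneg (32 * (n : ℝ) * d)]
  have hM2 : (n * (32 * n * d) ^ 2 : ℝ) ^ d ≤ M := by
    refine pow_le_pow_left₀ (by positivity) ?_ d
    nlinarith [mul_nonneg (by linarith : (0:ℝ) ≤ n) (sq_nonneg (32 * (n : ℝ) * d))]
  set η₁ : ℝ := 2 * n * (η * (2 * (32 * n * d) ^ 2) ^ d) with hη₁
  have hη₁0 : 0 ≤ η₁ := by positivity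
  have hη₁le : 2 ^ d * η₁ ≤ n / (4 * (n + 1) ^ 2) := by
    calc 2 ^ d * η₁ ≤ 2 ^ d * (2 * n * (η * M)) := by rw [hη₁]; gcongr
      _ = _ := by rw [hηM]; field_simp; norm_num
  have h2d : (1 : ℝ) ≤ 2 ^ d := one_le_pow₀ (by norm_num)
  have hq : (n : ℝ) / (4 * (n + 1) ^ 2) < 1 / 4 := by
    rw [div_lt_div_iff₀ (by positivity) (by norm_num)]; nlinarith
  have hη₁4 : η₁ < 1 / 4 := by nlinarith
  have hsum : n * (η * (n * (32 * n * d) ^ 2) ^ d) + (n + 1) * (2 ^ d * η₁) < 1 := by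
    have a1 : n * (η * (n * (32 * n * d) ^ 2) ^ d) ≤ 1 / 4 := by
      calc n * (η * (n * (32 * n * d) ^ 2) ^ d) ≤ n * (η * M) := by gcongr
        _ ≤ 1 / 4 := by
          rw [hηM, mul_one_div, div_le_div_iff₀ (by positivity) (by norm_num)]
          nlinarith [mul_le_mul_of_nonneg_left h2d (by positivity : (0:ℝ) ≤ 8 * ((n : ℝ) + 1) ^ 2)]
    have a2 : (n + 1) * (2 ^ d * η₁) ≤ 1 / 4 := by
      calc (n + 1) * (2 ^ d * η₁) ≤ (n + 1) * (n / (4 * (n + 1) ^ 2)) := by gcongr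
        _ ≤ 1 / 4 := by
          rw [mul_div_assoc', div_le_div_iff₀ (by positivity) (by norm_num)]; nlinarith
    linarith
  refine ⟨η, hη0, fun β hβ hβ1 => ?_⟩
  have h1β : 0 < 1 - β := by linarith
  set C₀ : ℝ := 2 ^ (n + 1) * (1 + 3 / (1 - β)) with hC₀
  have hC₀0 : 0 ≤ C₀ := by positivity
  refine ⟨2 ^ (4 * n) * (2 ^ n * (C₀ + 1)), by positivity, fun f hf B hB hs => ?_⟩
  -- The values of g are chosen point by point; all regularity is deduced afterwards from their
  -- closeness to extrapolated values.
  choose! g hg using fun x hx => exists_limit_value hd hn hf hη0.le hB hβ hβ1 hη₁4 hs (x := x) hx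
  have hclose : ExtrapClose n f g η₁ β (C₀ * B) := fun x hx l => by
    have := hg x hx l
    rwa [← mul_assoc] at this
  refine ⟨g, continuousOn_of_extrapClose hd hn hf hβ hβ1 hη₁4 hclose,
    ae_eq_of_extrapClose hd hn hf hη0.le hβ hβ1 hs hη₁4 hclose, fun l x h hx hxh hh => ?_⟩
  -- Since scale l / 2 = 2^{-l} / 16, four doublings reach steps of length 2^{-l}; hence the factor
  -- 2^{4n}.
  have key := abs_difference_le_of_pow_two
    (fun x h hx hxh hh => abs_difference_le_of_extrapClose hd hn hf hη0.le hβ hs hB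
      hη₁0 hsum hclose l x h hx hxh hh) 4 x h hx hxh (by
        unfold scale; linarith)
  refine key.trans (le_of_eq ?_)
  ring

end

/-! ### Interpolation in one variable -/

open Polynomial in
theorem sum_wt_mul_eval_eq_zero {r : ℕ} {Q : ℝ[X]} (hQ : Q.degree < r) (x : ℝ) :
    ∑ k ∈ Finset.range (r + 1), wt r k * Q.eval (x + k) = 0 := by
  by_cases h0 : Q = 0
  · simp [h0]
  have hn : Q.natDegree < r := (natDegree_lt_iff_degree_lt h0).2 hQ
  have h := congrFun (Polynomial.fwdDiff_iter_eq_zero_of_degree_lt hn) x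
  rw [fwdDiff_iter_eq_sum_shift] at h
  have e : ∑ k ∈ Finset.range (r + 1), wt r k * Q.eval (x + k)
      = (-1) ^ r * ∑ k ∈ Finset.range (r + 1),
        ((-1 : ℤ) ^ (r - k) * (r.choose k : ℤ)) • Q.eval (x + k • (1 : ℝ)) := by
    rw [Finset.mul_sum]
    refine Finset.sum_congr rfl fun k hk => ?_
    obtain ⟨t, rfl⟩ := Nat.exists_eq_add_of_le (show k ≤ r by simp at hk; omega)
    rw [wt, Nat.add_sub_cancel_left, zsmul_eq_mul, nsmul_eq_mul, mul_one]
    push_cast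
    rw [pow_add]
    have : ((-1 : ℝ)) ^ t * (-1) ^ t = 1 := by rw [← mul_pow]; simp
    linear_combination (-(-1) ^ k * ((k + t).choose k : ℝ) * eval (x + k) Q) * this
  rw [e]
  refine mul_eq_zero_of_right _ (Eq.trans ?_ h)
  rfl

/-- The leading coefficient of the difference is ±1, so each new value is at most E plus 2^r times
the bound for the preceding ones. One step along the sequence costs a factor 2^r + 1. -/
theorem abs_le_of_sum_wt_le {r N : ℕ} {z : ℕ → ℝ} {E : ℝ} (hE : 0 ≤ E) (h0 : ∀ i < r, z i = 0)
    (hz : ∀ m, m + r ≤ N → |∑ k ∈ Finset.range (r + 1), wt r k * z (m + k)| ≤ E) (m : ℕ)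
    (hm : m ≤ N) : |z m| ≤ (2 ^ r + 1) ^ m * E := by
  induction m using Nat.strong_induction_on with
  | _ m ih =>
    rcases lt_or_ge m r with h | h
    · rw [h0 m h, abs_zero]; positivity
    · obtain ⟨t, rfl⟩ := Nat.exists_eq_add_of_le' h
      have h1 := hz t hm
      rcases Nat.eq_zero_or_pos r with hr | hr
      · subst hr
        simp [wt] at h1 ⊢
        refine h1.trans (le_mul_of_one_le_left hE (one_le_pow₀ (by norm_num)))
      have h2 := abs_sum_range_wt_le r (fun k => if k = r then 0 else z (t + k))
        ((2 ^ r + 1) ^ (t + r - 1) * E) (by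
          intro k hk
          by_cases hkr : k = r
          · simp only [hkr, if_true, abs_zero]; positivity
          · simp only [hkr, if_false]
            refine (ih (t + k) (by omega) (by omega)).trans ?_
            exact mul_le_mul_of_nonneg_right (pow_le_pow_right₀ (by
              have : (0 : ℝ) ≤ 2 ^ r := by positivity
              linarith) (by omega)) hE)
      rw [Finset.sum_range_succ] at h1 h2
      have e : ∑ k ∈ Finset.range r, wt r k * (if k = r then 0 else z (t + k))
          = ∑ k ∈ Finset.range r, wt r k * z (t + k) := by
        refine Finset.sum_congr rfl fun k hk => ?_
        have : k ≠ r := by simp at hk; omega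
        simp [this]
      rw [e] at h2
      simp only [if_true, mul_zero, add_zero] at h2
      have h3 : |wt r r * z (t + r)| = |z (t + r)| := by
        rw [abs_mul, abs_wt]; simp
      rw [← h3]
      set S := ∑ k ∈ Finset.range r, wt r k * z (t + k)
      have h4 : |wt r r * z (t + r)| ≤ |S + wt r r * z (t + r)| + |S| := by
        have := abs_sub (S + wt r r * z (t + r)) S
        rwa [add_sub_cancel_left] at this
      have h5 : (2 ^ r + 1 : ℝ) ^ (t + r) = (2 ^ r + 1) ^ (t + r - 1) * (2 ^ r + 1) := by
        rw [← pow_succ]; congr 1; omega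
      have h6 : (1 : ℝ) ≤ (2 ^ r + 1) ^ (t + r - 1) := one_le_pow₀ (by
        have : (0 : ℝ) ≤ 2 ^ r := by positivity
        linarith)
      rw [h5]
      nlinarith

/-- The equispaced nodes `i / (r - 1)` in `[0,1]`. -/
noncomputable def node (r i : ℕ) : ℝ := i / ((r : ℝ) - 1)

theorem node_injOn {r : ℕ} (hr : 2 ≤ r) : InjOn (node r) (Finset.range r : Finset ℕ) := by
  have : (2 : ℝ) ≤ r := by exact_mod_cast hr
  intro i _ j _ h
  have h' : (i : ℝ) / ((r : ℝ) - 1) = j / ((r : ℝ) - 1) := h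
  rw [div_left_inj' (by linarith)] at h'
  exact_mod_cast h'

theorem node_mem_Icc {r i : ℕ} (hr : 2 ≤ r) (hi : i < r) : node r i ∈ Icc (0 : ℝ) 1 := by
  have h2 : (2 : ℝ) ≤ r := by exact_mod_cast hr
  have hi' : (i : ℝ) + 1 ≤ r := by exact_mod_cast hi
  refine ⟨div_nonneg (by positivity) (by linarith), ?_⟩
  rw [node, div_le_one (by linarith)]; linarith

open Polynomial in
/-- The polynomial of degree less than `r` with prescribed values at the equispaced nodes. -/
noncomputable def interp (r : ℕ) (w : ℕ → ℝ) : ℝ[X] :=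
  Lagrange.interpolate (Finset.range r) (node r) w

theorem interp_add (r : ℕ) (v w : ℕ → ℝ) :
    interp r (fun i => v i + w i) = interp r v + interp r w := by
  unfold interp
  rw [← map_add]; rfl

theorem interp_sub (r : ℕ) (v w : ℕ → ℝ) :
    interp r (fun i => v i - w i) = interp r v - interp r w := by
  unfold interp
  rw [← map_sub]; rfl

open Polynomial in
theorem interp_eval {r : ℕ} (hr : 2 ≤ r) {Q : ℝ[X]} (hQ : Q.degree < r) :
    interp r (fun i => Q.eval (node r i)) = Q :=
  (Lagrange.eq_interpolate (node_injOn hr) (by simpa using hQ)).symm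

/-- Boundedness of the interpolation operator in the supremum norm. The number Λ depends on r only
and is the source of the factor carried into C₁. -/
theorem exists_interp_bound (r : ℕ) : ∃ Λ : ℝ, 1 ≤ Λ ∧ ∀ x ∈ Icc (0 : ℝ) 1, ∀ (w : ℕ → ℝ) (M : ℝ),
    0 ≤ M → (∀ i < r, |w i| ≤ M) → |(interp r w).eval x| ≤ Λ * M := by
  have hb : ∀ i, ∃ C : ℝ, ∀ x ∈ Icc (0 : ℝ) 1,
      ‖(Lagrange.basis (Finset.range r) (node r) i).eval x‖ ≤ C := fun i =>
    isCompact_Icc.exists_bound_of_continuousOn (Polynomial.continuous _).continuousOn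
  choose C hC using hb
  refine ⟨1 + ∑ i ∈ Finset.range r, |C i|, ?_, fun x hx w M hM hw => ?_⟩
  · have : 0 ≤ ∑ i ∈ Finset.range r, |C i| := Finset.sum_nonneg fun i _ => abs_nonneg _
    linarith
  · rw [interp, Lagrange.interpolate_apply, Polynomial.eval_finsetSum]
    calc |∑ i ∈ Finset.range r, (Polynomial.C (w i) * Lagrange.basis (Finset.range r) (node r) i).eval x|
        ≤ ∑ i ∈ Finset.range r, |(Polynomial.C (w i) *
          Lagrange.basis (Finset.range r) (node r) i).eval x| := Finset.abs_sum_le_sum_abs _ _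
      _ ≤ ∑ i ∈ Finset.range r, |C i| * M := by
          refine Finset.sum_le_sum fun i hi => ?_
          rw [Polynomial.eval_mul, Polynomial.eval_C, abs_mul, mul_comm]
          refine mul_le_mul (((hC i x hx)).trans (le_abs_self _)) (hw i (by simpa using hi))
            (abs_nonneg _) (abs_nonneg _)
      _ ≤ (1 + ∑ i ∈ Finset.range r, |C i|) * M := by
          rw [← Finset.sum_mul, add_mul, one_mul]; linarith

open Polynomial in
/-- Interpolation on one half of an interval is close to interpolation on the whole interval if
the differences with the finer spacing are small. -/
theorem exists_interp_refine {r : ℕ} (hr : 2 ≤ r) : ∃ C : ℝ, 0 ≤ C ∧ ∀ (w : ℕ → ℝ) (E : ℝ), 0 ≤ E →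
    (∀ m, m + r ≤ 2 * (r - 1) → |∑ k ∈ Finset.range (r + 1), wt r k * w (m + k)| ≤ E) →
    ∀ c ≤ r - 1, ∀ x ∈ Icc (0 : ℝ) 1,
      |(interp r fun i => w (c + i)).eval x
        - (interp r fun i => w (2 * i)).eval ((x + node r c) / 2)| ≤ C * E := by
  obtain ⟨Λ, hΛ1, hΛ⟩ := exists_interp_bound r
  set D : ℝ := (2 ^ r + 1) ^ (2 * (r - 1)) with hD
  have hD0 : 0 ≤ D := by positivity
  have hr1 : (0 : ℝ) < r - 1 := by
    have : (2 : ℝ) ≤ r := by exact_mod_cast hr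
    linarith
  refine ⟨2 * Λ * D, by positivity, fun w E hE hw c hc x hx => ?_⟩
  have hinj : InjOn (fun i : ℕ => (i : ℝ)) (Finset.range r : Finset ℕ) :=
    fun i _ j _ h => Nat.cast_injective h
  -- Q matches w at the first r integers. The residual w - Q has the same r-th differences and
  -- vanishes there, hence is O(E), while both interpolants reproduce Q exactly after an affine
  -- change of variable.
  set Q : ℝ[X] := Lagrange.interpolate (Finset.range r) (fun i : ℕ => (i : ℝ)) w with hQ
  have hQd : Q.degree < r := by
    have := Lagrange.degree_interpolate_lt w hinj
    rwa [Finset.card_range] at this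
  set z : ℕ → ℝ := fun m => w m - Q.eval (m : ℝ) with hz
  have hz0 : ∀ i < r, z i = 0 := fun i hi => by
    have := Lagrange.eval_interpolate_at_node w hinj (Finset.mem_range.2 hi)
    simp only [hz, hQ]
    rw [this, sub_self]
  have hzd : ∀ m, m + r ≤ 2 * (r - 1) →
      |∑ k ∈ Finset.range (r + 1), wt r k * z (m + k)| ≤ E := fun m hm => by
    have h1 := sum_wt_mul_eval_eq_zero hQd m
    have e : ∑ k ∈ Finset.range (r + 1), wt r k * z (m + k)
        = ∑ k ∈ Finset.range (r + 1), wt r k * w (m + k) := by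
      simp only [hz, mul_sub, Finset.sum_sub_distrib]
      push_cast
      rw [h1, sub_zero]
    rw [e]; exact hw m hm
  have hzb : ∀ m ≤ 2 * (r - 1), |z m| ≤ D * E := fun m hm => by
    refine (abs_le_of_sum_wt_le hE hz0 hzd m hm).trans (mul_le_mul_of_nonneg_right ?_ hE)
    refine pow_le_pow_right₀ ?_ hm
    have : (0 : ℝ) ≤ 2 ^ r := by positivity
    linarith
  have hcomp : ∀ a b : ℝ, (Q.comp (C a * X + C b)).degree < r := fun a b => by
    refine lt_of_le_of_lt (degree_le_natDegree) ?_
    by_cases h0 : Q = 0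
    · simp only [h0, zero_comp, natDegree_zero]
      exact_mod_cast (by omega : 0 < r)
    have h1 : Q.natDegree < r := (natDegree_lt_iff_degree_lt h0).2 hQd
    have h2 : (Q.comp (C a * X + C b)).natDegree ≤ Q.natDegree * 1 := by
      rw [natDegree_comp]
      exact Nat.mul_le_mul_left _ (natDegree_linear_le)
    exact_mod_cast (by omega : (Q.comp (C a * X + C b)).natDegree < r)
  have e1 : (interp r fun i => w (c + i))
      = Q.comp (C ((r : ℝ) - 1) * X + C (c : ℝ)) + interp r fun i => z (c + i) := by
    rw [← interp_eval hr (hcomp ((r : ℝ) - 1) c), ← interp_add]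
    congr 1
    funext i
    simp only [hz, eval_comp, eval_add, eval_mul, eval_C, eval_X, node]
    rw [mul_div_cancel₀ _ hr1.ne', add_comm (i : ℝ)]
    push_cast; ring
  have e2 : (interp r fun i => w (2 * i))
      = Q.comp (C (2 * ((r : ℝ) - 1)) * X + C 0) + interp r fun i => z (2 * i) := by
    rw [← interp_eval hr (hcomp (2 * ((r : ℝ) - 1)) 0), ← interp_add]
    congr 1
    funext i
    simp only [hz, eval_comp, eval_add, eval_mul, eval_C, eval_X, node]
    rw [mul_assoc, mul_div_cancel₀ _ hr1.ne']
    push_cast; ring_nf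
  have hcn := node_mem_Icc hr (show c < r by omega)
  have b1 := hΛ x hx (fun i => z (c + i)) (D * E) (by positivity) fun i hi => hzb _ (by omega)
  have b2 := hΛ ((x + node r c) / 2) ⟨by linarith [hx.1, hcn.1], by linarith [hx.2, hcn.2]⟩
    (fun i => z (2 * i)) (D * E) (by positivity) fun i hi => hzb _ (by omega)
  have e3 : (Q.comp (C ((r : ℝ) - 1) * X + C (c : ℝ))).eval x
      = (Q.comp (C (2 * ((r : ℝ) - 1)) * X + C 0)).eval ((x + node r c) / 2) := by
    simp only [eval_comp, eval_add, eval_mul, eval_C, eval_X, node]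
    congr 1
    field_simp
    ring
  rw [e1, e2, eval_add, eval_add, e3, add_sub_add_left_eq_sub]
  refine (abs_sub _ _).trans ?_
  linarith

/-- A continuous function on `[0,1]` with small differences of order `r` is controlled by its
values at `r` equispaced nodes. -/
theorem exists_abs_le_nodes {r : ℕ} (hr : 2 ≤ r) : ∃ L : ℝ, 1 ≤ L ∧ ∀ β : ℝ, 0 < β → β < 1 →
    ∃ C : ℝ, 0 ≤ C ∧ ∀ (u : ℝ → ℝ) (K : ℝ), 0 ≤ K → ContinuousOn u (Icc 0 1) →
      (∀ (j : ℕ) (t η : ℝ), 0 ≤ η → η ≤ (1 / 2) ^ j → 0 ≤ t → t + r * η ≤ 1 →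
        |∑ k ∈ Finset.range (r + 1), wt r k * u (t + k * η)| ≤ K * β ^ j) →
      ∀ t ∈ Icc (0 : ℝ) 1, ∃ i < r, |u t| ≤ L * |u (node r i)| + C * K := by
  obtain ⟨Λ, hΛ1, hΛ⟩ := exists_interp_bound r
  obtain ⟨C, hC0, hC⟩ := exists_interp_refine hr
  refine ⟨Λ, hΛ1, fun β hβ hβ1 => ⟨C / (1 - β), div_nonneg hC0 (by linarith),
    fun u K hK hu hd t ht => ?_⟩⟩
  have h1β : 0 < 1 - β := by linarith
  have hr1 : (0 : ℝ) < r - 1 := by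
    have : (2 : ℝ) ≤ r := by exact_mod_cast hr
    linarith
  -- I a ℓ is the value at t of the interpolant of u on the interval [a, a + ℓ].
  set I : ℝ → ℝ → ℝ := fun a ℓ => (interp r fun i => u (a + ℓ * node r i)).eval ((t - a) / ℓ) with hI
  have hstep : ∀ j : ℕ, ∃ a : ℝ, 0 ≤ a ∧ a ≤ t ∧ t ≤ a + (1 / 2) ^ j ∧ a + (1 / 2) ^ j ≤ 1 ∧
      |I a ((1 / 2) ^ j) - I 0 1| ≤ C * K * ((1 - β ^ j) / (1 - β)) := by
    intro j
    induction j with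
    | zero => exact ⟨0, le_rfl, ht.1, by simpa using ht.2, by norm_num, by simp⟩
    | succ j ih =>
      obtain ⟨a, ha0, hat, hta, ha1, hIa⟩ := ih
      set ℓ : ℝ := (1 / 2) ^ j with hℓ
      have hℓ0 : 0 < ℓ := by positivity
      have hℓ' : ((1 : ℝ) / 2) ^ (j + 1) = ℓ / 2 := by rw [pow_succ, hℓ]; ring
      have hchild : ∀ c ≤ r - 1, a + ℓ / 2 * node r c ≤ t → t ≤ a + ℓ / 2 * node r c + ℓ / 2 →
          |I (a + ℓ / 2 * node r c) (ℓ / 2) - I a ℓ| ≤ C * (K * β ^ j) := by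
        intro c hc h1 h2
        -- This is the node spacing of a half interval, so the nodes of the interval and of the
        -- chosen half are all of the form a + m η.
        set η : ℝ := ℓ / (2 * (r - 1)) with hη
        have hη0 : 0 ≤ η := by positivity
        have hηℓ : η * (2 * (r - 1)) = ℓ := by rw [hη]; field_simp
        have key := hC (fun m => u (a + m * η)) (K * β ^ j) (by positivity) (by
          intro m hm
          have hm' : (m : ℝ) + r ≤ 2 * (r - 1) := by
            have : ((m + r : ℕ) : ℝ) ≤ ((2 * (r - 1) : ℕ) : ℝ) := by exact_mod_cast hm
            rw [Nat.cast_mul, Nat.cast_sub (by omega)] at this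
            push_cast at this; linarith
          have hh := hd j (a + m * η) η hη0 (by
              rw [← hℓ]; nlinarith [(by exact_mod_cast hr : (2 : ℝ) ≤ r)])
            (by positivity) (by nlinarith)
          refine le_trans (le_of_eq ?_) hh
          congr 1
          refine Finset.sum_congr rfl fun k _ => ?_
          push_cast
          rw [add_mul, add_assoc]) c hc ((t - (a + ℓ / 2 * node r c)) / (ℓ / 2))
          ⟨div_nonneg (by linarith) (by linarith), by rw [div_le_one (by positivity)]; linarith⟩
        refine le_trans (le_of_eq ?_) key
        congr 1
        have p1 : ∀ i : ℕ, a + ℓ / 2 * node r c + ℓ / 2 * node r i = a + ((c + i : ℕ) : ℝ) * η := by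
          intro i; simp only [node, hη]; push_cast; field_simp; ring
        have p2 : ∀ i : ℕ, a + ℓ * node r i = a + ((2 * i : ℕ) : ℝ) * η := by
          intro i; simp only [node, hη]; push_cast; field_simp
        have p3 : ((t - (a + ℓ / 2 * node r c)) / (ℓ / 2) + node r c) / 2 = (t - a) / ℓ := by
          field_simp; ring
        simp only [hI, p1, p2, p3]
      have hsum : C * K * ((1 - β ^ (j + 1)) / (1 - β))
          = C * (K * β ^ j) + C * K * ((1 - β ^ j) / (1 - β)) := by
        rw [pow_succ]; field_simp; ring
      have hfin : ∀ c ≤ r - 1, a + ℓ / 2 * node r c ≤ t → t ≤ a + ℓ / 2 * node r c + ℓ / 2 →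
          a + ℓ / 2 * node r c + ℓ / 2 ≤ 1 →
          ∃ a : ℝ, 0 ≤ a ∧ a ≤ t ∧ t ≤ a + (1 / 2) ^ (j + 1) ∧ a + (1 / 2) ^ (j + 1) ≤ 1 ∧
            |I a ((1 / 2) ^ (j + 1)) - I 0 1| ≤ C * K * ((1 - β ^ (j + 1)) / (1 - β)) := by
        intro c hc h1 h2 h3
        have hn0 := (node_mem_Icc hr (show c < r by omega)).1
        refine ⟨a + ℓ / 2 * node r c, by positivity, h1, by rw [hℓ']; exact h2,
          by rw [hℓ']; exact h3, ?_⟩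
        rw [hℓ', hsum]
        exact (abs_sub_le _ (I a ℓ) _).trans (add_le_add (hchild c hc h1 h2) hIa)
      have hnr : node r (r - 1) = 1 := by
        rw [node, Nat.cast_sub (by omega), Nat.cast_one, div_self hr1.ne']
      have hn0 : node r 0 = 0 := by simp [node]
      -- The index c = 0 selects the left half and c = r - 1 the right half.
      rcases le_total t (a + ℓ / 2) with h | h
      · exact hfin 0 (by omega) (by rw [hn0]; linarith) (by rw [hn0]; linarith)
          (by rw [hn0]; linarith)
      · exact hfin (r - 1) le_rfl (by rw [hnr]; linarith) (by rw [hnr]; linarith)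
          (by rw [hnr]; linarith)
  have hI0 : |u t| ≤ |I 0 1| + C * K / (1 - β) := by
    -- On short intervals around t the nodal values are close to u t, and interpolation reproduces
    -- constants, so the interpolants at t converge to u t.
    refine le_of_forall_pos_le_add fun ε hε => ?_
    have huc := isCompact_Icc.uniformContinuousOn_of_continuous hu
    rw [Metric.uniformContinuousOn_iff] at huc
    obtain ⟨ρ, hρ0, hρ⟩ := huc (ε / Λ) (by positivity)
    obtain ⟨j, hj⟩ := exists_pow_lt_of_lt_one hρ0 (by norm_num : (1 : ℝ) / 2 < 1)
    obtain ⟨a, ha0, hat, hta, ha1, hIa⟩ := hstep j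
    set ℓ : ℝ := (1 / 2) ^ j with hℓ
    have hℓ0 : 0 < ℓ := by positivity
    have hx : (t - a) / ℓ ∈ Icc (0 : ℝ) 1 :=
      ⟨div_nonneg (by linarith) hℓ0.le, by rw [div_le_one hℓ0]; linarith⟩
    have hconst : (interp r fun _ => u t) = Polynomial.C (u t) := by
      have := interp_eval hr (Q := Polynomial.C (u t))
        (lt_of_le_of_lt Polynomial.degree_C_le (by exact_mod_cast (by omega : 0 < r)))
      simpa using this
    have hb := hΛ _ hx (fun i => u t - u (a + ℓ * node r i)) (ε / Λ) (by positivity) (by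
      intro i hi
      have hn := node_mem_Icc hr hi
      have hm1 : 0 ≤ ℓ * node r i := mul_nonneg hℓ0.le hn.1
      have hm2 : ℓ * node r i ≤ ℓ := mul_le_of_le_one_right hℓ0.le hn.2
      have := hρ t ht (a + ℓ * node r i) ⟨by positivity, by linarith⟩ (by
        rw [Real.dist_eq, abs_lt]; constructor <;> linarith)
      rw [Real.dist_eq] at this
      exact this.le)
    rw [interp_sub, hconst, Polynomial.eval_sub, Polynomial.eval_C,
      mul_div_cancel₀ _ (by linarith : Λ ≠ 0)] at hb
    have hb' : |u t - I a ℓ| ≤ ε := hb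
    have hbd : C * K * ((1 - β ^ j) / (1 - β)) ≤ C * K / (1 - β) := by
      rw [mul_div_assoc']
      refine div_le_div_of_nonneg_right ?_ h1β.le
      have : 0 ≤ β ^ j := by positivity
      nlinarith [mul_nonneg (mul_nonneg hC0 hK) this]
    have h1 := abs_sub_abs_le_abs_sub (u t) (I a ℓ)
    have h2 := abs_sub_abs_le_abs_sub (I a ℓ) (I 0 1)
    linarith
  obtain ⟨i, hi, hmax⟩ := Finset.exists_max_image (Finset.range r) (fun i => |u (node r i)|)
    ⟨0, by simp; omega⟩
  refine ⟨i, by simpa using hi, ?_⟩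
  have hb := hΛ t ht (fun i => u (node r i)) |u (node r i)| (abs_nonneg _)
    fun k hk => hmax k (by simpa using hk)
  have e : I 0 1 = (interp r fun i => u (node r i)).eval t := by simp [hI]
  rw [e] at hI0
  calc |u t| ≤ _ := hI0
    _ ≤ _ := by rw [div_mul_eq_mul_div]; linarith

/-! ### Control by the values at the nodes of the cube -/

/-- The point of the tensor product grid of the unit cube with index `ν`. -/
noncomputable def cubeNode (d r : ℕ) (ν : Fin d → Fin r) : EuclideanSpace ℝ (Fin d) :=
  WithLp.toLp 2 fun i => node r (ν i)

theorem cubeNode_mem {d r : ℕ} (hr : 2 ≤ r) (ν : Fin d → Fin r) : cubeNode d r ν ∈ closedCube d :=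
  fun i => node_mem_Icc hr (ν i).2

-- Coordinates are moved to nodes one at a time, applying the one-variable result along each axis.
-- Every coordinate multiplies the leading factor by the same L, while β enters only the additive
-- constant.
open Classical in
theorem exists_abs_le_cubeNode {r : ℕ} (d : ℕ) (hr : 2 ≤ r) :
    ∃ L : ℝ, 1 ≤ L ∧ ∀ β : ℝ, 0 < β → β < 1 →
    ∃ C : ℝ, 0 ≤ C ∧ ∀ (n : ℕ), n ≤ r → ∀ (g : EuclideanSpace ℝ (Fin d) → ℝ) (K : ℝ), 0 ≤ K →
      ContinuousOn g (closedCube d) →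
      (∀ (l : ℕ) (x h : EuclideanSpace ℝ (Fin d)), x ∈ closedCube d →
          x + (n : ℝ) • h ∈ closedCube d → ‖h‖ ≤ (1 / 2) ^ l → |difference n h g x| ≤ K * β ^ l) →
      ∀ x ∈ closedCube d, ∃ ν : Fin d → Fin r, |g x| ≤ L * |g (cubeNode d r ν)| + C * K := by
  obtain ⟨L, hL1, hL⟩ := exists_abs_le_nodes hr
  refine ⟨L ^ d, one_le_pow₀ hL1, fun β hβ hβ1 => ?_⟩
  obtain ⟨C, hC0, hC⟩ := hL β hβ hβ1
  have hr0 : 0 < r := by omega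
  set repl : Finset (Fin d) → (Fin d → Fin r) → EuclideanSpace ℝ (Fin d) → EuclideanSpace ℝ (Fin d) :=
    fun S ν x => WithLp.toLp 2 fun i => if i ∈ S then node r (ν i) else x i with hrepl
  have hmain : ∀ S : Finset (Fin d), ∃ c : ℝ, 0 ≤ c ∧ ∀ (n : ℕ), n ≤ r →
      ∀ (g : EuclideanSpace ℝ (Fin d) → ℝ) (K : ℝ), 0 ≤ K →
      ContinuousOn g (closedCube d) →
      (∀ (l : ℕ) (x h : EuclideanSpace ℝ (Fin d)), x ∈ closedCube d →
          x + (n : ℝ) • h ∈ closedCube d → ‖h‖ ≤ (1 / 2) ^ l → |difference n h g x| ≤ K * β ^ l) →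
      ∀ x ∈ closedCube d, ∃ ν : Fin d → Fin r, |g x| ≤ L ^ S.card * |g (repl S ν x)| + c * K := by
    intro S
    induction S using Finset.induction_on with
    | empty =>
      exact ⟨0, le_rfl, fun n _ g K _ _ _ x _ => ⟨fun _ => ⟨0, hr0⟩, by simp [hrepl]⟩⟩
    | insert i S hi ih =>
      obtain ⟨c, hc0, hc⟩ := ih
      refine ⟨c + L ^ S.card * (C * 2 ^ r), by positivity, fun n hnr g K hK hg hd x hx => ?_⟩
      obtain ⟨ν, hν⟩ := hc n hnr g K hK hg hd x hx
      set y := repl S ν x with hy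
      have hyQ : y ∈ closedCube d := fun k => by
        simp only [hy, hrepl]
        split_ifs
        · exact node_mem_Icc hr (ν k).2
        · exact hx k
      set upd : ℝ → EuclideanSpace ℝ (Fin d) := fun t => WithLp.toLp 2 (Function.update (fun k => y k) i t)
        with hupd
      have hupdQ : ∀ t ∈ Icc (0 : ℝ) 1, upd t ∈ closedCube d := fun t ht k => by
        simp only [hupd]
        by_cases hk : k = i
        · subst hk; simpa using ht
        · rw [Function.update_of_ne hk]; exact hyQ k
      have hupdc : Continuous upd := by
        refine (PiLp.continuous_toLp 2 _).comp ?_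
        exact continuous_const.update i continuous_id
      have hupda : ∀ t s : ℝ, upd (t + s) = upd t + s • EuclideanSpace.single i (1 : ℝ) := by
        intro t s
        ext k
        by_cases hk : k = i
        · subst hk; simp [hupd]
        · simp [hupd, hk]
      obtain ⟨i0, hi0, hle⟩ := hC (fun t => g (upd t)) (2 ^ r * K) (by positivity)
        (hg.comp hupdc.continuousOn hupdQ) (by
          intro j t η hη0 hη ht0 ht1
          set h : EuclideanSpace ℝ (Fin d) := η • EuclideanSpace.single i (1 : ℝ) with hh
          have hpt : ∀ k : ℝ, upd (t + k * η) = upd t + k • h := fun k => by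
            rw [hupda, hh, smul_smul]
          have hmem : ∀ k : ℝ, 0 ≤ k → k ≤ r → upd t + k • h ∈ closedCube d := fun k h0 h1 => by
            rw [← hpt]
            exact hupdQ _ ⟨by positivity, by nlinarith⟩
          -- Interpolation needs differences of order r, but only order n ≤ r is controlled; the
          -- remaining m = r - n differences cost 2^m ≤ 2^r.
          obtain ⟨m, rfl⟩ := Nat.exists_eq_add_of_le' hnr
          have hdiff := abs_difference_add_le (n := n) (m := m) (g := g) (M := K * β ^ j)
            (x := upd t) (h := h) (by
              intro k hk
              have hk' : (k : ℝ) ≤ m := by exact_mod_cast hk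
              refine hd j _ h (hmem k (by positivity) (by push_cast; linarith [(by positivity : (0:ℝ) ≤ n)])) ?_ ?_
              · rw [add_assoc, ← add_smul]
                exact hmem _ (by positivity) (by push_cast; linarith)
              · rw [hh, norm_smul, Real.norm_of_nonneg hη0]; simpa using hη)
          rw [difference_eq, abs_mul, abs_pow, abs_neg, abs_one, one_pow, one_mul] at hdiff
          have e : ∑ k ∈ Finset.range (m + n + 1), wt (m + n) k * g (upd (t + k * η))
              = ∑ k ∈ Finset.range (m + n + 1), wt (m + n) k * g (upd t + (k : ℝ) • h) :=
            Finset.sum_congr rfl fun k _ => by rw [hpt]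
          rw [e]
          refine hdiff.trans ?_
          rw [mul_assoc]
          exact mul_le_mul_of_nonneg_right (pow_le_pow_right₀ (by norm_num) (by omega))
            (by positivity)) (y i) (hyQ i)
      have hself : upd (y i) = y := by
        ext k
        by_cases hk : k = i
        · subst hk; simp [hupd]
        · simp [hupd]
      refine ⟨Function.update ν i ⟨i0, hi0⟩, ?_⟩
      have e : repl (insert i S) (Function.update ν i ⟨i0, hi0⟩) x = upd (node r i0) := by
        ext k
        by_cases hk : k = i
        · subst hk; simp [hupd, hrepl]
        · simp [hupd, hrepl, hk, hy]
      rw [e, Finset.card_insert_of_notMem hi, pow_succ]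
      simp only [hself] at hle
      have hLp : 0 ≤ L ^ S.card := by positivity
      calc |g x| ≤ L ^ S.card * |g y| + c * K := hν
        _ ≤ L ^ S.card * (L * |g (upd (node r i0))| + C * (2 ^ r * K)) + c * K := by gcongr
        _ = _ := by ring
  obtain ⟨c, hc0, hc⟩ := hmain Finset.univ
  refine ⟨c, hc0, fun n hnr g K hK hg hd x hx => ?_⟩
  obtain ⟨ν, hν⟩ := hc n hnr g K hK hg hd x hx
  refine ⟨ν, ?_⟩
  have e : repl Finset.univ ν x = cubeNode d r ν := by simp [hrepl, cubeNode]
  simpa [e] using hν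

theorem abs_extrap_le {d : ℕ} (n : ℕ) (h : EuclideanSpace ℝ (Fin d))
    (g : EuclideanSpace ℝ (Fin d) → ℝ) (x : EuclideanSpace ℝ (Fin d)) :
    |extrap n h g x| ≤ 2 ^ n * ∑ i ∈ Finset.Icc 1 n, |g (x + (i : ℝ) • h)| := by
  rw [extrap, abs_neg]
  refine abs_sum_Icc_wt_le n _ _ (Finset.sum_nonneg fun _ _ => abs_nonneg _) fun k h1 h2 => ?_
  exact Finset.single_le_sum (f := fun i : ℕ => |g (x + (i : ℝ) • h)|) (fun _ _ => abs_nonneg _)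
    (Finset.mem_Icc.2 ⟨h1, h2⟩)

/-- The value at a point is controlled by the values on the segment towards any other point. -/
theorem abs_le_sum_segment {d n : ℕ} (hd : 1 ≤ d) (hn : 1 ≤ n)
    {g : EuclideanSpace ℝ (Fin d) → ℝ} {K : ℝ}
    (hg : ∀ (x h : EuclideanSpace ℝ (Fin d)), x ∈ closedCube d →
          x + (n : ℝ) • h ∈ closedCube d → ‖h‖ ≤ 1 → |difference n h g x| ≤ K)
    {x y : EuclideanSpace ℝ (Fin d)} (hx : x ∈ closedCube d) (hy : y ∈ closedCube d) :
    |g x| ≤ 2 ^ n * ∑ i ∈ Finset.Icc 1 n, |g (x + ((i : ℝ) / (n * d)) • (y - x))| + K := by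
  have hn0 : (1 : ℝ) ≤ n := by exact_mod_cast hn
  have hd0 : (1 : ℝ) ≤ d := by exact_mod_cast hd
  -- The cube has diameter at most d, so this step has length at most 1, and its n-fold multiple
  -- ends at x + (y - x) / d inside the cube.
  set h : EuclideanSpace ℝ (Fin d) := (1 / (n * d) : ℝ) • (y - x) with hh
  have h1 : x + (n : ℝ) • h ∈ closedCube d := by
    have := convex_closedCube d hx hy (a := 1 - 1 / d) (b := 1 / d)
      (by rw [sub_nonneg, div_le_one (by linarith)]; exact hd0) (by positivity) (by ring)
    convert this using 1
    rw [hh]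
    (match_scalars <;> field_simp); ring
  have h2 : ‖h‖ ≤ 1 := by
    rw [hh, norm_smul, Real.norm_of_nonneg (by positivity), one_div, inv_mul_le_iff₀ (by positivity)]
    have := norm_sub_le_of_mem_closedCube hx hy
    nlinarith
  have h3 := hg x h hx h1 h2
  rw [← abs_sub_extrap] at h3
  have h4 := abs_extrap_le n h g x
  have h5 : ∀ i : ℕ, x + ((i : ℝ) / (n * d)) • (y - x) = x + (i : ℝ) • h := fun i => by
    rw [hh, smul_smul]; congr 2; ring
  simp only [h5]
  have := abs_sub_abs_le_abs_sub (g x) (extrap n h g x)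
  linarith

/-! ### Dyadic cells -/

/-- The affine map of the unit cube onto the dyadic cube of side `2⁻ᵏ` with index `j`. -/
noncomputable def dil {d : ℕ} (k : ℕ) (j : Fin d → Fin (2 ^ k)) (x : EuclideanSpace ℝ (Fin d)) :
    EuclideanSpace ℝ (Fin d) :=
  (1 / 2 : ℝ) ^ k • (x + WithLp.toLp 2 fun i => ((j i : ℕ) : ℝ))

/-- The half-open dyadic cube of side `2⁻ᵏ` with index `j`. -/
def cell {d : ℕ} (k : ℕ) (j : Fin d → Fin (2 ^ k)) : Set (EuclideanSpace ℝ (Fin d)) :=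
  {y | ∀ i, 2 ^ k * y i - ((j i : ℕ) : ℝ) ∈ Ico (0 : ℝ) 1}

section

variable {d k : ℕ}

theorem dil_apply (j : Fin d → Fin (2 ^ k)) (x : EuclideanSpace ℝ (Fin d)) (i : Fin d) :
    dil k j x i = (1 / 2 : ℝ) ^ k * (x i + ((j i : ℕ) : ℝ)) := by
  simp [dil, mul_add]

theorem continuous_dil (j : Fin d → Fin (2 ^ k)) : Continuous (dil k j) := by
  unfold dil; fun_prop

theorem dil_add (j : Fin d → Fin (2 ^ k)) (x h : EuclideanSpace ℝ (Fin d)) :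
    dil k j (x + h) = dil k j x + (1 / 2 : ℝ) ^ k • h := by
  unfold dil; module

theorem two_pow_mul_half_pow (k : ℕ) : (2 : ℝ) ^ k * (1 / 2) ^ k = 1 := by
  rw [← mul_pow]; norm_num

theorem dil_mem_cell {j : Fin d → Fin (2 ^ k)} {x : EuclideanSpace ℝ (Fin d)}
    (hx : ∀ i, x i ∈ Ico (0 : ℝ) 1) : dil k j x ∈ cell k j := by
  intro i
  rw [dil_apply, ← mul_assoc, two_pow_mul_half_pow, one_mul, add_sub_cancel_right]
  exact hx i

theorem dil_mem_closedCube (j : Fin d → Fin (2 ^ k)) {x : EuclideanSpace ℝ (Fin d)}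
    (hx : x ∈ closedCube d) : dil k j x ∈ closedCube d := by
  intro i
  have h1 := (hx i).1
  have h2 := (hx i).2
  have h3 : ((j i : ℕ) : ℝ) + 1 ≤ 2 ^ k := by exact_mod_cast (j i).2
  have h4 := two_pow_mul_half_pow k
  have h5 : (0 : ℝ) < (1 / 2) ^ k := by positivity
  rw [dil_apply]
  refine ⟨by positivity, ?_⟩
  nlinarith

theorem dil_mem_openCube (j : Fin d → Fin (2 ^ k)) {x : EuclideanSpace ℝ (Fin d)}
    (hx : x ∈ openCube d) : dil k j x ∈ openCube d := by
  intro i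
  have h1 := (hx i).1
  have h2 := (hx i).2
  have h3 : ((j i : ℕ) : ℝ) + 1 ≤ 2 ^ k := by exact_mod_cast (j i).2
  have h4 := two_pow_mul_half_pow k
  have h5 : (0 : ℝ) < (1 / 2) ^ k := by positivity
  have h6 : (0 : ℝ) ≤ ((j i : ℕ) : ℝ) := by positivity
  rw [dil_apply]
  exact ⟨by positivity, by nlinarith⟩

theorem volume_preimage_dil (j : Fin d → Fin (2 ^ k)) (T : Set (EuclideanSpace ℝ (Fin d))) :
    volume (dil k j ⁻¹' T) = ENNReal.ofReal ((2 ^ k) ^ d) * volume T := by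
  have h := volume_preimage_smul_add (a := (1 / 2 : ℝ) ^ k) (by positivity)
    ((1 / 2 : ℝ) ^ k • WithLp.toLp 2 fun i => ((j i : ℕ) : ℝ)) T
  rw [← inv_pow, one_div, inv_inv] at h
  rw [← h]
  congr 1
  ext x
  simp only [mem_preimage, mem_ofPred_eq, dil, smul_add, one_div]

theorem map_dil (j : Fin d → Fin (2 ^ k)) :
    Measure.map (dil k j) volume = ENNReal.ofReal ((2 ^ k) ^ d) • volume := by
  ext T hT
  rw [Measure.map_apply (continuous_dil j).measurable hT, volume_preimage_dil]; rfl

theorem measurableSet_cell (j : Fin d → Fin (2 ^ k)) : MeasurableSet (cell k j) := by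
  have : cell k j = ⋂ i, {y : EuclideanSpace ℝ (Fin d) | 2 ^ k * y i - ((j i : ℕ) : ℝ) ∈ Ico (0 : ℝ) 1} := by
    ext x; simp [cell]
  rw [this]
  exact MeasurableSet.iInter fun i =>
    (by fun_prop : Measurable fun y : EuclideanSpace ℝ (Fin d) => 2 ^ k * y i - ((j i : ℕ) : ℝ))
      measurableSet_Ico

theorem pairwise_disjoint_cell :
    Pairwise (Function.onFun Disjoint (cell k : (Fin d → Fin (2 ^ k)) → Set _)) := by
  intro j j' hne
  rw [Function.onFun, Set.disjoint_left]
  intro y hy hy'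
  apply hne
  funext i
  have h1 := hy i
  have h2 := hy' i
  rw [mem_Ico] at h1 h2
  have h3 : ((j i : ℕ) : ℝ) < (j' i : ℕ) + 1 := by linarith
  have h4 : ((j' i : ℕ) : ℝ) < (j i : ℕ) + 1 := by linarith
  have h5 : (j i : ℕ) < (j' i : ℕ) + 1 := by exact_mod_cast h3
  have h6 : (j' i : ℕ) < (j i : ℕ) + 1 := by exact_mod_cast h4
  exact Fin.ext (by omega)

/-- The half-open unit cube. -/
def halfOpenCube (d : ℕ) : Set (EuclideanSpace ℝ (Fin d)) := {x | ∀ i, x i ∈ Ico (0 : ℝ) 1}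

theorem openCube_subset_halfOpenCube (d : ℕ) : openCube d ⊆ halfOpenCube d :=
  fun _ hx i => ⟨(hx i).1.le, (hx i).2⟩

theorem measurableSet_halfOpenCube (d : ℕ) : MeasurableSet (halfOpenCube d) := by
  have : halfOpenCube d = ⋂ i, {x : EuclideanSpace ℝ (Fin d) | x i ∈ Ico (0 : ℝ) 1} := by
    ext x; simp [halfOpenCube]
  rw [this]
  exact MeasurableSet.iInter fun i =>
    (by fun_prop : Measurable fun y : EuclideanSpace ℝ (Fin d) => y i) measurableSet_Ico

theorem volume_halfOpenCube (d : ℕ) : volume (halfOpenCube d) = 1 := by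
  have h := (EuclideanSpace.volume_preserving_symm_measurableEquiv_toLp (Fin d)).measure_preimage
    (s := Set.pi univ fun _ => Ico (0 : ℝ) 1)
    (MeasurableSet.univ_pi fun _ => measurableSet_Ico).nullMeasurableSet
  have e : (⇑(MeasurableEquiv.toLp 2 (Fin d → ℝ)).symm ⁻¹' Set.pi univ fun _ => Ico (0 : ℝ) 1)
      = halfOpenCube d := by
    ext x; simp [halfOpenCube]
  rw [e] at h
  rw [h, Real.volume_pi_Ico]; simp

theorem halfOpenCube_ae_eq_openCube (d : ℕ) : (halfOpenCube d : Set _) =ᵐ[volume] openCube d := by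
  refine (ae_eq_of_subset_of_measure_ge (openCube_subset_halfOpenCube d) ?_
    (measurableSet_openCube d).nullMeasurableSet (by rw [volume_halfOpenCube]; simp)).symm
  rw [volume_halfOpenCube, volume_openCube]

theorem cubeMeasure_eq_restrict_halfOpenCube (d : ℕ) :
    cubeMeasure d = volume.restrict (halfOpenCube d) :=
  Measure.restrict_congr_set (halfOpenCube_ae_eq_openCube d).symm

theorem preimage_dil_cell (j : Fin d → Fin (2 ^ k)) : dil k j ⁻¹' cell k j = halfOpenCube d := by
  ext x
  simp only [mem_preimage, cell, mem_ofPred_eq, halfOpenCube]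
  refine forall_congr' fun i => ?_
  rw [dil_apply, ← mul_assoc, two_pow_mul_half_pow, one_mul, add_sub_cancel_right]

theorem ofReal_two_pow_mul_volume_cell (j : Fin d → Fin (2 ^ k)) :
    ENNReal.ofReal ((2 ^ k) ^ d) * volume (cell k j) = 1 := by
  rw [← volume_preimage_dil j, preimage_dil_cell, volume_halfOpenCube]

theorem cell_subset_halfOpenCube (j : Fin d → Fin (2 ^ k)) : cell k j ⊆ halfOpenCube d := by
  intro y hy i
  have h1 := hy i
  rw [mem_Ico] at h1 ⊢
  have h3 : ((j i : ℕ) : ℝ) + 1 ≤ 2 ^ k := by exact_mod_cast (j i).2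
  have h6 : (0 : ℝ) ≤ ((j i : ℕ) : ℝ) := by positivity
  have h5 : (0 : ℝ) < 2 ^ k := by positivity
  constructor
  · by_contra h; push Not at h; nlinarith
  · by_contra h; push Not at h; nlinarith

theorem exists_mem_cell {y : EuclideanSpace ℝ (Fin d)} (hy : y ∈ halfOpenCube d) :
    ∃ j : Fin d → Fin (2 ^ k), y ∈ cell k j := by
  have hlt : ∀ i, ⌊(2 : ℝ) ^ k * y i⌋₊ < 2 ^ k := fun i => by
    have h1 := hy i
    rw [Nat.floor_lt (mul_nonneg (by positivity) h1.1)]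
    push_cast
    have h5 : (0 : ℝ) < 2 ^ k := by positivity
    nlinarith [h1.2]
  refine ⟨fun i => ⟨_, hlt i⟩, fun i => ?_⟩
  have h1 := hy i
  have h2 := Nat.floor_le (mul_nonneg (by positivity : (0 : ℝ) ≤ 2 ^ k) h1.1)
  have h3 := Nat.lt_floor_add_one ((2 : ℝ) ^ k * y i)
  simp only [mem_Ico]
  constructor <;> linarith

theorem difference_comp_dil (n : ℕ) (j : Fin d → Fin (2 ^ k)) (h : EuclideanSpace ℝ (Fin d))
    (f : EuclideanSpace ℝ (Fin d) → ℝ) (x : EuclideanSpace ℝ (Fin d)) :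
    difference n h (fun y => f (dil k j y)) x
      = difference n ((1 / 2 : ℝ) ^ k • h) f (dil k j x) := by
  unfold difference
  simp only [dil_add]
  congr 1
  refine Finset.sum_congr rfl fun i _ => ?_
  rw [smul_comm]

/-! ### Local averages of differences -/

theorem measurableSet_shrunkCube (h : EuclideanSpace ℝ (Fin d)) : MeasurableSet (shrunkCube d h) := by
  rw [shrunkCube_eq]
  exact (measurableSet_openCube d).inter
    ((by fun_prop : Measurable fun x : EuclideanSpace ℝ (Fin d) => x + h) (measurableSet_openCube d))

theorem measurable_difference_right (n : ℕ) {f : EuclideanSpace ℝ (Fin d) → ℝ}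
    (hf : Measurable f) (h : EuclideanSpace ℝ (Fin d)) : Measurable (difference n h f) := by
  unfold difference
  fun_prop

/-- The integral of the differences of a rescaled function, in terms of the cell. -/
theorem lintegral_difference_dil_le (n : ℕ) {f : EuclideanSpace ℝ (Fin d) → ℝ}
    (hf : Measurable f) (P : ℝ) (j : Fin d → Fin (2 ^ k)) (h : EuclideanSpace ℝ (Fin d)) :
    ∫⁻ x in shrunkCube d ((n : ℝ) • h), ‖difference n h (fun y => f (dil k j y)) x‖ₑ ^ P
      ≤ ENNReal.ofReal ((2 ^ k) ^ d) *
        ∫⁻ y in shrunkCube d ((n : ℝ) • (1 / 2 : ℝ) ^ k • h) ∩ cell k j,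
          ‖difference n ((1 / 2 : ℝ) ^ k • h) f y‖ₑ ^ P := by
  set S := shrunkCube d ((n : ℝ) • (1 / 2 : ℝ) ^ k • h) ∩ cell k j with hS
  have hSm : MeasurableSet S := (measurableSet_shrunkCube _).inter (measurableSet_cell j)
  set φ : EuclideanSpace ℝ (Fin d) → ℝ≥0∞ :=
    fun y => ‖difference n ((1 / 2 : ℝ) ^ k • h) f y‖ₑ ^ P with hφ
  have hφm : Measurable φ := (measurable_difference_right n hf _).enorm.pow_const P
  rw [← lintegral_indicator hSm, ← lintegral_indicator (measurableSet_shrunkCube _)]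
  have e : ENNReal.ofReal ((2 ^ k) ^ d) * ∫⁻ y, S.indicator φ y
      = ∫⁻ x, S.indicator φ (dil k j x) := by
    rw [← lintegral_map (hφm.indicator hSm) (continuous_dil j).measurable, map_dil,
      lintegral_smul_measure]; rfl
  rw [e]
  refine lintegral_mono fun x => ?_
  by_cases hx : x ∈ shrunkCube d ((n : ℝ) • h)
  · have hmem : dil k j x ∈ S := by
      rw [shrunkCube_eq] at hx
      refine ⟨?_, dil_mem_cell (openCube_subset_halfOpenCube d hx.1)⟩
      rw [shrunkCube_eq]
      refine ⟨dil_mem_openCube j hx.1, ?_⟩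
      rw [smul_comm, ← dil_add]
      exact dil_mem_openCube j hx.2
    rw [indicator_of_mem hx, indicator_of_mem hmem, difference_comp_dil]
  · rw [indicator_of_notMem hx]; exact zero_le

/-- The cells are disjoint, so the local integrals add up to at most the global one; the factor
2^{kd} is the Jacobian of the rescaling. -/
theorem sum_lintegral_difference_dil_le (n : ℕ) {f : EuclideanSpace ℝ (Fin d) → ℝ}
    (hf : Measurable f) (P : ℝ) (h : EuclideanSpace ℝ (Fin d)) :
    ∑ j : Fin d → Fin (2 ^ k),
      ∫⁻ x in shrunkCube d ((n : ℝ) • h), ‖difference n h (fun y => f (dil k j y)) x‖ₑ ^ P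
      ≤ ENNReal.ofReal ((2 ^ k) ^ d) *
        ∫⁻ y in shrunkCube d ((n : ℝ) • (1 / 2 : ℝ) ^ k • h),
          ‖difference n ((1 / 2 : ℝ) ^ k • h) f y‖ₑ ^ P := by
  refine (Finset.sum_le_sum fun j _ => lintegral_difference_dil_le n hf P j h).trans ?_
  rw [← Finset.mul_sum]
  refine mul_le_mul' le_rfl ?_
  rw [← tsum_fintype (L := .unconditional _), ← lintegral_iUnion
    (fun j => (measurableSet_shrunkCube _).inter (measurableSet_cell j))]
  · exact lintegral_mono_set (iUnion_subset fun j => inter_subset_left)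
  · intro j j' hne
    exact (pairwise_disjoint_cell hne).mono inter_subset_right inter_subset_right

theorem lintegral_difference_le_modulus {n : ℕ} {p : ℝ≥0∞} {P : ℝ} (hP : 0 < P)
    (hp : p = ENNReal.ofReal P) (f : EuclideanSpace ℝ (Fin d) → ℝ)
    {t : ℝ} {h : EuclideanSpace ℝ (Fin d)} (ht : ‖h‖ ≤ t) :
    ∫⁻ y in shrunkCube d ((n : ℝ) • h), ‖difference n h f y‖ₑ ^ P ≤ modulus n p f t ^ P := by
  have hle : eLpNorm (difference n h f) p (volume.restrict (shrunkCube d ((n : ℝ) • h)))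
      ≤ modulus n p f t := le_iSup₂ (f := fun (h : EuclideanSpace ℝ (Fin d)) (_ : ‖h‖ ≤ t) =>
        eLpNorm (difference n h f) p (volume.restrict (shrunkCube d ((n : ℝ) • h)))) h ht
  have hPt : p.toReal = P := by rw [hp, ENNReal.toReal_ofReal hP.le]
  rw [eLpNorm_eq_lintegral_rpow_enorm_toReal (by simp [hp, hP]) (by simp [hp]), hPt] at hle
  calc _ = ((∫⁻ y in shrunkCube d ((n : ℝ) • h), ‖difference n h f y‖ₑ ^ P) ^ (1 / P)) ^ P := by
        rw [← ENNReal.rpow_mul, one_div_mul_cancel hP.ne', ENNReal.rpow_one]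
    _ ≤ _ := ENNReal.rpow_le_rpow hle hP.le

/-- For p = ∞ an auxiliary finite exponent P is used, so that the same Chebyshev argument serves all
p. -/
theorem lintegral_difference_le_modulus_top {n : ℕ} {P : ℝ} (hP : 0 < P)
    (f : EuclideanSpace ℝ (Fin d) → ℝ)
    {t : ℝ} {h : EuclideanSpace ℝ (Fin d)} (ht : ‖h‖ ≤ t) (S : Set (EuclideanSpace ℝ (Fin d))) :
    ∫⁻ y in shrunkCube d ((n : ℝ) • h) ∩ S, ‖difference n h f y‖ₑ ^ P
      ≤ modulus n ∞ f t ^ P * volume S := by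
  have hle : eLpNorm (difference n h f) ∞ (volume.restrict (shrunkCube d ((n : ℝ) • h)))
      ≤ modulus n ∞ f t := le_iSup₂ (f := fun (h : EuclideanSpace ℝ (Fin d)) (_ : ‖h‖ ≤ t) =>
        eLpNorm (difference n h f) ∞ (volume.restrict (shrunkCube d ((n : ℝ) • h)))) h ht
  rw [eLpNorm_exponent_top] at hle
  have hae : ∀ᵐ y ∂(volume.restrict (shrunkCube d ((n : ℝ) • h) ∩ S)),
      ‖difference n h f y‖ₑ ^ P ≤ modulus n ∞ f t ^ P := by
    have h1 := enorm_ae_le_eLpNormEssSup (difference n h f)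
      (volume.restrict (shrunkCube d ((n : ℝ) • h)))
    have h2 := ae_mono (Measure.restrict_mono (μ := volume)
      (inter_subset_left (s := shrunkCube d ((n : ℝ) • h)) (t := S)) le_rfl) h1
    filter_upwards [h2] with y hy
    exact ENNReal.rpow_le_rpow (hy.trans hle) hP.le
  calc _ ≤ ∫⁻ _ in shrunkCube d ((n : ℝ) • h) ∩ S, modulus n ∞ f t ^ P := lintegral_mono_ae hae
    _ = modulus n ∞ f t ^ P * volume (shrunkCube d ((n : ℝ) • h) ∩ S) := by
        rw [setLIntegral_const]
    _ ≤ _ := mul_le_mul' le_rfl (measure_mono inter_subset_right)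

/-- The integral of the `P`-th power of the differences of `f` with steps of length at most `ρ`. -/
noncomputable def diffEnergy (n : ℕ) (P : ℝ) (ρ : ℝ) (f : EuclideanSpace ℝ (Fin d) → ℝ) : ℝ≥0∞ :=
  ∫⁻ h in Metric.closedBall 0 ρ,
    ∫⁻ x in shrunkCube d ((n : ℝ) • h), ‖difference n h f x‖ₑ ^ P

theorem measurable_lintegral_difference (n : ℕ) {f : EuclideanSpace ℝ (Fin d) → ℝ}
    (hf : Measurable f) (P : ℝ) : Measurable fun h : EuclideanSpace ℝ (Fin d) =>
      ∫⁻ x in shrunkCube d ((n : ℝ) • h), ‖difference n h f x‖ₑ ^ P := by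
  have hW : MeasurableSet {z : EuclideanSpace ℝ (Fin d) × EuclideanSpace ℝ (Fin d) |
      z.1 ∈ openCube d ∧ z.1 + (n : ℝ) • z.2 ∈ openCube d} :=
    (measurable_fst (measurableSet_openCube d)).inter
      ((by fun_prop : Measurable fun z : EuclideanSpace ℝ (Fin d) × EuclideanSpace ℝ (Fin d) =>
        z.1 + (n : ℝ) • z.2) (measurableSet_openCube d))
  have hm := (((measurable_difference n hf).enorm.pow_const P).indicator hW).lintegral_prod_left'
    (μ := (volume : Measure (EuclideanSpace ℝ (Fin d))))
  convert hm using 2 with h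
  rw [← lintegral_indicator (measurableSet_shrunkCube _)]
  refine lintegral_congr fun x => ?_
  rw [shrunkCube_eq]
  rfl

/-- Chebyshev's inequality for the differences of `f`. -/
theorem rpow_mul_volume_badSet_le (n : ℕ) {f : EuclideanSpace ℝ (Fin d) → ℝ} (hf : Measurable f)
    {P : ℝ} (hP : 0 < P) (ρ b : ℝ) :
    ENNReal.ofReal b ^ P * volume (badSet n f ρ b) ≤ diffEnergy n P ρ f := by
  have hbm := measurableSet_badSet n hf ρ b
  rw [diffEnergy, ← lintegral_indicator Metric.isClosed_closedBall.measurableSet,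
    Measure.volume_eq_prod, Measure.prod_apply_symm hbm, ← lintegral_const_mul]
  · refine lintegral_mono fun h => ?_
    by_cases hh : h ∈ Metric.closedBall (0 : EuclideanSpace ℝ (Fin d)) ρ
    · rw [indicator_of_mem hh, ← setLIntegral_const]
      have hsub : (fun x => (x, h)) ⁻¹' badSet n f ρ b ⊆ shrunkCube d ((n : ℝ) • h) := by
        intro x hx
        rw [shrunkCube_eq]
        exact ⟨hx.1, hx.2.1⟩
      refine (setLIntegral_mono' (measurable_prodMk_right hbm) fun x hx => ?_).trans
        (lintegral_mono_set hsub)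
      refine ENNReal.rpow_le_rpow ?_ hP.le
      rw [Real.enorm_eq_ofReal_abs]
      exact ENNReal.ofReal_le_ofReal (le_of_lt hx.2.2.2)
    · have : (fun x => (x, h)) ⁻¹' badSet n f ρ b = ∅ := by
        refine eq_empty_iff_forall_notMem.2 fun x hx => hh ?_
        rw [mem_closedBall_zero_iff]
        exact hx.2.2.1
      rw [this, measure_empty, mul_zero]; exact zero_le
  · exact measurable_measure_prodMk_right hbm

/-- Chebyshev's inequality says nothing at threshold zero; the set is exhausted by the thresholds 1
/ (N + 1). This is needed when a cell has error zero. -/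
theorem volume_badSet_zero_eq_zero (n : ℕ) {f : EuclideanSpace ℝ (Fin d) → ℝ} (hf : Measurable f)
    {P : ℝ} (hP : 0 < P) {ρ : ℝ} (h0 : diffEnergy n P ρ f = 0) :
    volume (badSet n f ρ 0) = 0 := by
  have hsub : badSet n f ρ 0 ⊆ ⋃ N : ℕ, badSet n f ρ (1 / ((N : ℝ) + 1)) := by
    rintro z ⟨h1, h2, h3, h4⟩
    obtain ⟨N, hN⟩ := exists_nat_one_div_lt h4
    exact mem_iUnion.2 ⟨N, h1, h2, h3, hN⟩
  refine measure_mono_null hsub (measure_iUnion_null fun N => ?_)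
  have h := rpow_mul_volume_badSet_le n hf hP ρ (1 / ((N : ℝ) + 1))
  rw [h0, nonpos_iff_eq_zero, mul_eq_zero] at h
  refine h.resolve_left ?_
  have : 0 < ENNReal.ofReal (1 / ((N : ℝ) + 1)) := ENNReal.ofReal_pos.2 (by positivity)
  exact (ENNReal.rpow_pos this ENNReal.ofReal_ne_top).ne'

/-- A step h on the rescaled cells is the step 2^{-k} h on the cube, so the modulus at 2^{-k} ρ
bounds the sum over cells for each h in the ball. -/
theorem sum_diffEnergy_dil_le {n : ℕ} {p : ℝ≥0∞} {P : ℝ} (hP : 0 < P) (hp : p = ENNReal.ofReal P)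
    {f : EuclideanSpace ℝ (Fin d) → ℝ} (hf : Measurable f) (ρ : ℝ) :
    ∑ j : Fin d → Fin (2 ^ k), diffEnergy n P ρ (fun y => f (dil k j y))
      ≤ ENNReal.ofReal ((2 ^ k) ^ d) * (modulus n p f ((1 / 2) ^ k * ρ) ^ P *
        volume (Metric.closedBall (0 : EuclideanSpace ℝ (Fin d)) ρ)) := by
  have hfj : ∀ j : Fin d → Fin (2 ^ k), Measurable fun y => f (dil k j y) := fun j =>
    hf.comp (continuous_dil j).measurable
  unfold diffEnergy
  rw [← lintegral_finsetSum _ fun j _ => measurable_lintegral_difference n (hfj j) P, ← mul_assoc, ← setLIntegral_const]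
  refine setLIntegral_mono' Metric.isClosed_closedBall.measurableSet fun h hh => ?_
  refine (sum_lintegral_difference_dil_le n hf P h).trans (mul_le_mul' le_rfl ?_)
  refine lintegral_difference_le_modulus hP hp f ?_
  rw [norm_smul, Real.norm_of_nonneg (by positivity)]
  exact mul_le_mul_of_nonneg_left (mem_closedBall_zero_iff.1 hh) (by positivity)

/-- For p = ∞ each cell is bounded separately: the Jacobian 2^{kd} cancels the volume of the cell.
-/
theorem diffEnergy_dil_le_top {n : ℕ} {P : ℝ} (hP : 0 < P)
    {f : EuclideanSpace ℝ (Fin d) → ℝ} (hf : Measurable f) (ρ : ℝ) (j : Fin d → Fin (2 ^ k)) :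
    diffEnergy n P ρ (fun y => f (dil k j y))
      ≤ modulus n ∞ f ((1 / 2) ^ k * ρ) ^ P *
        volume (Metric.closedBall (0 : EuclideanSpace ℝ (Fin d)) ρ) := by
  unfold diffEnergy
  rw [← setLIntegral_const]
  refine setLIntegral_mono' Metric.isClosed_closedBall.measurableSet fun h hh => ?_
  refine (lintegral_difference_dil_le n hf P j h).trans ?_
  refine (mul_le_mul' le_rfl (lintegral_difference_le_modulus_top hP f
    (t := (1 / 2) ^ k * ρ) ?_ (cell k j))).trans (le_of_eq ?_)
  · rw [norm_smul, Real.norm_of_nonneg (by positivity)]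
    exact mul_le_mul_of_nonneg_left (mem_closedBall_zero_iff.1 hh) (by positivity)
  · rw [mul_left_comm, ofReal_two_pow_mul_volume_cell, mul_one]

end

/-! ### The modulus of smoothness and the Besov seminorm -/

theorem modulus_mono {d : ℕ} (n : ℕ) (p : ℝ≥0∞) (f : EuclideanSpace ℝ (Fin d) → ℝ) {t u : ℝ}
    (h : t ≤ u) : modulus n p f t ≤ modulus n p f u :=
  iSup₂_le fun v hv => le_iSup₂ (f := fun (v : EuclideanSpace ℝ (Fin d)) (_ : ‖v‖ ≤ u) =>
    eLpNorm (difference n v f) p (volume.restrict (shrunkCube d ((n : ℝ) • v)))) v (hv.trans h)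

theorem lintegral_inv_Ioc {t : ℝ} (ht : 0 < t) :
    ∫⁻ u in Ioc t (Real.exp 1 * t), ENNReal.ofReal u⁻¹ = 1 := by
  have hle : t ≤ Real.exp 1 * t := by
    have := Real.add_one_le_exp 1
    nlinarith
  have h0 : (0 : ℝ) ∉ uIcc t (Real.exp 1 * t) := by
    rw [uIcc_of_le hle]; exact fun h => absurd h.1 (not_le.2 ht)
  have hint : IntegrableOn (fun u : ℝ => u⁻¹) (Ioc t (Real.exp 1 * t)) := by
    rw [← intervalIntegrable_iff_integrableOn_Ioc_of_le hle]
    exact intervalIntegral.intervalIntegrable_inv (fun u hu h => h0 (h ▸ hu)) continuousOn_id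
  rw [← ofReal_integral_eq_lintegral_ofReal hint, ← intervalIntegral.integral_of_le hle,
    integral_inv h0, mul_div_assoc, div_self ht.ne', mul_one, Real.log_exp, ENNReal.ofReal_one]
  filter_upwards [ae_restrict_mem measurableSet_Ioc] with u hu
  exact inv_nonneg.2 (ht.le.trans hu.1.le)

/-- The Besov seminorm controls the modulus of smoothness at small scales, uniformly in `q`. -/
theorem modulus_le_besovSeminorm {d : ℕ} {s : ℝ} (hs : 0 < s) {p q : ℝ≥0∞} (hq : 0 < q)
    (f : EuclideanSpace ℝ (Fin d) → ℝ) {t : ℝ} (ht : 0 < t) (ht1 : Real.exp 1 * t ≤ 1) :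
    modulus (besovOrder s) p f t
      ≤ ENNReal.ofReal ((Real.exp 1 * t) ^ s) * besovSeminorm s p q f := by
  have he : 1 ≤ Real.exp 1 := Real.one_le_exp (by norm_num)
  have hte : t ≤ Real.exp 1 * t := by nlinarith
  have het : 0 < Real.exp 1 * t := by positivity
  set c := ENNReal.ofReal ((Real.exp 1 * t) ^ (-s)) with hc
  suffices h : c * modulus (besovOrder s) p f t ≤ besovSeminorm s p q f by
    calc modulus (besovOrder s) p f t
        = ENNReal.ofReal ((Real.exp 1 * t) ^ s) * (c * modulus (besovOrder s) p f t) := by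
          rw [← mul_assoc, hc, ← ENNReal.ofReal_mul (by positivity), ← Real.rpow_add het]
          simp
      _ ≤ _ := mul_le_mul' le_rfl h
  unfold besovSeminorm
  split_ifs with hqt
  · refine le_trans (mul_le_mul' (ENNReal.ofReal_le_ofReal ?_) le_rfl)
      (le_iSup₂ (f := fun (t : ℝ) (_ : t ∈ Ioc (0 : ℝ) 1) =>
        ENNReal.ofReal (t ^ (-s)) * modulus (besovOrder s) p f t) t ⟨ht, hte.trans ht1⟩)
    exact Real.rpow_le_rpow_of_nonpos ht hte (by linarith)
  · have hq0 : 0 < q.toReal := ENNReal.toReal_pos hq.ne' hqt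
    -- The interval (t, e t] has mass exactly 1 for du / u, so the q-th power and q-th root cancel
    -- without a constant. This gives uniformity in q.
    have h1 : (c * modulus (besovOrder s) p f t) ^ q.toReal ≤
        ∫⁻ t in Ioc (0 : ℝ) 1, (ENNReal.ofReal (t ^ (-s)) * modulus (besovOrder s) p f t) ^ q.toReal
          * ENNReal.ofReal t⁻¹ := by
      calc (c * modulus (besovOrder s) p f t) ^ q.toReal
          = (c * modulus (besovOrder s) p f t) ^ q.toReal *
            ∫⁻ u in Ioc t (Real.exp 1 * t), ENNReal.ofReal u⁻¹ := by
            rw [lintegral_inv_Ioc ht, mul_one]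
        _ = ∫⁻ u in Ioc t (Real.exp 1 * t), (c * modulus (besovOrder s) p f t) ^ q.toReal *
              ENNReal.ofReal u⁻¹ := by
            rw [lintegral_const_mul]; fun_prop
        _ ≤ ∫⁻ u in Ioc t (Real.exp 1 * t),
            (ENNReal.ofReal (u ^ (-s)) * modulus (besovOrder s) p f u) ^ q.toReal
              * ENNReal.ofReal u⁻¹ := by
            refine setLIntegral_mono' measurableSet_Ioc fun u hu => ?_
            refine mul_le_mul' (ENNReal.rpow_le_rpow (mul_le_mul' ?_ ?_) hq0.le) le_rfl
            · exact ENNReal.ofReal_le_ofReal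
                (Real.rpow_le_rpow_of_nonpos (ht.trans hu.1) hu.2 (by linarith))
            · exact modulus_mono _ _ _ hu.1.le
        _ ≤ _ := lintegral_mono_set (Ioc_subset_Ioc ht.le ht1)
    calc c * modulus (besovOrder s) p f t
        = ((c * modulus (besovOrder s) p f t) ^ q.toReal) ^ (1 / q.toReal) := by
          rw [← ENNReal.rpow_mul, mul_one_div_cancel hq0.ne', ENNReal.rpow_one]
      _ ≤ _ := ENNReal.rpow_le_rpow h1 (by positivity)

/-- The factor 1/8 in `scale` absorbs the number e lost in averaging over (t, e t]. -/
theorem modulus_scale_le {d : ℕ} {s : ℝ} (hs : 0 < s) {p q : ℝ≥0∞} (hq : 0 < q)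
    (f : EuclideanSpace ℝ (Fin d) → ℝ) (k l : ℕ) :
    modulus (besovOrder s) p f ((1 / 2) ^ k * scale l)
      ≤ ENNReal.ofReal (((1 / 2) ^ (k + l)) ^ s) * besovSeminorm s p q f := by
  have h3 : Real.exp 1 < 3 := lt_trans Real.exp_one_lt_d9 (by norm_num)
  have hp : (0 : ℝ) < (1 / 2) ^ (k + l) := by positivity
  have e : (1 / 2 : ℝ) ^ k * scale l = (1 / 2) ^ (k + l) / 8 := by
    unfold scale; rw [pow_add]; ring
  have hle : Real.exp 1 * ((1 / 2) ^ k * scale l) ≤ (1 / 2) ^ (k + l) := by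
    rw [e]; nlinarith
  have h1 : ((1 : ℝ) / 2) ^ (k + l) ≤ 1 := pow_le_one₀ (by norm_num) (by norm_num)
  have hpos : 0 < (1 / 2 : ℝ) ^ k * scale l := by rw [e]; positivity
  refine (modulus_le_besovSeminorm hs hq f hpos (hle.trans h1)).trans ?_
  exact mul_le_mul' (ENNReal.ofReal_le_ofReal
    (Real.rpow_le_rpow (by positivity) hle hs.le)) le_rfl

/-! ### Local errors -/

/-- The exponent bookkeeping behind `exists_local_errors`. -/
theorem weight_mul_le {d : ℕ} {δ R P s : ℝ} (hδ : 0 < δ) (hP : 0 < P) (hPR : 1 / P ≤ R)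
    (hs : d / P + δ / 2 ≤ s) (l : ℕ) :
    (4 ^ l) ^ d * ((((1 / 2 : ℝ) ^ (δ / 4)) ^ l) ^ (-P)) * ((((1 / 2 : ℝ) ^ l) ^ s) ^ P
      * ((1 / 2) ^ l) ^ d) ≤ ((1 / 2 : ℝ) ^ (δ / (4 * R))) ^ l := by
  have hR : 0 < R := lt_of_lt_of_le (by positivity) hPR
  have h2 : (0 : ℝ) < 1 / 2 := by norm_num
  have e4 : ((4 : ℝ) ^ l) ^ d = (1 / 2 : ℝ) ^ (-(2 * l * d) : ℝ) := by
    rw [Real.rpow_neg h2.le, one_div, Real.inv_rpow (by norm_num), inv_inv,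
      show (2 * l * d : ℝ) = ((2 * l * d : ℕ) : ℝ) by push_cast; ring, Real.rpow_natCast,
      pow_mul, pow_mul]
    norm_num
  have e1 : ((((1 / 2 : ℝ) ^ (δ / 4)) ^ l) ^ (-P)) = (1 / 2 : ℝ) ^ (δ / 4 * l * (-P)) := by
    rw [← Real.rpow_natCast, ← Real.rpow_mul h2.le, ← Real.rpow_mul h2.le]
  have e2 : (((1 / 2 : ℝ) ^ l) ^ s) ^ P = (1 / 2 : ℝ) ^ (l * s * P) := by
    rw [← Real.rpow_natCast, ← Real.rpow_mul h2.le, ← Real.rpow_mul h2.le]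
  have e3 : ((1 / 2 : ℝ) ^ l) ^ d = (1 / 2 : ℝ) ^ ((l : ℝ) * d) := by
    rw [← pow_mul, ← Real.rpow_natCast]; push_cast; rfl
  have e5 : ((1 / 2 : ℝ) ^ (δ / (4 * R))) ^ l = (1 / 2 : ℝ) ^ (δ / (4 * R) * l) := by
    rw [← Real.rpow_natCast, ← Real.rpow_mul h2.le]
  rw [e4, e1, e2, e3, e5, ← Real.rpow_add h2, ← Real.rpow_add h2, ← Real.rpow_add h2]
  refine Real.rpow_le_rpow_of_exponent_ge h2 (by norm_num) ?_
  have h1 : (d : ℝ) + δ / 2 * P ≤ s * P := by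
    have := mul_le_mul_of_nonneg_right hs hP.le
    rwa [add_mul, div_mul_cancel₀ _ hP.ne'] at this
  have h3 : δ / (4 * R) ≤ δ / 4 * P := by
    rw [div_le_iff₀ (by positivity)]
    have : 1 ≤ R * P := by rwa [div_le_iff₀ hP] at hPR
    nlinarith
  -- Per unit of l the exponent of 1/2 is sP - d - δP/4. The margin gives sP - d ≥ δP/2, half of
  -- which pays for β^{-P}.
  have h4 : δ / (4 * R) ≤ s * P - δ / 4 * P - d := by linarith
  have hl : (0 : ℝ) ≤ l := by positivity
  nlinarith [mul_le_mul_of_nonneg_right h4 hl]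

/-- Chebyshev at threshold S^{1/P} β^l: the weight is chosen so that β^{lP} cancels and exactly the
measure bound η 4^{-ld} remains after dividing by S. This division is why S = 0 is treated apart. -/
theorem smallDiff_of_tsum {d n : ℕ} {f : EuclideanSpace ℝ (Fin d) → ℝ} (hf : Measurable f)
    {P η β : ℝ} (hP : 0 < P) (hη : 0 < η) (hβ : 0 < β) {S : ℝ≥0∞} (hS : S ≠ ∞)
    (h : ∀ l, ENNReal.ofReal (η⁻¹ * (4 ^ l) ^ d * (β ^ l) ^ (-P)) * diffEnergy n P (scale l) f ≤ S) :
    SmallDiff n f η β (S ^ (1 / P)).toReal := by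
  have hfin : S ^ (1 / P) ≠ ∞ := ENNReal.rpow_ne_top_of_nonneg (by positivity) hS
  intro l
  by_cases h0 : S = 0
  · have hD : diffEnergy n P (scale l) f = 0 := by
      have := h l
      rw [h0, nonpos_iff_eq_zero, mul_eq_zero] at this
      exact this.resolve_left (ENNReal.ofReal_pos.2 (by positivity)).ne'
    rw [h0, ENNReal.zero_rpow_of_pos (by positivity), ENNReal.toReal_zero, zero_mul,
      volume_badSet_zero_eq_zero n hf hP hD]
    exact zero_le
  · set v := volume (badSet n f (scale l) ((S ^ (1 / P)).toReal * β ^ l)) with hv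
    have h1 : ENNReal.ofReal ((S ^ (1 / P)).toReal * β ^ l) ^ P * v ≤ diffEnergy n P (scale l) f :=
      rpow_mul_volume_badSet_le n hf hP _ _
    rw [ENNReal.ofReal_mul ENNReal.toReal_nonneg, ENNReal.ofReal_toReal hfin,
      ENNReal.mul_rpow_of_nonneg _ _ hP.le, ← ENNReal.rpow_mul, one_div_mul_cancel hP.ne',
      ENNReal.rpow_one, ENNReal.ofReal_rpow_of_pos (by positivity)] at h1
    have h2 : S * (ENNReal.ofReal (η⁻¹ * (4 ^ l) ^ d) * v) ≤ S * 1 := by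
      rw [mul_one]
      refine le_trans (le_of_eq ?_) ((mul_le_mul' le_rfl h1).trans (h l))
      have e : η⁻¹ * (4 ^ l) ^ d = (η⁻¹ * (4 ^ l) ^ d * (β ^ l) ^ (-P)) * (β ^ l) ^ P := by
        rw [mul_assoc _ ((β ^ l) ^ (-P)), ← Real.rpow_add (by positivity)]; simp
      have e' : ENNReal.ofReal (η⁻¹ * (4 ^ l) ^ d)
          = ENNReal.ofReal (η⁻¹ * (4 ^ l) ^ d * (β ^ l) ^ (-P)) * ENNReal.ofReal ((β ^ l) ^ P) := by
        rw [← ENNReal.ofReal_mul (by positivity), ← e]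
      rw [e']
      ring
    have h3 := (ENNReal.mul_le_mul_iff_right h0 hS).1 h2
    have e2 : ENNReal.ofReal (η * ((1 / 4) ^ l) ^ d) * ENNReal.ofReal (η⁻¹ * (4 ^ l) ^ d) = 1 := by
      rw [← ENNReal.ofReal_mul (by positivity), ← ENNReal.ofReal_one]
      congr 1
      have : ((1 / 4 : ℝ) ^ l) ^ d * (4 ^ l) ^ d = 1 := by
        rw [← mul_pow, ← mul_pow]; norm_num
      calc η * ((1 / 4) ^ l) ^ d * (η⁻¹ * (4 ^ l) ^ d)
          = (η * η⁻¹) * (((1 / 4 : ℝ) ^ l) ^ d * (4 ^ l) ^ d) := by ring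
        _ = 1 := by rw [this, mul_inv_cancel₀ hη.ne', one_mul]
    calc v = ENNReal.ofReal (η * ((1 / 4) ^ l) ^ d) * (ENNReal.ofReal (η⁻¹ * (4 ^ l) ^ d) * v) := by
          rw [← mul_assoc, e2, one_mul]
      _ ≤ ENNReal.ofReal (η * ((1 / 4) ^ l) ^ d) * 1 := mul_le_mul' le_rfl h3
      _ = _ := mul_one _

theorem volume_closedBall_scale_le (d l : ℕ) :
    volume (Metric.closedBall (0 : EuclideanSpace ℝ (Fin d)) (scale l))
      ≤ ENNReal.ofReal (((1 / 2) ^ l) ^ d) * volume (Metric.ball (0 : EuclideanSpace ℝ (Fin d)) 1) := by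
  rw [Measure.addHaar_closedBall _ _ (scale_pos l).le, finrank_euclideanSpace_fin]
  refine mul_le_mul' (ENNReal.ofReal_le_ofReal (pow_le_pow_left₀ (scale_pos l).le ?_ d)) le_rfl
  unfold scale
  have : (0 : ℝ) < (1 / 2) ^ l := by positivity
  linarith

/-- Bounds for the differences on the dyadic cubes of side `2⁻ᵏ`, whose (quasi-)norm in `ℓ_p` is
controlled by the seminorm. -/
theorem exists_local_errors (d n : ℕ) {η δ R : ℝ} (hη : 0 < η) (hδ : 0 < δ) (hR : 0 < R) :
    ∃ A : ℝ≥0, ∀ (p M : ℝ≥0∞) (P s : ℝ) (f : EuclideanSpace ℝ (Fin d) → ℝ), Measurable f →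
      0 < P → 1 / P ≤ R → d / P + δ / 2 ≤ s → (p = ∞ ∨ p = ENNReal.ofReal P) → M ≠ ∞ →
      (∀ k l, modulus n p f ((1 / 2) ^ k * scale l) ≤ ENNReal.ofReal (((1 / 2) ^ (k + l)) ^ s) * M) →
      ∀ k : ℕ, ∃ e : (Fin d → Fin (2 ^ k)) → ℝ, (∀ j, 0 ≤ e j) ∧
        (∀ j, SmallDiff n (fun y => f (dil k j y)) η ((1 / 2) ^ (δ / 4)) (e j)) ∧
        (p = ∞ → ∀ j, ENNReal.ofReal (e j) ≤ A * (ENNReal.ofReal (((1 / 2) ^ k) ^ s) * M)) ∧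
        (p = ENNReal.ofReal P → ∑ j, ENNReal.ofReal (e j) ^ P ≤
          ENNReal.ofReal ((2 ^ k) ^ d) * (A * (ENNReal.ofReal (((1 / 2) ^ k) ^ s) * M)) ^ P) := by
  set β : ℝ := (1 / 2) ^ (δ / 4) with hβ
  have hβ0 : 0 < β := by positivity
  set q₀ : ℝ := (1 / 2) ^ (δ / (4 * R)) with hq₀
  have hq₀0 : 0 < q₀ := by positivity
  have hq₀1 : q₀ < 1 := Real.rpow_lt_one (by norm_num) (by norm_num) (by positivity)
  set v := volume (Metric.ball (0 : EuclideanSpace ℝ (Fin d)) 1) with hv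
  have hvfin : v ≠ ∞ := measure_ball_lt_top.ne
  set A₀ : ℝ≥0∞ := ENNReal.ofReal (η⁻¹ * (1 - q₀)⁻¹) * v with hA₀
  have hA₀fin : A₀ ≠ ∞ := ENNReal.mul_ne_top ENNReal.ofReal_ne_top hvfin
  -- One A with A₀ ≤ A^P is needed for all P with 1 / P ≤ R; raising a number at least 1 to the
  -- power R achieves this.
  set A : ℝ≥0∞ := (max 1 A₀) ^ R with hA
  have hAfin : A ≠ ∞ := ENNReal.rpow_ne_top_of_nonneg hR.le (by simp [hA₀fin])
  refine ⟨A.toNNReal, fun p M P s f hf hP hPR hs hp hM hmod k => ?_⟩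
  rw [ENNReal.coe_toNNReal hAfin]
  set X := ENNReal.ofReal (((1 / 2) ^ k) ^ s) * M with hX
  have hXfin : X ≠ ∞ := ENNReal.mul_ne_top ENNReal.ofReal_ne_top hM
  set w : ℕ → ℝ := fun l => η⁻¹ * (4 ^ l) ^ d * (β ^ l) ^ (-P) with hw
  have hw0 : ∀ l, 0 < w l := fun l => by positivity
  have hfj : ∀ j : Fin d → Fin (2 ^ k), Measurable fun y => f (dil k j y) := fun j =>
    hf.comp (continuous_dil j).measurable
  set Z : ℕ → ℝ≥0∞ := fun l => modulus n p f ((1 / 2) ^ k * scale l) ^ P *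
        volume (Metric.closedBall (0 : EuclideanSpace ℝ (Fin d)) (scale l)) with hZ
  have hmod' : ∀ l, modulus n p f ((1 / 2) ^ k * scale l)
      ≤ ENNReal.ofReal (((1 / 2) ^ l) ^ s) * X := fun l => by
    refine (hmod k l).trans (le_of_eq ?_)
    rw [hX, ← mul_assoc, ← ENNReal.ofReal_mul (by positivity),
      ← Real.mul_rpow (by positivity) (by positivity), ← pow_add, add_comm]
  have hZle : ∀ l, ENNReal.ofReal (w l) * Z l ≤ ENNReal.ofReal (η⁻¹ * q₀ ^ l) * (v * X ^ P) := by
    intro l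
    calc ENNReal.ofReal (w l) * Z l
        ≤ ENNReal.ofReal (w l) * ((ENNReal.ofReal (((1 / 2) ^ l) ^ s) * X) ^ P *
          (ENNReal.ofReal (((1 / 2) ^ l) ^ d) * v)) :=
          mul_le_mul' le_rfl (mul_le_mul' (ENNReal.rpow_le_rpow (hmod' l) hP.le)
            (volume_closedBall_scale_le d l))
      _ = ENNReal.ofReal (w l * ((((1 / 2) ^ l) ^ s) ^ P * ((1 / 2) ^ l) ^ d)) * (v * X ^ P) := by
          rw [ENNReal.mul_rpow_of_nonneg _ _ hP.le, ENNReal.ofReal_rpow_of_pos (by positivity),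
            ENNReal.ofReal_mul (hw0 l).le,
            ENNReal.ofReal_mul (p := (((1 / 2 : ℝ) ^ l) ^ s) ^ P) (by positivity)]
          ring
      _ ≤ _ := by
          refine mul_le_mul' (ENNReal.ofReal_le_ofReal ?_) le_rfl
          have := mul_le_mul_of_nonneg_left (weight_mul_le hδ hP hPR hs l)
            (inv_nonneg.2 hη.le)
          refine le_trans (le_of_eq ?_) this
          simp only [hw, hβ]; ring
  have hsumZ : ∑' l, ENNReal.ofReal (w l) * Z l ≤ (A * X) ^ P := by
    calc ∑' l, ENNReal.ofReal (w l) * Z l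
        ≤ ∑' l, ENNReal.ofReal (η⁻¹ * q₀ ^ l) * (v * X ^ P) := ENNReal.tsum_le_tsum hZle
      _ = A₀ * X ^ P := by
          rw [ENNReal.tsum_mul_right, ← ENNReal.ofReal_tsum_of_nonneg (fun l => by positivity)
            ((summable_geometric_of_lt_one hq₀0.le hq₀1).mul_left _), tsum_mul_left,
            tsum_geometric_of_lt_one hq₀0.le hq₀1, hA₀]
          ring
      _ ≤ A ^ P * X ^ P := by
          refine mul_le_mul' ?_ le_rfl
          rw [hA, ← ENNReal.rpow_mul]
          have h1 : 1 ≤ R * P := by rwa [div_le_iff₀ hP] at hPR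
          calc A₀ ≤ max 1 A₀ := le_max_right _ _
            _ = (max 1 A₀) ^ (1 : ℝ) := (ENNReal.rpow_one _).symm
            _ ≤ _ := ENNReal.rpow_le_rpow_of_exponent_le (le_max_left _ _) h1
      _ = _ := (ENNReal.mul_rpow_of_nonneg _ _ hP.le).symm
  -- S j collects the weighted energies of cell j over all levels; the local error is its P-th root.
  set S : (Fin d → Fin (2 ^ k)) → ℝ≥0∞ := fun j =>
    ∑' l, ENNReal.ofReal (w l) * diffEnergy n P (scale l) (fun y => f (dil k j y)) with hS
  have hAX : (A * X) ^ P ≠ ∞ :=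
    ENNReal.rpow_ne_top_of_nonneg hP.le (ENNReal.mul_ne_top hAfin hXfin)
  have hStop : p = ∞ → ∀ j, S j ≤ (A * X) ^ P := fun hpt j => by
    refine le_trans (ENNReal.tsum_le_tsum fun l => mul_le_mul' le_rfl ?_) hsumZ
    rw [hZ, hpt]
    exact diffEnergy_dil_le_top hP hf (scale l) j
  have hSsum : p = ENNReal.ofReal P → ∑ j, S j ≤ ENNReal.ofReal ((2 ^ k) ^ d) * (A * X) ^ P := by
    intro hpP
    calc ∑ j, S j = ∑' l, ∑ j : Fin d → Fin (2 ^ k),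
          ENNReal.ofReal (w l) * diffEnergy n P (scale l) (fun y => f (dil k j y)) := by
          rw [Summable.tsum_finsetSum fun _ _ => ENNReal.summable]
      _ ≤ ∑' l, ENNReal.ofReal ((2 ^ k) ^ d) * (ENNReal.ofReal (w l) * Z l) := by
          refine ENNReal.tsum_le_tsum fun l => ?_
          rw [← Finset.mul_sum, mul_left_comm]
          exact mul_le_mul' le_rfl (sum_diffEnergy_dil_le hP hpP hf (scale l))
      _ ≤ _ := by
          rw [ENNReal.tsum_mul_left]
          exact mul_le_mul' le_rfl hsumZ
  have hSfin : ∀ j, S j ≠ ∞ := fun j => by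
    rcases hp with hp | hp
    · exact ne_top_of_le_ne_top hAX (hStop hp j)
    · refine ne_top_of_le_ne_top (ENNReal.mul_ne_top ENNReal.ofReal_ne_top hAX)
        (le_trans ?_ (hSsum hp))
      exact Finset.single_le_sum (f := S) (fun _ _ => zero_le) (Finset.mem_univ j)
  have hroot : ∀ j, ENNReal.ofReal (S j ^ (1 / P)).toReal = S j ^ (1 / P) := fun j =>
    ENNReal.ofReal_toReal (ENNReal.rpow_ne_top_of_nonneg (by positivity) (hSfin j))
  refine ⟨fun j => (S j ^ (1 / P)).toReal, fun j => ENNReal.toReal_nonneg, fun j => ?_, ?_, ?_⟩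
  · exact smallDiff_of_tsum (hfj j) hP hη hβ0 (hSfin j) fun l => ENNReal.le_tsum l
  · intro hpt j
    rw [hroot]
    calc S j ^ (1 / P) ≤ ((A * X) ^ P) ^ (1 / P) :=
          ENNReal.rpow_le_rpow (hStop hpt j) (by positivity)
      _ = A * X := by rw [← ENNReal.rpow_mul, mul_one_div_cancel hP.ne', ENNReal.rpow_one]
  · intro hpP
    refine le_trans (le_of_eq (Finset.sum_congr rfl fun j _ => ?_)) (hSsum hpP)
    rw [hroot, ← ENNReal.rpow_mul, one_div_mul_cancel hP.ne', ENNReal.rpow_one]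

/-! ### The modulus depends only on the values in the cube up to null sets -/

/-- All sample points lie on a segment inside the cube, so only finitely many translates of a null
set matter. This allows f to be replaced by a measurable representative. -/
theorem difference_ae_eq {d n : ℕ} {f g : EuclideanSpace ℝ (Fin d) → ℝ}
    (hfg : f =ᵐ[cubeMeasure d] g) (h : EuclideanSpace ℝ (Fin d)) :
    difference n h f =ᵐ[volume.restrict (shrunkCube d ((n : ℝ) • h))] difference n h g := by
  have h1 : ∀ᵐ y ∂(volume : Measure (EuclideanSpace ℝ (Fin d))), y ∈ openCube d → f y = g y :=
    (ae_restrict_iff' (measurableSet_openCube d)).1 hfg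
  have h2 : ∀ᵐ x ∂(volume : Measure (EuclideanSpace ℝ (Fin d))), ∀ k ∈ Finset.range (n + 1),
      x + (k : ℝ) • h ∈ openCube d → f (x + (k : ℝ) • h) = g (x + (k : ℝ) • h) := by
    rw [Filter.eventually_all_finset]
    intro k _
    exact (measurePreserving_add_right volume ((k : ℝ) • h)).quasiMeasurePreserving.ae h1
  refine (ae_restrict_iff' (measurableSet_shrunkCube _)).2 ?_
  filter_upwards [h2] with x hx hxs
  unfold difference
  congr 1
  refine Finset.sum_congr rfl fun k hk => ?_
  have hk' : k ≤ n := by simp at hk; omega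
  have hmem : x + (k : ℝ) • h ∈ openCube d := by
    rcases Nat.eq_zero_or_pos n with hn | hn
    · have : k = 0 := by omega
      subst this
      simpa using hxs.1
    · refine hxs.2 ?_
      have hn0 : (0 : ℝ) < n := by exact_mod_cast hn
      have hkn : (k : ℝ) ≤ n := by exact_mod_cast hk'
      rw [segment_eq_image']
      refine ⟨k / n, ⟨by positivity, by rw [div_le_one hn0]; exact hkn⟩, ?_⟩
      simp only [add_sub_cancel_left, smul_smul]
      rw [div_mul_cancel₀ _ hn0.ne']
  rw [hx k hk hmem]

theorem modulus_congr_ae {d n : ℕ} {p : ℝ≥0∞} {f g : EuclideanSpace ℝ (Fin d) → ℝ}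
    (hfg : f =ᵐ[cubeMeasure d] g) (t : ℝ) : modulus n p f t = modulus n p g t := by
  unfold modulus
  exact iSup_congr fun h => iSup_congr fun _ => eLpNorm_congr_ae (difference_ae_eq hfg h)

theorem besovSeminorm_congr_ae {d : ℕ} {s : ℝ} {p q : ℝ≥0∞} {f g : EuclideanSpace ℝ (Fin d) → ℝ}
    (hfg : f =ᵐ[cubeMeasure d] g) : besovSeminorm s p q f = besovSeminorm s p q g := by
  unfold besovSeminorm
  simp only [modulus_congr_ae hfg]

/-! ### Pointwise estimates on dyadic cubes -/

theorem comp_dil_ae_eq {d k : ℕ} {f g : EuclideanSpace ℝ (Fin d) → ℝ}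
    (hfg : f =ᵐ[cubeMeasure d] g) (j : Fin d → Fin (2 ^ k)) :
    (fun x => f (dil k j x)) =ᵐ[cubeMeasure d] fun x => g (dil k j x) := by
  have h1 : ∀ᵐ y ∂(volume : Measure (EuclideanSpace ℝ (Fin d))), y ∈ openCube d → f y = g y :=
    (ae_restrict_iff' (measurableSet_openCube d)).1 hfg
  have hq : Measure.QuasiMeasurePreserving (dil k j) volume volume := by
    refine ⟨(continuous_dil j).measurable, ?_⟩
    rw [map_dil]
    exact Measure.smul_absolutelyContinuous
  refine (ae_restrict_iff' (measurableSet_openCube d)).2 ?_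
  filter_upwards [hq.ae h1] with x hx hxo
  exact hx (dil_mem_openCube j hxo)

theorem dil_zero {d : ℕ} (j : Fin d → Fin (2 ^ 0)) (x : EuclideanSpace ℝ (Fin d)) :
    dil 0 j x = x := by
  ext i
  have : ((j i : ℕ)) = 0 := by have := (j i).2; omega
  rw [dil_apply, this]; simp

/-- The continuous representative, with its pointwise estimates on all dyadic cubes. -/
theorem exists_pointwise_estimates {d n r : ℕ} (hd : 1 ≤ d) (hn : 1 ≤ n) (hr : 2 ≤ r) (hnr : n ≤ r) :
    ∃ L : ℝ, 1 ≤ L ∧ ∀ δ R : ℝ, 0 < δ → 0 < R → ∃ A : ℝ≥0,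
      ∀ (p M : ℝ≥0∞) (P s : ℝ) (f : EuclideanSpace ℝ (Fin d) → ℝ), Measurable f →
      0 < P → 1 / P ≤ R → d / P + δ / 2 ≤ s → (p = ∞ ∨ p = ENNReal.ofReal P) → M ≠ ∞ →
      (∀ k l, modulus n p f ((1 / 2) ^ k * scale l) ≤ ENNReal.ofReal (((1 / 2) ^ (k + l)) ^ s) * M) →
      ∃ g : EuclideanSpace ℝ (Fin d) → ℝ, Measurable g ∧ ContinuousOn g (closedCube d) ∧
        g =ᵐ[cubeMeasure d] f ∧
      ∀ k : ℕ, ∃ e : (Fin d → Fin (2 ^ k)) → ℝ, (∀ j, 0 ≤ e j) ∧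
        (∀ j, ∀ x ∈ closedCube d, ∃ ν : Fin d → Fin r,
          |g (dil k j x)| ≤ L * |g (dil k j (cubeNode d r ν))| + e j) ∧
        (∀ j, ∀ x ∈ closedCube d, ∀ y ∈ closedCube d, |g (dil k j x)| ≤ 2 ^ n *
          ∑ i ∈ Finset.Icc 1 n, |g (dil k j (x + ((i : ℝ) / (n * d)) • (y - x)))| + e j) ∧
        (p = ∞ → ∀ j, ENNReal.ofReal (e j) ≤ A * (ENNReal.ofReal (((1 / 2) ^ k) ^ s) * M)) ∧
        (p = ENNReal.ofReal P → ∑ j, ENNReal.ofReal (e j) ^ P ≤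
          ENNReal.ofReal ((2 ^ k) ^ d) * (A * (ENNReal.ofReal (((1 / 2) ^ k) ^ s) * M)) ^ P) := by
  obtain ⟨L, hL1, hL⟩ := exists_abs_le_cubeNode d hr
  obtain ⟨η, hη, hloc⟩ := exists_continuous_of_smallDiff hd hn
  refine ⟨L, hL1, fun δ R hδ hR => ?_⟩
  have hβ : (0 : ℝ) < (1 / 2) ^ (δ / 4) := by positivity
  have hβ1 : (1 / 2 : ℝ) ^ (δ / 4) < 1 :=
    Real.rpow_lt_one (by norm_num) (by norm_num) (by positivity)
  obtain ⟨C₃, hC₃, hloc⟩ := hloc _ hβ hβ1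
  obtain ⟨C₄, hC₄, hL⟩ := hL _ hβ hβ1
  obtain ⟨A, hA⟩ := exists_local_errors d n hη hδ hR
  set D : ℝ := (C₄ + 1) * C₃ with hD
  have hD0 : 0 ≤ D := by positivity
  refine ⟨D.toNNReal * A, fun p M P s f hf hP hPR hs hp hM hmod => ?_⟩
  have hG := hA p M P s f hf hP hPR hs hp hM hmod
  have hfj : ∀ (k : ℕ) (j : Fin d → Fin (2 ^ k)), Measurable fun y => f (dil k j y) := fun k j =>
    hf.comp (continuous_dil j).measurable
  obtain ⟨g₀, hg₀c, hg₀f⟩ : ∃ g : EuclideanSpace ℝ (Fin d) → ℝ, ContinuousOn g (closedCube d) ∧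
      g =ᵐ[cubeMeasure d] f := by
    obtain ⟨e, he0, hes, -⟩ := hG 0
    obtain ⟨g, hgc, hgf, -⟩ := hloc _ (hfj 0 fun _ => 0) _ (he0 _) (hes fun _ => 0)
    refine ⟨g, hgc, ?_⟩
    simpa only [dil_zero] using hgf
  classical
  -- Extension by zero makes the representative measurable on the whole space.
  set g : EuclideanSpace ℝ (Fin d) → ℝ := (closedCube d).piecewise g₀ 0 with hg
  have hgeq : EqOn g g₀ (closedCube d) := piecewise_eqOn _ _ _
  have hgm : Measurable g := hg₀c.measurable_piecewise continuousOn_const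
    (isClosed_closedCube d).measurableSet
  have hgc : ContinuousOn g (closedCube d) := hg₀c.congr hgeq
  have hgf : g =ᵐ[cubeMeasure d] f := by
    filter_upwards [hg₀f, ae_restrict_mem (measurableSet_openCube d)] with x hx hxo
    rw [hgeq (openCube_subset_closedCube d hxo), hx]
  refine ⟨g, hgm, hgc, hgf, fun k => ?_⟩
  obtain ⟨e, he0, hes, het, hep⟩ := hG k
  have hgj : ∀ j : Fin d → Fin (2 ^ k), ∃ G : EuclideanSpace ℝ (Fin d) → ℝ,
      EqOn G (fun x => g (dil k j x)) (closedCube d) ∧ ContinuousOn G (closedCube d) ∧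
      ∀ (l : ℕ) (x h : EuclideanSpace ℝ (Fin d)), x ∈ closedCube d →
          x + (n : ℝ) • h ∈ closedCube d → ‖h‖ ≤ (1 / 2) ^ l →
          |difference n h G x| ≤ C₃ * e j * ((1 / 2) ^ (δ / 4)) ^ l := by
    intro j
    obtain ⟨G, hGc, hGf, hGd⟩ := hloc _ (hfj k j) _ (he0 j) (hes j)
    -- The representative built on the cell and the rescaled global g are continuous and agree a.e.,
    -- hence everywhere, so the bounds on each cell hold for one and the same g.
    refine ⟨G, eqOn_closedCube_of_ae_eq hGc ?_ (hGf.trans (comp_dil_ae_eq hgf j).symm), hGc, hGd⟩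
    exact hgc.comp (continuous_dil j).continuousOn fun x hx => dil_mem_closedCube j hx
  have hDe : ∀ j, C₄ * (C₃ * e j) ≤ D * e j ∧ C₃ * e j ≤ D * e j := fun j => by
    have h1 : 0 ≤ C₃ * e j := mul_nonneg hC₃ (he0 j)
    have h2 : 0 ≤ C₄ * (C₃ * e j) := mul_nonneg hC₄ h1
    rw [hD]
    constructor <;> nlinarith
  refine ⟨fun j => D * e j, fun j => mul_nonneg hD0 (he0 j), fun j x hx => ?_,
    fun j x hx y hy => ?_, fun hpt j => ?_, fun hpP => ?_⟩
  · obtain ⟨G, hGg, hGc, hGd⟩ := hgj j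
    obtain ⟨ν, hν⟩ := hL n hnr G (C₃ * e j) (mul_nonneg hC₃ (he0 j)) hGc hGd x hx
    refine ⟨ν, ?_⟩
    rw [hGg hx, hGg (cubeNode_mem hr ν)] at hν
    exact hν.trans (add_le_add le_rfl (hDe j).1)
  · obtain ⟨G, hGg, hGc, hGd⟩ := hgj j
    have h1 := abs_le_sum_segment hd hn (g := G) (K := C₃ * e j) (fun x h hx hxh hh => by
      simpa using hGd 0 x h hx hxh (by simpa using hh)) hx hy
    rw [hGg hx] at h1
    refine h1.trans (add_le_add (le_of_eq ?_) (hDe j).2)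
    congr 1
    refine Finset.sum_congr rfl fun i hi => ?_
    rw [Finset.mem_Icc] at hi
    have hn0 : (1 : ℝ) ≤ n := by exact_mod_cast hn
    have hd0 : (1 : ℝ) ≤ d := by exact_mod_cast hd
    have hin : (i : ℝ) ≤ n := by exact_mod_cast hi.2
    have ht1 : (i : ℝ) / (n * d) ≤ 1 := by
      rw [div_le_one (by positivity)]; nlinarith
    have hmem : x + ((i : ℝ) / (n * d)) • (y - x) ∈ closedCube d := by
      have := convex_closedCube d hx hy (a := 1 - (i : ℝ) / (n * d)) (b := (i : ℝ) / (n * d))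
        (by linarith) (by positivity) (by ring)
      convert this using 1
      module
    rw [hGg hmem]
  · rw [ENNReal.ofReal_mul hD0, ENNReal.coe_mul, mul_assoc]
    exact mul_le_mul' le_rfl (het hpt j)
  · have hc : ENNReal.ofReal D = (D.toNNReal : ℝ≥0∞) := rfl
    calc ∑ j, ENNReal.ofReal (D * e j) ^ P
        = ENNReal.ofReal D ^ P * ∑ j, ENNReal.ofReal (e j) ^ P := by
          rw [Finset.mul_sum]
          refine Finset.sum_congr rfl fun j _ => ?_
          rw [ENNReal.ofReal_mul hD0, ENNReal.mul_rpow_of_nonneg _ _ hP.le]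
      _ ≤ ENNReal.ofReal D ^ P * _ := mul_le_mul' le_rfl (hep hpP)
      _ = _ := by
          rw [mul_left_comm, ← ENNReal.mul_rpow_of_nonneg _ _ hP.le, ENNReal.coe_mul, mul_assoc, hc]

/-! ### Step functions on the dyadic cells -/

section Step

variable {d : ℕ} {k : ℕ} {E : Type*} [AddCommMonoid E]

open Classical in
/-- The function with constant value `a j` on the cell with index `j`. -/
noncomputable def dyadicStep (a : (Fin d → Fin (2 ^ k)) → E) (w : EuclideanSpace ℝ (Fin d)) : E :=
  ∑ j, (cell k j).indicator (fun _ => a j) w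

theorem dyadicStep_eq (a : (Fin d → Fin (2 ^ k)) → E) {j : Fin d → Fin (2 ^ k)}
    {w : EuclideanSpace ℝ (Fin d)} (hw : w ∈ cell k j) : dyadicStep a w = a j := by
  classical
  unfold dyadicStep
  rw [Finset.sum_eq_single j]
  · rw [indicator_of_mem hw]
  · intro i _ hij
    exact indicator_of_notMem (Set.disjoint_left.1 (pairwise_disjoint_cell hij.symm) hw) _
  · simp

theorem measurable_dyadicStep [MeasurableSpace E] [MeasurableAdd₂ E]
    (a : (Fin d → Fin (2 ^ k)) → E) : Measurable (dyadicStep a) := by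
  unfold dyadicStep
  exact Finset.measurable_sum _ fun j _ => measurable_const.indicator (measurableSet_cell j)

end Step

theorem ae_mem_halfOpenCube (d : ℕ) : ∀ᵐ w ∂(cubeMeasure d), w ∈ halfOpenCube d := by
  rw [cubeMeasure_eq_restrict_halfOpenCube]
  exact ae_restrict_mem (measurableSet_halfOpenCube d)

variable {d k : ℕ}

theorem cubeMeasure_cell (j : Fin d → Fin (2 ^ k)) :
    cubeMeasure d (cell k j) = (ENNReal.ofReal ((2 ^ k) ^ d))⁻¹ := by
  rw [cubeMeasure_eq_restrict_halfOpenCube, Measure.restrict_apply (measurableSet_cell j),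
    inter_eq_left.2 (cell_subset_halfOpenCube j)]
  exact ENNReal.eq_inv_of_mul_eq_one_left (by rw [mul_comm]; exact ofReal_two_pow_mul_volume_cell j)

theorem eLpNorm_dyadicStep {τ : ℝ≥0∞} (h0 : τ ≠ 0) (hτ : τ ≠ ∞) (a : (Fin d → Fin (2 ^ k)) → ℝ) :
    eLpNorm (dyadicStep a) τ (cubeMeasure d)
      = ((ENNReal.ofReal ((2 ^ k) ^ d))⁻¹ * ∑ j, ‖a j‖ₑ ^ τ.toReal) ^ (1 / τ.toReal) := by
  rw [eLpNorm_eq_lintegral_rpow_enorm_toReal h0 hτ]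
  congr 1
  have h1 : (fun w => ‖dyadicStep a w‖ₑ ^ τ.toReal)
      =ᵐ[cubeMeasure d] fun w => ∑ j, (cell k j).indicator (fun _ => ‖a j‖ₑ ^ τ.toReal) w := by
    filter_upwards [ae_mem_halfOpenCube d] with w hw
    obtain ⟨j, hj⟩ := exists_mem_cell (k := k) hw
    rw [dyadicStep_eq a hj]
    exact (dyadicStep_eq (fun j => ‖a j‖ₑ ^ τ.toReal) hj).symm
  rw [lintegral_congr_ae h1, lintegral_finsetSum _ fun j _ =>
    measurable_const.indicator (measurableSet_cell j), Finset.mul_sum]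
  refine Finset.sum_congr rfl fun j _ => ?_
  rw [lintegral_indicator_const (measurableSet_cell j), cubeMeasure_cell, mul_comm]

theorem eLpNorm_dyadicStep_top_le (a : (Fin d → Fin (2 ^ k)) → ℝ) {C : ℝ≥0∞}
    (h : ∀ j, ‖a j‖ₑ ≤ C) (τ : ℝ≥0∞) : eLpNorm (dyadicStep a) τ (cubeMeasure d) ≤ C := by
  have h1 : ∀ᵐ w ∂(cubeMeasure d), ‖dyadicStep a w‖ₑ ≤ C := by
    filter_upwards [ae_mem_halfOpenCube d] with w hw
    obtain ⟨j, hj⟩ := exists_mem_cell (k := k) hw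
    rw [dyadicStep_eq a hj]
    exact h j
  simpa using eLpNorm_le_of_ae_enorm_bound (p := τ) h1

theorem enorm_le_eLpNorm_dyadicStep_top (a : (Fin d → Fin (2 ^ k)) → ℝ) (j : Fin d → Fin (2 ^ k)) :
    ‖a j‖ₑ ≤ eLpNorm (dyadicStep a) ∞ (cubeMeasure d) := by
  rw [eLpNorm_exponent_top]
  by_contra! hlt
  have h0 : cubeMeasure d (cell k j) = 0 := by
    refine measure_mono_null (fun w hw => ?_)
      (ae_iff.1 (enorm_ae_le_eLpNormEssSup (dyadicStep a) (cubeMeasure d)))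
    rw [mem_ofPred_eq, dyadicStep_eq a hw]
    exact not_le.2 hlt
  rw [cubeMeasure_cell] at h0
  simp at h0

theorem rpow_sum_le_sum_rpow {ι : Type*} (s : Finset ι) (a : ι → ℝ≥0∞) {p : ℝ} (hp : 0 < p)
    (hp1 : p ≤ 1) : (∑ i ∈ s, a i) ^ p ≤ ∑ i ∈ s, a i ^ p :=
  Finset.le_sum_of_subadditive (fun x : ℝ≥0∞ => x ^ p) (by simp [hp])
    (fun x y => ENNReal.rpow_add_le_add_rpow x y hp.le hp1) s a

/-- The `L_τ` norm of a step function whose `ℓ_P` norm is controlled. -/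
theorem eLpNorm_dyadicStep_le {P : ℝ} (hP : 0 < P) {τ : ℝ≥0∞} (hτ : 1 ≤ τ) {Y : ℝ≥0∞}
    {e : (Fin d → Fin (2 ^ k)) → ℝ}
    (h : ∑ j, ‖e j‖ₑ ^ P ≤ ENNReal.ofReal ((2 ^ k) ^ d) * Y ^ P) :
    eLpNorm (dyadicStep e) τ (cubeMeasure d)
      ≤ ENNReal.ofReal (((2 ^ k) ^ d) ^ max (1 / P - (τ⁻¹).toReal) 0) * Y := by
  set N : ℝ := (2 ^ k) ^ d with hN
  have hN0 : 0 < N := by positivity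
  have hN1 : 1 ≤ N := one_le_pow₀ (one_le_pow₀ (by norm_num))
  have hNne : ENNReal.ofReal N ≠ 0 := (ENNReal.ofReal_pos.2 hN0).ne'
  have hroot : (ENNReal.ofReal N * Y ^ P) ^ (1 / P) = ENNReal.ofReal (N ^ (1 / P)) * Y := by
    rw [ENNReal.mul_rpow_of_nonneg _ _ (by positivity), ← ENNReal.rpow_mul,
      mul_one_div_cancel hP.ne', ENNReal.rpow_one, ENNReal.ofReal_rpow_of_pos hN0]
  -- For τ ≤ P monotonicity of norms on a probability space loses nothing. For τ > P the inclusion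
  -- of ℓ_P in ℓ_τ is applied to unnormalized sums, and renormalizing over N cells costs N^{1/P -
  -- 1/τ}.
  rcases le_or_gt τ (ENNReal.ofReal P) with hle | hlt
  · calc eLpNorm (dyadicStep e) τ (cubeMeasure d)
        ≤ eLpNorm (dyadicStep e) (ENNReal.ofReal P) (cubeMeasure d) :=
          eLpNorm_le_eLpNorm_of_exponent_le hle (measurable_dyadicStep e).aestronglyMeasurable
      _ ≤ Y := by
          rw [eLpNorm_dyadicStep (ENNReal.ofReal_pos.2 hP).ne' ENNReal.ofReal_ne_top,
            ENNReal.toReal_ofReal hP.le]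
          calc _ ≤ ((ENNReal.ofReal N)⁻¹ * (ENNReal.ofReal N * Y ^ P)) ^ (1 / P) :=
                ENNReal.rpow_le_rpow (mul_le_mul' le_rfl h) (by positivity)
            _ = Y := by
                rw [← mul_assoc, ENNReal.inv_mul_cancel hNne ENNReal.ofReal_ne_top, one_mul,
                  ← ENNReal.rpow_mul, mul_one_div_cancel hP.ne', ENNReal.rpow_one]
      _ ≤ _ := by
          refine le_mul_of_one_le_left' ?_
          rw [ENNReal.one_le_ofReal]
          exact Real.one_le_rpow hN1 (le_max_right _ _)
  · by_cases htop : τ = ∞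
    · subst htop
      refine (eLpNorm_dyadicStep_top_le e (C := ENNReal.ofReal (N ^ (1 / P)) * Y) (fun j => ?_)
        ∞).trans (mul_le_mul' (ENNReal.ofReal_le_ofReal (Real.rpow_le_rpow_of_exponent_le hN1
          (by simp))) le_rfl)
      rw [← hroot]
      calc ‖e j‖ₑ = (‖e j‖ₑ ^ P) ^ (1 / P) := by
            rw [← ENNReal.rpow_mul, mul_one_div_cancel hP.ne', ENNReal.rpow_one]
        _ ≤ _ := ENNReal.rpow_le_rpow (le_trans (Finset.single_le_sum
            (f := fun j => ‖e j‖ₑ ^ P) (fun _ _ => zero_le) (Finset.mem_univ j)) h) (by positivity)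
    · set t := τ.toReal with ht
      have ht0 : 0 < t := ENNReal.toReal_pos (zero_lt_one.trans_le hτ).ne' htop
      have hPt : P ≤ t := ((ENNReal.ofReal_lt_iff_lt_toReal hP.le htop).1 hlt).le
      rw [eLpNorm_dyadicStep (zero_lt_one.trans_le hτ).ne' htop, ENNReal.toReal_inv, ← ht]
      have h1 : (∑ j, ‖e j‖ₑ ^ t) ^ (P / t) ≤ ENNReal.ofReal N * Y ^ P := by
        refine (rpow_sum_le_sum_rpow _ _ (by positivity) ((div_le_one ht0).2 hPt)).trans
          (le_trans (le_of_eq (Finset.sum_congr rfl fun j _ => ?_)) h)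
        rw [← ENNReal.rpow_mul, mul_div_cancel₀ _ ht0.ne']
      have h2 : (∑ j, ‖e j‖ₑ ^ t) ^ (1 / t) ≤ ENNReal.ofReal (N ^ (1 / P)) * Y := by
        rw [← hroot]
        refine le_trans (le_of_eq ?_) (ENNReal.rpow_le_rpow h1 (by positivity))
        rw [← ENNReal.rpow_mul]
        congr 1
        field_simp
      calc ((ENNReal.ofReal N)⁻¹ * ∑ j, ‖e j‖ₑ ^ t) ^ (1 / t)
          = (ENNReal.ofReal N)⁻¹ ^ (1 / t) * (∑ j, ‖e j‖ₑ ^ t) ^ (1 / t) :=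
            ENNReal.mul_rpow_of_nonneg _ _ (by positivity)
        _ ≤ (ENNReal.ofReal N)⁻¹ ^ (1 / t) * (ENNReal.ofReal (N ^ (1 / P)) * Y) :=
            mul_le_mul' le_rfl h2
        _ = ENNReal.ofReal (N ^ (1 / P - t⁻¹)) * Y := by
            rw [← ENNReal.ofReal_inv_of_pos hN0, ENNReal.ofReal_rpow_of_pos (by positivity),
              ← mul_assoc, ← ENNReal.ofReal_mul (by positivity), Real.inv_rpow hN0.le,
              ← Real.rpow_neg hN0.le, ← Real.rpow_add hN0]
            congr 3; ring
        _ ≤ _ := mul_le_mul' (ENNReal.ofReal_le_ofReal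
            (Real.rpow_le_rpow_of_exponent_le hN1 (le_max_left _ _))) le_rfl

/-! ### The grid -/

theorem dil_cubeNode_mem_grid {r : ℕ} (hr : 2 ≤ r) (j : Fin d → Fin (2 ^ k)) (ν : Fin d → Fin r) :
    dil k j (cubeNode d r ν) ∈ grid d r k := by
  classical
  have hlt : ∀ i, (r - 1) * (j i : ℕ) + (ν i : ℕ) < (r - 1) * 2 ^ k + 1 := fun i => by
    have h1 : (j i : ℕ) + 1 ≤ 2 ^ k := (j i).2
    have h2 := Nat.mul_le_mul_left (r - 1) h1
    have h3 := (ν i).2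
    rw [mul_add] at h2
    omega
  have hr1 : (0 : ℝ) < (r : ℝ) - 1 := by
    have : (2 : ℝ) ≤ r := by exact_mod_cast hr
    linarith
  unfold grid
  rw [Finset.mem_image]
  refine ⟨fun i => ⟨_, hlt i⟩, Finset.mem_univ _, ?_⟩
  ext i
  rw [dil_apply]
  simp only [cubeNode, node]
  rw [Nat.cast_add, Nat.cast_mul, Nat.cast_sub (by omega), Nat.cast_one, one_div, inv_pow]
  field_simp
  ring

theorem exists_eq_dil_cubeNode {r : ℕ} (hr : 2 ≤ r) {x : EuclideanSpace ℝ (Fin d)}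
    (hx : x ∈ grid d r k) : ∃ (j : Fin d → Fin (2 ^ k)) (ν : Fin d → Fin r),
      x = dil k j (cubeNode d r ν) := by
  classical
  unfold grid at hx
  rw [Finset.mem_image] at hx
  obtain ⟨J, -, rfl⟩ := hx
  have hr1 : (0 : ℝ) < (r : ℝ) - 1 := by
    have : (2 : ℝ) ≤ r := by exact_mod_cast hr
    linarith
  have hex : ∀ i, ∃ (a : Fin (2 ^ k)) (b : Fin r), (J i : ℕ) = (r - 1) * (a : ℕ) + b := by
    intro i
    have h2 : 0 < 2 ^ k := by positivity
    rcases Nat.lt_or_ge (J i : ℕ) ((r - 1) * 2 ^ k) with hlt | hge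
    · refine ⟨⟨(J i : ℕ) / (r - 1), Nat.div_lt_of_lt_mul hlt⟩, ⟨(J i : ℕ) % (r - 1), ?_⟩, ?_⟩
      · have := Nat.mod_lt (J i : ℕ) (show 0 < r - 1 by omega)
        omega
      · exact (Nat.div_add_mod _ _).symm
    -- The last grid index would fall into cell 2^k, which does not exist; it is the last node of
    -- cell 2^k - 1.
    · refine ⟨⟨2 ^ k - 1, by omega⟩, ⟨r - 1, by omega⟩, ?_⟩
      have := (J i).2
      have h3 : (r - 1) * (2 ^ k - 1) + (r - 1) = (r - 1) * 2 ^ k := by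
        rw [← Nat.mul_succ]; congr 1; omega
      simp only
      omega
  choose a b hab using hex
  refine ⟨a, b, ?_⟩
  ext i
  rw [dil_apply]
  simp only [cubeNode, node]
  rw [hab i, Nat.cast_add, Nat.cast_mul, Nat.cast_sub (by omega), Nat.cast_one, one_div, inv_pow]
  field_simp
  ring

theorem dil_injective_index (x : EuclideanSpace ℝ (Fin d)) :
    Function.Injective fun j : Fin d → Fin (2 ^ k) => dil k j x := by
  intro j j' h
  funext i
  have h1 := congrArg (fun y : EuclideanSpace ℝ (Fin d) => y i) h
  simp only [dil_apply] at h1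
  have h2 := mul_left_cancel₀ (by positivity) h1
  have h3 : ((j i : ℕ) : ℝ) = (j' i : ℕ) := by linarith
  exact Fin.ext (by exact_mod_cast h3)

theorem two_pow_le_card_grid {r : ℕ} (hr : 2 ≤ r) : (2 ^ k) ^ d ≤ (grid d r k).card := by
  classical
  have h := Finset.card_le_card_of_injOn (s := (Finset.univ : Finset (Fin d → Fin (2 ^ k))))
    (t := grid d r k) (fun j => dil k j (cubeNode d r fun _ => ⟨0, by omega⟩))
    (fun j _ => dil_cubeNode_mem_grid hr j _) (dil_injective_index _).injOn
  simpa using h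

theorem card_grid_le {r : ℕ} (hr : 2 ≤ r) : (grid d r k).card ≤ r ^ d * (2 ^ k) ^ d := by
  classical
  unfold grid
  refine Finset.card_image_le.trans ?_
  rw [Finset.card_univ, Fintype.card_fun, Fintype.card_fin, Fintype.card_fin, ← mul_pow]
  refine Nat.pow_le_pow_left ?_ d
  have h2 : 0 < 2 ^ k := by positivity
  obtain ⟨m, rfl⟩ := Nat.exists_eq_add_of_le' hr
  simp only [show m + 2 - 1 = m + 1 by omega]
  nlinarith

theorem card_grid_pos {r : ℕ} (hr : 2 ≤ r) : 0 < (grid d r k).card :=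
  lt_of_lt_of_le (by positivity) (two_pow_le_card_grid hr)

/-- The values at one node of each cell are controlled by the discrete norm. -/
theorem eLpNorm_dyadicStep_node_le {r : ℕ} (hr : 2 ≤ r) (g : EuclideanSpace ℝ (Fin d) → ℝ)
    (ν : Fin d → Fin r) {τ : ℝ≥0∞} (hτ : 1 ≤ τ) :
    eLpNorm (dyadicStep fun j : Fin d → Fin (2 ^ k) => g (dil k j (cubeNode d r ν))) τ
      (cubeMeasure d) ≤ (r : ℝ≥0∞) ^ d * discreteNorm r k τ g := by
  classical
  have hr1 : (1 : ℝ≥0∞) ≤ (r : ℝ≥0∞) ^ d := one_le_pow₀ (by exact_mod_cast (by omega : 1 ≤ r))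
  unfold discreteNorm
  split_ifs with htop
  · refine (eLpNorm_dyadicStep_top_le _ (fun j => ?_) τ).trans (le_mul_of_one_le_left' hr1)
    exact Finset.le_sup (f := fun x => ‖g x‖ₑ) (dil_cubeNode_mem_grid hr j ν)
  · have h0 : τ ≠ 0 := (zero_lt_one.trans_le hτ).ne'
    set t := τ.toReal with ht
    have ht1 : 1 ≤ t := by
      have := ENNReal.toReal_mono htop hτ
      simpa using this
    rw [eLpNorm_dyadicStep h0 htop, ← ht]
    have hsum : ∑ j : Fin d → Fin (2 ^ k), ‖g (dil k j (cubeNode d r ν))‖ₑ ^ t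
        ≤ ∑ x ∈ grid d r k, ‖g x‖ₑ ^ t := by
      rw [← Finset.sum_image (g := fun j : Fin d → Fin (2 ^ k) => dil k j (cubeNode d r ν))
        (f := fun x => ‖g x‖ₑ ^ t) (dil_injective_index _).injOn]
      refine Finset.sum_le_sum_of_subset fun x hx => ?_
      obtain ⟨j, -, rfl⟩ := Finset.mem_image.1 hx
      exact dil_cubeNode_mem_grid hr j ν
    have hcard : (ENNReal.ofReal ((2 ^ k) ^ d))⁻¹
        ≤ (r : ℝ≥0∞) ^ d * ((grid d r k).card : ℝ≥0∞)⁻¹ := by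
      have hm : ((grid d r k).card : ℝ≥0∞) ≠ 0 := by exact_mod_cast (card_grid_pos hr).ne'
      rw [← div_eq_mul_inv, ENNReal.le_div_iff_mul_le (Or.inl hm) (Or.inl (by simp)), mul_comm,
        ← div_eq_mul_inv]
      refine ENNReal.div_le_of_le_mul ?_
      have h := card_grid_le (d := d) (k := k) hr
      rw [ENNReal.ofReal_pow (by positivity), ENNReal.ofReal_pow (by positivity)]
      simp only [ENNReal.ofReal_ofNat]
      exact_mod_cast h
    calc _ ≤ ((r : ℝ≥0∞) ^ d * (((grid d r k).card : ℝ≥0∞)⁻¹ *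
            ∑ x ∈ grid d r k, ‖g x‖ₑ ^ t)) ^ (1 / t) := by
          rw [← mul_assoc]
          exact ENNReal.rpow_le_rpow (mul_le_mul' hcard hsum) (by positivity)
      _ = ((r : ℝ≥0∞) ^ d) ^ (1 / t) * (((grid d r k).card : ℝ≥0∞)⁻¹ *
            ∑ x ∈ grid d r k, ‖g x‖ₑ ^ t) ^ (1 / t) :=
          ENNReal.mul_rpow_of_nonneg _ _ (by positivity)
      _ ≤ _ := by
          refine mul_le_mul' ?_ le_rfl
          calc ((r : ℝ≥0∞) ^ d) ^ (1 / t) ≤ ((r : ℝ≥0∞) ^ d) ^ (1 : ℝ) :=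
                ENNReal.rpow_le_rpow_of_exponent_le hr1 ((div_le_one (by linarith)).2 ht1)
            _ = _ := ENNReal.rpow_one _

/-- The discrete norm is controlled by the values at the nodes of the cells. -/
theorem discreteNorm_le_sum {r : ℕ} (hr : 2 ≤ r) (g : EuclideanSpace ℝ (Fin d) → ℝ)
    {τ : ℝ≥0∞} (hτ : 1 ≤ τ) :
    discreteNorm r k τ g ≤ ∑ ν : Fin d → Fin r, eLpNorm
      (dyadicStep fun j : Fin d → Fin (2 ^ k) => g (dil k j (cubeNode d r ν))) τ (cubeMeasure d) := by
  classical
  unfold discreteNorm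
  split_ifs with htop
  · subst htop
    refine Finset.sup_le fun x hx => ?_
    obtain ⟨j, ν, rfl⟩ := exists_eq_dil_cubeNode hr hx
    exact (enorm_le_eLpNorm_dyadicStep_top
      (fun j : Fin d → Fin (2 ^ k) => g (dil k j (cubeNode d r ν))) j).trans
      (Finset.single_le_sum (f := fun ν : Fin d → Fin r => eLpNorm (dyadicStep
        fun j : Fin d → Fin (2 ^ k) => g (dil k j (cubeNode d r ν))) ∞ (cubeMeasure d))
        (fun _ _ => zero_le) (Finset.mem_univ ν))
  · have h0 : τ ≠ 0 := (zero_lt_one.trans_le hτ).ne'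
    set t := τ.toReal with ht
    have ht1 : 1 ≤ t := by
      have := ENNReal.toReal_mono htop hτ
      simpa using this
    simp only [eLpNorm_dyadicStep h0 htop, ← ht]
    -- As 1 / t ≤ 1 the root is subadditive, so the sum over ν may be pulled out.
    refine le_trans (ENNReal.rpow_le_rpow ?_ (by positivity))
      (rpow_sum_le_sum_rpow _ _ (by positivity) ((div_le_one (by linarith)).2 ht1))
    rw [← Finset.mul_sum]
    refine mul_le_mul' (ENNReal.inv_le_inv.2 ?_) ?_
    · have h := two_pow_le_card_grid (d := d) (k := k) hr
      rw [ENNReal.ofReal_pow (by positivity), ENNReal.ofReal_pow (by positivity)]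
      simp only [ENNReal.ofReal_ofNat]
      exact_mod_cast h
    · rw [← Finset.sum_product' (f := fun (ν : Fin d → Fin r) (j : Fin d → Fin (2 ^ k)) =>
        ‖g (dil k j (cubeNode d r ν))‖ₑ ^ t)]
      calc ∑ x ∈ grid d r k, ‖g x‖ₑ ^ t
          ≤ ∑ x ∈ (Finset.univ ×ˢ Finset.univ).image
            fun z : (Fin d → Fin r) × (Fin d → Fin (2 ^ k)) => dil k z.2 (cubeNode d r z.1),
              ‖g x‖ₑ ^ t := by
            refine Finset.sum_le_sum_of_subset fun x hx => ?_
            obtain ⟨j, ν, rfl⟩ := exists_eq_dil_cubeNode hr hx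
            exact Finset.mem_image.2 ⟨(ν, j), by simp, rfl⟩
        _ ≤ _ := Finset.sum_image_le_of_nonneg (fun _ _ => zero_le)

/-! ### Contracting all cells towards a point -/

/-- On each cell, the contraction with ratio `θ` towards the point `c j`. -/
noncomputable def cellContraction (θ : ℝ) (c : (Fin d → Fin (2 ^ k)) → EuclideanSpace ℝ (Fin d))
    (w : EuclideanSpace ℝ (Fin d)) : EuclideanSpace ℝ (Fin d) :=
  θ • w + (1 - θ) • dyadicStep c w

theorem measurable_cellContraction (θ : ℝ)
    (c : (Fin d → Fin (2 ^ k)) → EuclideanSpace ℝ (Fin d)) : Measurable (cellContraction θ c) := by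
  have := measurable_dyadicStep c
  unfold cellContraction
  fun_prop

/-- Each cell is contracted into itself, by convexity, with Jacobian θ^d. Since the cells are
disjoint, the images do not accumulate. -/
theorem map_cellContraction_le {θ : ℝ} (hθ : 0 < θ) (hθ1 : θ ≤ 1)
    {c : (Fin d → Fin (2 ^ k)) → EuclideanSpace ℝ (Fin d)}
    (hc : ∀ j i, 2 ^ k * c j i - ((j i : ℕ) : ℝ) ∈ Icc (0 : ℝ) 1) :
    (cubeMeasure d).map (cellContraction θ c) ≤ ENNReal.ofReal ((θ⁻¹) ^ d) • cubeMeasure d := by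
  refine Measure.le_iff.2 fun S hS => ?_
  rw [Measure.map_apply (measurable_cellContraction θ c) hS, Measure.smul_apply, smul_eq_mul,
    cubeMeasure_eq_restrict_halfOpenCube, Measure.restrict_apply hS,
    Measure.restrict_apply (measurable_cellContraction θ c hS)]
  have hcell : ∀ j : Fin d → Fin (2 ^ k), cellContraction θ c ⁻¹' S ∩ cell k j
      ⊆ {x | θ • x + (1 - θ) • c j ∈ S ∩ cell k j} := by
    rintro j w ⟨hwS, hwj⟩
    have e : cellContraction θ c w = θ • w + (1 - θ) • c j := by
      rw [cellContraction, dyadicStep_eq c hwj]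
    refine ⟨by rw [← e]; exact hwS, fun i => ?_⟩
    have h1 := hwj i
    have h2 := hc j i
    have e2 : 2 ^ k * (θ • w + (1 - θ) • c j) i - ((j i : ℕ) : ℝ)
        = θ * (2 ^ k * w i - ((j i : ℕ) : ℝ)) + (1 - θ) * (2 ^ k * c j i - ((j i : ℕ) : ℝ)) := by
      simp only [PiLp.add_apply, PiLp.smul_apply, smul_eq_mul]
      ring
    rw [e2]
    constructor <;> nlinarith [h1.1, h1.2, h2.1, h2.2]
  calc volume (cellContraction θ c ⁻¹' S ∩ halfOpenCube d)
      ≤ volume (⋃ j ∈ (Finset.univ : Finset (Fin d → Fin (2 ^ k))),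
          (cellContraction θ c ⁻¹' S ∩ cell k j)) := by
        refine measure_mono fun w hw => ?_
        obtain ⟨j, hj⟩ := exists_mem_cell (k := k) hw.2
        simp only [mem_iUnion]
        exact ⟨j, Finset.mem_univ _, hw.1, hj⟩
    _ ≤ ∑ j : Fin d → Fin (2 ^ k), volume (cellContraction θ c ⁻¹' S ∩ cell k j) :=
        measure_biUnion_finset_le _ _
    _ ≤ ∑ j : Fin d → Fin (2 ^ k), ENNReal.ofReal ((θ⁻¹) ^ d) * volume (S ∩ cell k j) :=
        Finset.sum_le_sum fun j _ => (measure_mono (hcell j)).trans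
          (volume_preimage_smul_add hθ _ _).le
    _ = ENNReal.ofReal ((θ⁻¹) ^ d) * ∑ j : Fin d → Fin (2 ^ k), volume (S ∩ cell k j) :=
        (Finset.mul_sum _ _ _).symm
    _ ≤ _ := by
        refine mul_le_mul' le_rfl ?_
        rw [← measure_biUnion_finset
          (fun i _ j _ hij => (pairwise_disjoint_cell hij).mono inter_subset_right inter_subset_right)
          (fun j _ => hS.inter (measurableSet_cell j))]
        refine measure_mono (iUnion₂_subset fun j _ => ?_)
        exact inter_subset_inter_right _ (cell_subset_halfOpenCube j)

theorem eLpNorm_comp_cellContraction_le {θ : ℝ} (hθ : 0 < θ) (hθ1 : θ ≤ 1)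
    {c : (Fin d → Fin (2 ^ k)) → EuclideanSpace ℝ (Fin d)}
    (hc : ∀ j i, 2 ^ k * c j i - ((j i : ℕ) : ℝ) ∈ Icc (0 : ℝ) 1)
    {g : EuclideanSpace ℝ (Fin d) → ℝ} (hg : Measurable g) {τ : ℝ≥0∞} (hτ : 1 ≤ τ) :
    eLpNorm (g ∘ cellContraction θ c) τ (cubeMeasure d)
      ≤ ENNReal.ofReal ((θ⁻¹) ^ d) * eLpNorm g τ (cubeMeasure d) := by
  have h1 : 1 ≤ (θ⁻¹) ^ d := one_le_pow₀ ((one_le_inv₀ hθ).2 hθ1)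
  have h2 : (1 : ℝ≥0∞) ≤ ENNReal.ofReal ((θ⁻¹) ^ d) := ENNReal.one_le_ofReal.2 h1
  have h3 : (1 / τ).toReal ≤ 1 := by
    refine ENNReal.toReal_le_of_le_ofReal zero_le_one ?_
    rw [ENNReal.ofReal_one, one_div]
    exact ENNReal.inv_le_one.2 hτ
  rw [← eLpNorm_map_measure hg.aestronglyMeasurable (measurable_cellContraction θ c).aemeasurable]
  refine (eLpNorm_mono_measure g (map_cellContraction_le hθ hθ1 hc)).trans ?_
  rw [eLpNorm_smul_measure_of_ne_zero (zero_lt_one.trans_le h2).ne', smul_eq_mul]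
  refine mul_le_mul' ?_ le_rfl
  exact (ENNReal.rpow_le_rpow_of_exponent_le h2 h3).trans (ENNReal.rpow_one _).le

/-! ### Comparison of the continuous and the discrete norm -/

theorem exists_eq_dil_of_mem_halfOpenCube {w : EuclideanSpace ℝ (Fin d)} (hw : w ∈ halfOpenCube d) :
    ∃ (j : Fin d → Fin (2 ^ k)) (y : EuclideanSpace ℝ (Fin d)), y ∈ closedCube d ∧
      w ∈ cell k j ∧ w = dil k j y := by
  obtain ⟨j, hj⟩ := exists_mem_cell (k := k) hw
  refine ⟨j, WithLp.toLp 2 fun i => 2 ^ k * w i - ((j i : ℕ) : ℝ), fun i => ?_, hj, ?_⟩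
  · exact Ico_subset_Icc_self (hj i)
  · ext i
    have h4 := two_pow_mul_half_pow k
    rw [dil_apply]
    simp only [sub_add_cancel]
    linear_combination (-(w i)) * h4

/-- The node ν depends on the point, so the pointwise bound is summed over all r^d nodes; each node
contributes r^d times the discrete norm. -/
theorem eLpNorm_le_discreteNorm {r : ℕ} (hr : 2 ≤ r) {L : ℝ} (hL : 0 ≤ L)
    {g : EuclideanSpace ℝ (Fin d) → ℝ} {e : (Fin d → Fin (2 ^ k)) → ℝ}
    (h : ∀ j, ∀ x ∈ closedCube d, ∃ ν : Fin d → Fin r,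
      |g (dil k j x)| ≤ L * |g (dil k j (cubeNode d r ν))| + e j) {τ : ℝ≥0∞} (hτ : 1 ≤ τ) :
    eLpNorm g τ (cubeMeasure d) ≤ ENNReal.ofReal L * ((r : ℝ≥0∞) ^ d * ((r : ℝ≥0∞) ^ d *
      discreteNorm r k τ g)) + eLpNorm (dyadicStep e) τ (cubeMeasure d) := by
  classical
  set G : (Fin d → Fin r) → (Fin d → Fin (2 ^ k)) → ℝ := fun ν j => |g (dil k j (cubeNode d r ν))|
    with hG
  have hm : ∀ ν, AEStronglyMeasurable (dyadicStep (G ν)) (cubeMeasure d) := fun ν =>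
    (measurable_dyadicStep _).aestronglyMeasurable
  have h1 : eLpNorm g τ (cubeMeasure d) ≤
      eLpNorm (L • (∑ ν, dyadicStep (G ν)) + dyadicStep e) τ (cubeMeasure d) := by
    refine eLpNorm_mono_ae ?_
    filter_upwards [ae_mem_halfOpenCube d] with w hw
    obtain ⟨j, y, hy, hwj, rfl⟩ := exists_eq_dil_of_mem_halfOpenCube (k := k) hw
    obtain ⟨ν, hν⟩ := h j y hy
    rw [Real.norm_eq_abs]
    refine hν.trans (le_trans ?_ (le_abs_self _))
    simp only [Pi.add_apply, Pi.smul_apply, Finset.sum_apply, smul_eq_mul, dyadicStep_eq _ hwj]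
    refine add_le_add (mul_le_mul_of_nonneg_left ?_ hL) le_rfl
    exact Finset.single_le_sum (f := fun ν => G ν j) (fun _ _ => abs_nonneg _) (Finset.mem_univ ν)
  refine h1.trans ((eLpNorm_add_le ((Finset.aestronglyMeasurable_sum _ fun ν _ => hm ν).const_smul L)
    (measurable_dyadicStep e).aestronglyMeasurable hτ).trans (add_le_add ?_ le_rfl))
  rw [eLpNorm_const_smul, Real.enorm_of_nonneg hL]
  refine mul_le_mul' le_rfl ((eLpNorm_sum_le (fun ν _ => hm ν) hτ).trans ?_)
  have hν : ∀ ν : Fin d → Fin r, eLpNorm (dyadicStep (G ν)) τ (cubeMeasure d)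
      ≤ (r : ℝ≥0∞) ^ d * discreteNorm r k τ g := fun ν => by
    refine le_trans (eLpNorm_mono_ae ?_) (eLpNorm_dyadicStep_node_le hr g ν hτ)
    filter_upwards [ae_mem_halfOpenCube d] with w hw
    obtain ⟨j, hj⟩ := exists_mem_cell (k := k) hw
    rw [dyadicStep_eq _ hj, dyadicStep_eq _ hj]
    simp [hG]
  refine (Finset.sum_le_sum fun ν _ => hν ν).trans (le_of_eq ?_)
  simp

/-- A nodal value is bounded through points on the segment to an arbitrary w in the cell. Taking the
L_τ norm in w makes these points contractions of w with ratio i / (nd), which cost at most (nd)^d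
each. -/
theorem discreteNorm_le_eLpNorm {r n : ℕ} (hd : 1 ≤ d) (hr : 2 ≤ r)
    {g : EuclideanSpace ℝ (Fin d) → ℝ} (hg : Measurable g)
    {e : (Fin d → Fin (2 ^ k)) → ℝ}
    (h : ∀ j, ∀ x ∈ closedCube d, ∀ y ∈ closedCube d, |g (dil k j x)| ≤ 2 ^ n *
      ∑ i ∈ Finset.Icc 1 n, |g (dil k j (x + ((i : ℝ) / (n * d)) • (y - x)))| + e j)
    {τ : ℝ≥0∞} (hτ : 1 ≤ τ) :
    discreteNorm r k τ g ≤ (r : ℝ≥0∞) ^ d * ((2 ^ n * (n * ENNReal.ofReal (((n : ℝ) * d) ^ d))) *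
      eLpNorm g τ (cubeMeasure d) + eLpNorm (dyadicStep e) τ (cubeMeasure d)) := by
  classical
  refine (discreteNorm_le_sum hr g hτ).trans ?_
  have hd0 : (1 : ℝ) ≤ d := by exact_mod_cast hd
  have key : ∀ ν : Fin d → Fin r, eLpNorm
      (dyadicStep fun j : Fin d → Fin (2 ^ k) => g (dil k j (cubeNode d r ν))) τ (cubeMeasure d)
      ≤ (2 ^ n * (n * ENNReal.ofReal (((n : ℝ) * d) ^ d))) * eLpNorm g τ (cubeMeasure d)
        + eLpNorm (dyadicStep e) τ (cubeMeasure d) := by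
    intro ν
    set c : (Fin d → Fin (2 ^ k)) → EuclideanSpace ℝ (Fin d) := fun j => dil k j (cubeNode d r ν)
      with hc
    have hcQ : ∀ j i, 2 ^ k * c j i - ((j i : ℕ) : ℝ) ∈ Icc (0 : ℝ) 1 := fun j i => by
      have := cubeNode_mem (d := d) hr ν i
      rw [hc]
      simp only
      rw [dil_apply, ← mul_assoc, two_pow_mul_half_pow, one_mul, add_sub_cancel_right]
      exact this
    set F : ℕ → EuclideanSpace ℝ (Fin d) → ℝ := fun i w =>
      |(g ∘ cellContraction ((i : ℝ) / (n * d)) c) w| with hF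
    have hFm : ∀ i, AEStronglyMeasurable (F i) (cubeMeasure d) := fun i => by
      have := hg.comp (measurable_cellContraction ((i : ℝ) / (n * d)) c)
      exact this.abs.aestronglyMeasurable
    have h1 : eLpNorm (dyadicStep fun j => g (c j)) τ (cubeMeasure d) ≤
        eLpNorm ((2 ^ n : ℝ) • (∑ i ∈ Finset.Icc 1 n, F i) + dyadicStep e) τ (cubeMeasure d) := by
      refine eLpNorm_mono_ae ?_
      filter_upwards [ae_mem_halfOpenCube d] with w hw
      obtain ⟨j, y, hy, hwj, hwy⟩ := exists_eq_dil_of_mem_halfOpenCube (k := k) hw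
      have hν := h j (cubeNode d r ν) (cubeNode_mem hr ν) y hy
      rw [Real.norm_eq_abs, dyadicStep_eq _ hwj]
      refine hν.trans (le_trans (le_of_eq ?_) (le_abs_self _))
      simp only [Pi.add_apply, Pi.smul_apply, Finset.sum_apply, smul_eq_mul, dyadicStep_eq _ hwj]
      congr 2
      refine Finset.sum_congr rfl fun i _ => ?_
      simp only [hF, Function.comp_apply, cellContraction, dyadicStep_eq _ hwj]
      congr 2
      rw [hwy, hc]
      simp only [dil]
      module
    refine h1.trans ((eLpNorm_add_le
      ((Finset.aestronglyMeasurable_sum _ fun i _ => hFm i).const_smul (2 ^ n : ℝ))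
      (measurable_dyadicStep e).aestronglyMeasurable hτ).trans (add_le_add ?_ le_rfl))
    rw [eLpNorm_const_smul, Real.enorm_of_nonneg (by positivity),
      ENNReal.ofReal_pow (by positivity), ENNReal.ofReal_ofNat, mul_assoc]
    refine mul_le_mul' le_rfl ((eLpNorm_sum_le (fun i _ => hFm i) hτ).trans ?_)
    have hi : ∀ i ∈ Finset.Icc 1 n, eLpNorm (F i) τ (cubeMeasure d)
        ≤ ENNReal.ofReal (((n : ℝ) * d) ^ d) * eLpNorm g τ (cubeMeasure d) := by
      intro i hi
      rw [Finset.mem_Icc] at hi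
      have hi1 : (1 : ℝ) ≤ i := by exact_mod_cast hi.1
      have hin : (i : ℝ) ≤ n := by exact_mod_cast hi.2
      have hnd : (0 : ℝ) < n * d := by nlinarith
      have e1 : eLpNorm (F i) τ (cubeMeasure d)
          = eLpNorm (g ∘ cellContraction ((i : ℝ) / (n * d)) c) τ (cubeMeasure d) :=
        eLpNorm_norm (g ∘ cellContraction ((i : ℝ) / (n * d)) c)
      rw [e1]
      refine (eLpNorm_comp_cellContraction_le (div_pos (by linarith) hnd)
        ((div_le_one hnd).2 (by nlinarith)) hcQ hg hτ).trans (mul_le_mul' ?_ le_rfl)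
      refine ENNReal.ofReal_le_ofReal (pow_le_pow_left₀ (by positivity) ?_ d)
      rw [inv_div]
      exact div_le_self hnd.le hi1
    refine (Finset.sum_le_sum hi).trans (le_of_eq ?_)
    simp [mul_assoc]
  refine (Finset.sum_le_sum fun ν _ => key ν).trans (le_of_eq ?_)
  simp [mul_add]

/-! ### The rate -/

theorem two_le_besovOrder (s : ℝ) : 2 ≤ besovOrder s := by
  have : 1 ≤ ⌊max s 1⌋₊ := Nat.le_floor (by simp)
  unfold besovOrder
  omega

theorem besovOrder_le {s : ℝ} {r : ℕ} (h : max s 1 < r) : besovOrder s ≤ r :=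
  Nat.succ_le_of_lt ((Nat.floor_lt (zero_le_one.trans (le_max_right _ _))).2 h)

/-- The left side equals N^{-α} with N = 2^{kd}. The grid has at most r^d N points and α ≥ 0, so
replacing N costs r^{dα}, and dα ≤ s ≤ r bounds this independently of s, p and τ. -/
theorem rpow_mul_le_card_rpow_neg_rate {d r : ℕ} (k : ℕ) (hd : 1 ≤ d) (hr : 2 ≤ r) {s : ℝ}
    {p τ : ℝ≥0∞} (hs : d * (p⁻¹).toReal ≤ s) (hsr : s ≤ r) :
    (((2 : ℝ) ^ k) ^ d) ^ max ((p⁻¹).toReal - (τ⁻¹).toReal) 0 * ((1 / 2) ^ k) ^ s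
      ≤ (r : ℝ) ^ (r : ℝ) * ((grid d r k).card : ℝ) ^ (-rate d s p τ) := by
  set E := max ((p⁻¹).toReal - (τ⁻¹).toReal) 0 with hE
  have hd0 : (0 : ℝ) < d := by exact_mod_cast hd
  have hr1 : (1 : ℝ) ≤ r := by exact_mod_cast (by omega : 1 ≤ r)
  have hE0 : 0 ≤ E := le_max_right _ _
  have hEp : E ≤ s / d := by
    have h1 : (p⁻¹).toReal ≤ s / d := by rw [le_div_iff₀ hd0]; linarith
    have h2 : 0 ≤ (p⁻¹).toReal := ENNReal.toReal_nonneg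
    have h3 : 0 ≤ (τ⁻¹).toReal := ENNReal.toReal_nonneg
    exact max_le (by linarith) (by linarith)
  set D := rate d s p τ with hD
  have hDE : D = s / d - E := rfl
  have hD0 : 0 ≤ D := by linarith
  have hdD : d * D ≤ r := by
    have : d * D = s - d * E := by rw [hDE]; field_simp
    nlinarith
  have hm0 : (0 : ℝ) < (grid d r k).card := by exact_mod_cast card_grid_pos hr
  have hm : ((grid d r k).card : ℝ) ≤ (r : ℝ) ^ d * (2 ^ k) ^ d := by
    exact_mod_cast card_grid_le (d := d) (k := k) hr
  have h2k : (0 : ℝ) < 2 ^ k := by positivity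
  have e1 : (((2 : ℝ) ^ k) ^ d) ^ E * ((1 / 2) ^ k) ^ s = ((2 : ℝ) ^ k) ^ (-(d * D)) := by
    rw [one_div, inv_pow, Real.inv_rpow h2k.le, ← Real.rpow_neg h2k.le, ← Real.rpow_natCast _ d,
      ← Real.rpow_mul h2k.le, ← Real.rpow_add h2k, hDE]
    congr 1
    field_simp
    ring
  have e2 : ((grid d r k).card : ℝ) ^ D ≤ (r : ℝ) ^ (r : ℝ) * ((2 : ℝ) ^ k) ^ (d * D) := by
    calc ((grid d r k).card : ℝ) ^ D ≤ ((r : ℝ) ^ d * (2 ^ k) ^ d) ^ D :=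
          Real.rpow_le_rpow hm0.le hm hD0
      _ = (r : ℝ) ^ (d * D) * ((2 : ℝ) ^ k) ^ (d * D) := by
          rw [Real.mul_rpow (by positivity) (by positivity), ← Real.rpow_natCast _ d,
            ← Real.rpow_natCast _ d, ← Real.rpow_mul (by positivity), ← Real.rpow_mul h2k.le]
      _ ≤ _ := by
          gcongr
  rw [e1, Real.rpow_neg h2k.le, Real.rpow_neg hm0.le, ← div_eq_mul_inv,
    le_div_iff₀ (by positivity), inv_mul_le_iff₀ (by positivity), mul_comm]
  exact e2

/-! ### Comparison of norms for functions with differences of a fixed order -/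

/-- The order n of the differences is frozen here because the constants of the local estimates
depend on it. C₁ is fixed before δ. -/
theorem exists_norm_comparison {d r n : ℕ} (hd : 1 ≤ d) (hr : 2 ≤ r) (hn : 1 ≤ n) (hnr : n ≤ r) :
    ∃ C₁ : ℝ≥0, ∀ δ : ℝ, 0 < δ → ∃ C₂ : ℝ≥0,
      ∀ (s : ℝ) (p q : ℝ≥0∞), 0 < p → 0 < q → besovOrder s = n → s ≤ r →
        (d : ℝ) * (p⁻¹).toReal + δ ≤ s →
      ∀ f : EuclideanSpace ℝ (Fin d) → ℝ, MemBesov s p q f →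
      ∃ g : EuclideanSpace ℝ (Fin d) → ℝ, ContinuousOn g (closedCube d) ∧ g =ᵐ[cubeMeasure d] f ∧
        ∀ τ : ℝ≥0∞, 1 ≤ τ → ∀ k : ℕ,
          eLpNorm f τ (cubeMeasure d) ≤ (C₁ : ℝ≥0∞) * discreteNorm r k τ g
              + (C₂ : ℝ≥0∞) * besovNorm s p q f
                * ENNReal.ofReal (((grid d r k).card : ℝ) ^ (-rate d s p τ)) ∧
          discreteNorm r k τ g ≤ (C₁ : ℝ≥0∞) * eLpNorm f τ (cubeMeasure d)
              + (C₂ : ℝ≥0∞) * besovNorm s p q f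
                * ENNReal.ofReal (((grid d r k).card : ℝ) ^ (-rate d s p τ)) := by
  obtain ⟨L, hL1, hL⟩ := exists_pointwise_estimates hd hn hr hnr
  set X₁ : ℝ≥0∞ := ENNReal.ofReal L * ((r : ℝ≥0∞) ^ d * (r : ℝ≥0∞) ^ d) with hX₁
  set X₂ : ℝ≥0∞ := (r : ℝ≥0∞) ^ d * (2 ^ n * (n * ENNReal.ofReal (((n : ℝ) * d) ^ d))) with hX₂
  have hX : X₁ + X₂ ≠ ∞ := by
    refine ENNReal.add_ne_top.2 ⟨?_, ?_⟩ <;>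
    simp [hX₁, hX₂, ENNReal.mul_eq_top]
  refine ⟨(X₁ + X₂).toNNReal, fun δ hδ => ?_⟩
  rw [ENNReal.coe_toNNReal hX]
  -- R = r + δ covers every case: 1/p ≤ d/p ≤ s ≤ r for finite p, and 1/P = δ/(2d) ≤ δ for the
  -- auxiliary exponent when p = ∞.
  obtain ⟨A, hA⟩ := hL δ (r + δ) hδ (by positivity)
  set K : ℝ≥0∞ := A * ENNReal.ofReal ((r : ℝ) ^ (r : ℝ)) with hK
  have hKfin : (r : ℝ≥0∞) ^ d * K ≠ ∞ := by
    simp [hK, ENNReal.mul_eq_top]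
  refine ⟨((r : ℝ≥0∞) ^ d * K).toNNReal, fun s p q hp hq hsn hsr hδs f hf => ?_⟩
  rw [ENNReal.coe_toNNReal hKfin]
  have hd1 : (1 : ℝ) ≤ d := by exact_mod_cast hd
  have hd0 : (0 : ℝ) < d := by linarith
  have hp0 : 0 ≤ (p⁻¹).toReal := ENNReal.toReal_nonneg
  have hs0 : 0 < s := by nlinarith
  have hr1 : (1 : ℝ≥0∞) ≤ (r : ℝ≥0∞) ^ d := one_le_pow₀ (by exact_mod_cast (by omega : 1 ≤ r))
  set f' := hf.1.aestronglyMeasurable.mk f with hf'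
  have hff' : f =ᵐ[cubeMeasure d] f' := hf.1.aestronglyMeasurable.ae_eq_mk
  have hf'm : Measurable f' := hf.1.aestronglyMeasurable.stronglyMeasurable_mk.measurable
  set M := besovSeminorm s p q f with hM
  have hmod : ∀ k l, modulus n p f' ((1 / 2) ^ k * scale l)
      ≤ ENNReal.ofReal (((1 / 2) ^ (k + l)) ^ s) * M := fun k l => by
    rw [hM, besovSeminorm_congr_ae hff', ← hsn]
    exact modulus_scale_le hs0 hq f' k l
  obtain ⟨P, hP, hPR, hPs, hpP, hPinv⟩ : ∃ P : ℝ, 0 < P ∧ 1 / P ≤ r + δ ∧ d / P + δ / 2 ≤ s ∧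
      (p = ∞ ∨ p = ENNReal.ofReal P) ∧ (p = ENNReal.ofReal P → (p⁻¹).toReal = 1 / P) := by
    by_cases hpt : p = ∞
    · subst hpt
      -- With this P one has d / P = δ / 2, which uses exactly half of the margin s ≥ δ.
      refine ⟨2 * d / δ, by positivity, ?_, ?_, Or.inl rfl, fun h => absurd h (by simp)⟩
      · rw [one_div_div, div_le_iff₀ (by positivity)]
        have : (0 : ℝ) ≤ r := by positivity
        nlinarith
      · have : (d : ℝ) / (2 * d / δ) = δ / 2 := by field_simp
        rw [this]
        simp at hδs
        linarith
    · have hP : 0 < p.toReal := ENNReal.toReal_pos hp.ne' hpt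
      have hinv : (p⁻¹).toReal = 1 / p.toReal := by rw [ENNReal.toReal_inv, one_div]
      rw [hinv] at hδs hp0
      refine ⟨p.toReal, hP, by nlinarith, ?_, Or.inr (ENNReal.ofReal_toReal hpt).symm,
        fun _ => hinv⟩
      rw [mul_one_div] at hδs
      linarith
  obtain ⟨g, hgm, hgc, hgf', hest⟩ := hA p M P s f' hf'm hP hPR hPs hpP hf.2.ne hmod
  have hgf : g =ᵐ[cubeMeasure d] f := hgf'.trans hff'.symm
  refine ⟨g, hgc, hgf, fun τ hτ k => ?_⟩
  obtain ⟨e, he0, ha, hb, hetop, hesum⟩ := hest k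
  set ρ := ENNReal.ofReal (((grid d r k).card : ℝ) ^ (-rate d s p τ)) with hρ
  set Y : ℝ≥0∞ := A * (ENNReal.ofReal (((1 / 2) ^ k) ^ s) * M) with hY
  have henorm : ∀ j, ‖e j‖ₑ = ENNReal.ofReal (e j) := fun j => Real.enorm_of_nonneg (he0 j)
  have hstep : eLpNorm (dyadicStep e) τ (cubeMeasure d)
      ≤ ENNReal.ofReal ((((2 : ℝ) ^ k) ^ d) ^ max ((p⁻¹).toReal - (τ⁻¹).toReal) 0) * Y := by
    rcases hpP with hp' | hp'
    · refine (eLpNorm_dyadicStep_top_le e (fun j => (henorm j).trans_le (hetop hp' j)) τ).trans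
        (le_mul_of_one_le_left' (ENNReal.one_le_ofReal.2 (Real.one_le_rpow ?_ (le_max_right _ _))))
      exact one_le_pow₀ (one_le_pow₀ (by norm_num))
    · rw [hPinv hp']
      refine eLpNorm_dyadicStep_le hP hτ ?_
      simpa only [henorm] using hesum hp'
  have hMle : M ≤ besovNorm s p q f := le_add_self
  have herr : eLpNorm (dyadicStep e) τ (cubeMeasure d) ≤ K * besovNorm s p q f * ρ := by
    refine hstep.trans ?_
    calc _ = A * M * ENNReal.ofReal ((((2 : ℝ) ^ k) ^ d) ^ max ((p⁻¹).toReal - (τ⁻¹).toReal) 0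
            * ((1 / 2) ^ k) ^ s) := by
          rw [ENNReal.ofReal_mul (by positivity), hY]
          ring
      _ ≤ A * besovNorm s p q f * (ENNReal.ofReal ((r : ℝ) ^ (r : ℝ)) * ρ) := by
          rw [hρ, ← ENNReal.ofReal_mul (by positivity)]
          exact mul_le_mul' (mul_le_mul' le_rfl hMle) (ENNReal.ofReal_le_ofReal
            (rpow_mul_le_card_rpow_neg_rate k hd hr (by linarith) hsr))
      _ = _ := by rw [hK]; ring
  rw [← eLpNorm_congr_ae hgf]
  constructor
  · refine (eLpNorm_le_discreteNorm hr (by linarith) ha hτ).trans (add_le_add ?_ (herr.trans ?_))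
    · rw [← mul_assoc ((r : ℝ≥0∞) ^ d), ← mul_assoc]
      exact mul_le_mul' le_self_add le_rfl
    · exact mul_le_mul' (mul_le_mul' (le_mul_of_one_le_left' hr1) le_rfl) le_rfl
  · refine (discreteNorm_le_eLpNorm hd hr hgm hb hτ).trans ?_
    rw [mul_add, ← mul_assoc]
    refine add_le_add (mul_le_mul' le_add_self le_rfl) ?_
    refine (mul_le_mul' le_rfl herr).trans (le_of_eq ?_)
    ring

end BesovGrid

/-! ### Constants uniform in the smoothness -/

theorem lemma6p1 (d r : ℕ) (hd : 2 ≤ d) :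
    ∃ C₁ : ℝ≥0, ∀ δ : ℝ, 0 < δ → ∃ C₂ : ℝ≥0,
      ∀ (s : ℝ) (p q : ℝ≥0∞), 0 < p → 0 < q →
        max s 1 < (r : ℝ) → (d : ℝ) * (p⁻¹).toReal + δ ≤ s →
      ∀ f : EuclideanSpace ℝ (Fin d) → ℝ, BesovGrid.MemBesov s p q f →
      ∃ g : EuclideanSpace ℝ (Fin d) → ℝ,
        ContinuousOn g (BesovGrid.closedCube d) ∧
        g =ᵐ[BesovGrid.cubeMeasure d] f ∧
        ∀ τ : ℝ≥0∞, 1 ≤ τ → ∀ k : ℕ,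
          eLpNorm f τ (BesovGrid.cubeMeasure d) ≤
              (C₁ : ℝ≥0∞) * BesovGrid.discreteNorm r k τ g
              + (C₂ : ℝ≥0∞) * BesovGrid.besovNorm s p q f
                * ENNReal.ofReal
                    (((BesovGrid.grid d r k).card : ℝ) ^ (-BesovGrid.rate d s p τ)) ∧
          BesovGrid.discreteNorm r k τ g ≤
              (C₁ : ℝ≥0∞) * eLpNorm f τ (BesovGrid.cubeMeasure d)
              + (C₂ : ℝ≥0∞) * BesovGrid.besovNorm s p q f
                * ENNReal.ofReal
                    (((BesovGrid.grid d r k).card : ℝ) ^ (-BesovGrid.rate d s p τ)) := by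
  rcases Nat.lt_or_ge r 2 with hr | hr
  · refine ⟨0, fun δ _ => ⟨0, fun s p q _ _ hsr => ?_⟩⟩
    have h1 : (r : ℝ) ≤ 1 := by exact_mod_cast (by omega : r ≤ 1)
    exact absurd (hsr.trans_le h1) (not_lt.2 (le_max_right _ _))
  -- The order determined by s lies between 1 and r; for other n no admissible s exists and any
  -- constants will do.
  have hcmp : ∀ n : ℕ, ∃ C₁ : ℝ≥0, ∀ δ : ℝ, 0 < δ → ∃ C₂ : ℝ≥0,
      ∀ (s : ℝ) (p q : ℝ≥0∞), 0 < p → 0 < q → BesovGrid.besovOrder s = n → max s 1 < r →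
        (d : ℝ) * (p⁻¹).toReal + δ ≤ s →
      ∀ f : EuclideanSpace ℝ (Fin d) → ℝ, BesovGrid.MemBesov s p q f →
      ∃ g : EuclideanSpace ℝ (Fin d) → ℝ,
        ContinuousOn g (BesovGrid.closedCube d) ∧ g =ᵐ[BesovGrid.cubeMeasure d] f ∧
        ∀ τ : ℝ≥0∞, 1 ≤ τ → ∀ k : ℕ,
          eLpNorm f τ (BesovGrid.cubeMeasure d) ≤ (C₁ : ℝ≥0∞) * BesovGrid.discreteNorm r k τ g
              + (C₂ : ℝ≥0∞) * BesovGrid.besovNorm s p q f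
                * ENNReal.ofReal
                  (((BesovGrid.grid d r k).card : ℝ) ^ (-BesovGrid.rate d s p τ)) ∧
          BesovGrid.discreteNorm r k τ g ≤ (C₁ : ℝ≥0∞) * eLpNorm f τ (BesovGrid.cubeMeasure d)
              + (C₂ : ℝ≥0∞) * BesovGrid.besovNorm s p q f
                * ENNReal.ofReal
                  (((BesovGrid.grid d r k).card : ℝ) ^ (-BesovGrid.rate d s p τ)) := by
    intro n
    by_cases hn : 1 ≤ n ∧ n ≤ r
    · obtain ⟨C₁, h₁⟩ := BesovGrid.exists_norm_comparison (by omega : 1 ≤ d) hr hn.1 hn.2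
      refine ⟨C₁, fun δ hδ => ?_⟩
      obtain ⟨C₂, h₂⟩ := h₁ δ hδ
      exact ⟨C₂, fun s p q hp hq hsn hsr =>
        h₂ s p q hp hq hsn ((le_max_left _ _).trans hsr.le)⟩
    · refine ⟨0, fun δ _ => ⟨0, fun s p q _ _ hsn hsr => absurd ?_ hn⟩⟩
      rw [← hsn]
      exact ⟨one_le_two.trans (BesovGrid.two_le_besovOrder s), BesovGrid.besovOrder_le hsr⟩
  choose C₁ hC₁ using hcmp
  -- Only finitely many orders occur, so summing over them dominates every single constant and
  -- removes the dependence on s.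
  refine ⟨∑ n ∈ Finset.range (r + 1), C₁ n, fun δ hδ => ?_⟩
  choose C₂ hC₂ using fun n => hC₁ n δ hδ
  refine ⟨∑ n ∈ Finset.range (r + 1), C₂ n, fun s p q hp hq hsr hδs f hf => ?_⟩
  have hmem : BesovGrid.besovOrder s ∈ Finset.range (r + 1) :=
    Finset.mem_range.2 (Nat.lt_succ_of_le (BesovGrid.besovOrder_le hsr))
  have h1 : (C₁ (BesovGrid.besovOrder s) : ℝ≥0∞) ≤ (∑ n ∈ Finset.range (r + 1), C₁ n : ℝ≥0) :=
    ENNReal.coe_le_coe.2 (Finset.single_le_sum (f := C₁) (fun _ _ => zero_le) hmem)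
  have h2 : (C₂ (BesovGrid.besovOrder s) : ℝ≥0∞) ≤ (∑ n ∈ Finset.range (r + 1), C₂ n : ℝ≥0) :=
    ENNReal.coe_le_coe.2 (Finset.single_le_sum (f := C₂) (fun _ _ => zero_le) hmem)
  obtain ⟨g, hgc, hgf, hg⟩ := hC₂ _ s p q hp hq rfl hsr hδs f hf
  refine ⟨g, hgc, hgf, fun τ hτ k => ⟨(hg τ hτ k).1.trans ?_, (hg τ hτ k).2.trans ?_⟩⟩ <;>
  exact add_le_add (mul_le_mul' h1 le_rfl) (mul_le_mul' (mul_le_mul' h2 le_rfl) le_rfl)
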